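/- There is an algorithm which, given a connected, clean $\{P_7,C_3\}$-free graph $G$ on $n$ vertices that contains a $7$-gon, produces a $3$-coloring of $G$ or determines that none exists, in time $O(n^{10})$. Here all graphs are finite and simple. $P_7$ is the path on $7$ vertices, $C_k$ is the cycle of length $k$, and $G$ is $\{P_7,C_3\}$-free if no induced subgraph of $G$ is isomorphic to $P_7$ or $C_3$. A $7$-gon in $G$ is an induced subgraph isomorphic to $C_7$. A vertex $u$ is dominated if there is a vertex $v\neq u$, not adjacent to $u$, with $N(u)\subseteq N(v)$. A vertex $v\notin X$ is mixed on a set $X$ of vertices if it is adjacent to some but not all vertices of $X$. A non-trivial homogeneous pair of stable sets is a pair $(A,B)$ of disjoint non-empty stable sets with $2<|A|+|B|<|V(G)|$ such that no vertex outside $A\cup B$ is mixed on $A$ or mixed on $B$. $G$ is clean if it has no dominated vertex and no non-trivial homogeneous pair of stable sets. A $3$-coloring of $G$ is a map $V(G)\to\{1,2,3\}$ giving adjacent vertices different values. An algorithm is a single program for a word RAM that works for all $n$ and for all word sizes $w\ge c(\lfloor\log_2 n\rfloor+1)$, where $c$ is a constant. It receives $n$ and the adjacency matrix of $G$ (with vertex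 set $\{0,\dots,n-1\}$). Addition, truncated subtraction and multiplication of $w$-bit words (results taken modulo $2^w$), indirect reads and writes, and comparisons cost one step each, and the number of steps is at most $K n^{10}$ for a constant $K$ independent of $G$, $n$ and $w$. -/

import Mathlib

/-! ### Clean graphs -/

namespace CleanGraph

variable {V : Type*}

/-- `u` is dominated: some other vertex `v`, not adjacent to `u`, has `N(u) ⊆ N(v)`. -/
def IsDominated (G : SimpleGraph V) (u : V) : Prop :=
  ∃ v, v ≠ u ∧ ¬ G.Adj u v ∧ G.neighborSet u ⊆ G.neighborSet v

/-- `v` lies outside `X` and is neither complete nor anticomplete to `X`. -/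
def IsMixedOn (G : SimpleGraph V) (v : V) (X : Finset V) : Prop :=
  v ∉ X ∧ ¬ (∀ x ∈ X, G.Adj v x) ∧ ¬ (∀ x ∈ X, ¬ G.Adj v x)

/-- `(A, B)` is a non-trivial homogeneous pair of stable sets. -/
def IsNontrivialHomogeneousPair [Fintype V] (G : SimpleGraph V) (A B : Finset V) : Prop :=
  A.Nonempty ∧ B.Nonempty ∧ Disjoint A B ∧
  G.IsIndepSet (A : Set V) ∧ G.IsIndepSet (B : Set V) ∧
  2 < A.card + B.card ∧ A.card + B.card < Fintype.card V ∧
  ∀ v, v ∉ A → v ∉ B → ¬ IsMixedOn G v A ∧ ¬ IsMixedOn G v B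

/-- No dominated vertex and no non-trivial homogeneous pair of stable sets. -/
def IsClean [Fintype V] (G : SimpleGraph V) : Prop :=
  (∀ u, ¬ IsDominated G u) ∧ ∀ A B, ¬ IsNontrivialHomogeneousPair G A B

end CleanGraph

/-! ### A word RAM

Memory consists of registers and of arrays; a program mentions finitely many of each. Every
cell holds a word of `w` bits, that is, a natural number below `2 ^ w`. Each elementary
instruction, and each evaluation of a test, takes one step. -/

namespace WordRAM

/-- Memory contents: `reg r` is register `r`, and `mem a k` is cell `k` of array `a`. -/
structure State where
  reg : ℕ → ℕ
  mem : ℕ → ℕ → ℕ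

/-- Word arithmetic; the results are reduced modulo `2 ^ w` when they are written. -/
inductive Op where
  | add
  | sub
  | mul

/-- The value of an operation; subtraction is truncated at `0`. -/
def Op.eval : Op → ℕ → ℕ → ℕ
  | .add, x, y => x + y
  | .sub, x, y => x - y
  | .mul, x, y => x * y

/-- Comparisons of two registers. -/
inductive Test where
  | lt (r s : ℕ)
  | eq (r s : ℕ)

/-- The truth of a comparison in a given state. -/
def Test.Holds : Test → State → Prop
  | .lt r s, σ => σ.reg r < σ.reg s
  | .eq r s, σ => σ.reg r = σ.reg s

/-- Programs. Arguments called `r`, `s`, `i` are register numbers, `a` is an array number and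
`k` is a literal; all of them are fixed in the program text. -/
inductive Prog where
  /-- do nothing -/
  | skip
  /-- `r := k` -/
  | const (r k : ℕ)
  /-- `r := r₁ o r₂` -/
  | arith (r : ℕ) (o : Op) (r₁ r₂ : ℕ)
  /-- `r := a[i]`, the index being the content of register `i` -/
  | load (r a i : ℕ)
  /-- `a[i] := r`, the index being the content of register `i` -/
  | store (a i r : ℕ)
  /-- first `p`, then `q` -/
  | seq (p q : Prog)
  /-- `p` if the test holds, else `q` -/
  | branch (b : Test) (p q : Prog)
  /-- repeat `p` as long as the test holds -/
  | loop (b : Test) (p : Prog)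

/-- Write the word `x mod 2 ^ w` into register `r`. -/
def State.setReg (w : ℕ) (σ : State) (r x : ℕ) : State :=
  { σ with reg := Function.update σ.reg r (x % 2 ^ w) }

/-- Write the word `x mod 2 ^ w` into cell `k` of array `a`. -/
def State.setMem (w : ℕ) (σ : State) (a k x : ℕ) : State :=
  { σ with mem := Function.update σ.mem a (Function.update (σ.mem a) k (x % 2 ^ w)) }

/-- `Exec w p σ σ' t`: with word size `w`, program `p` started in state `σ` halts in state `σ'`
after exactly `t` steps. -/
inductive Exec (w : ℕ) : Prog → State → State → ℕ → Prop where
  | skip (σ : State) : Exec w .skip σ σ 1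
  | const (σ : State) (r k : ℕ) : Exec w (.const r k) σ (σ.setReg w r k) 1
  | arith (σ : State) (r : ℕ) (o : Op) (r₁ r₂ : ℕ) :
      Exec w (.arith r o r₁ r₂) σ (σ.setReg w r (o.eval (σ.reg r₁) (σ.reg r₂))) 1
  | load (σ : State) (r a i : ℕ) :
      Exec w (.load r a i) σ (σ.setReg w r (σ.mem a (σ.reg i))) 1
  | store (σ : State) (a i r : ℕ) :
      Exec w (.store a i r) σ (σ.setMem w a (σ.reg i) (σ.reg r)) 1
  | seq {p q : Prog} {σ σ' σ'' : State} {t t' : ℕ} :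
      Exec w p σ σ' t → Exec w q σ' σ'' t' → Exec w (.seq p q) σ σ'' (t + t')
  | branch_true {b : Test} {p q : Prog} {σ σ' : State} {t : ℕ} :
      b.Holds σ → Exec w p σ σ' t → Exec w (.branch b p q) σ σ' (1 + t)
  | branch_false {b : Test} {p q : Prog} {σ σ' : State} {t : ℕ} :
      ¬ b.Holds σ → Exec w q σ σ' t → Exec w (.branch b p q) σ σ' (1 + t)
  | loop_true {b : Test} {p : Prog} {σ σ' σ'' : State} {t t' : ℕ} :
      b.Holds σ → Exec w p σ σ' t → Exec w (.loop b p) σ' σ'' t' →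
      Exec w (.loop b p) σ σ'' (1 + t + t')
  | loop_false {b : Test} {p : Prog} {σ : State} :
      ¬ b.Holds σ → Exec w (.loop b p) σ σ 1

/-- The machine is deterministic: final state and step count are functions of the program, the
word size and the initial state. -/
theorem Exec.deterministic {w : ℕ} {p : Prog} {σ σ₁ σ₂ : State} {t₁ t₂ : ℕ}
    (h₁ : Exec w p σ σ₁ t₁) (h₂ : Exec w p σ σ₂ t₂) : σ₁ = σ₂ ∧ t₁ = t₂ := by
  induction h₁ generalizing σ₂ t₂ with
  | skip | const | arith | load | store => cases h₂; exact ⟨rfl, rfl⟩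
  | seq _ _ ih ih' =>
    cases h₂ with
    | seq h h' =>
      obtain ⟨rfl, rfl⟩ := ih h
      obtain ⟨rfl, rfl⟩ := ih' h'
      exact ⟨rfl, rfl⟩
  | branch_true hb _ ih =>
    cases h₂ with
    | branch_true _ h => obtain ⟨rfl, rfl⟩ := ih h; exact ⟨rfl, rfl⟩
    | branch_false hb' _ => exact absurd hb hb'
  | branch_false hb _ ih =>
    cases h₂ with
    | branch_true hb' _ => exact absurd hb' hb
    | branch_false _ h => obtain ⟨rfl, rfl⟩ := ih h; exact ⟨rfl, rfl⟩
  | loop_true hb _ _ ih ih' =>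
    cases h₂ with
    | loop_true _ h h' =>
      obtain ⟨rfl, rfl⟩ := ih h
      obtain ⟨rfl, rfl⟩ := ih' h'
      exact ⟨rfl, rfl⟩
    | loop_false hb' => exact absurd hb hb'
  | loop_false hb =>
    cases h₂ with
    | loop_true hb' _ _ => exact absurd hb' hb
    | loop_false _ => exact ⟨rfl, rfl⟩

open Classical in
/-- The input: register `0` holds the number `n` of vertices, array `0` holds the adjacency
matrix row by row, and all other cells are `0`. -/
noncomputable def graphInput {n : ℕ} (G : SimpleGraph (Fin n)) : State where
  reg r := if r = 0 then n else 0
  mem a k := if a = 0 ∧ ∃ i j : Fin n, k = n * (i : ℕ) + (j : ℕ) ∧ G.Adj i j then 1 else 0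

/-- The output: either register `0` holds `1` and the first `n` cells of array `1` hold a
`3`-coloring of `G` with colors `1, 2, 3`, or register `0` holds `0` and `G` has no
`3`-coloring. -/
def IsThreeColoringOutput {n : ℕ} (G : SimpleGraph (Fin n)) (σ : State) : Prop :=
  (σ.reg 0 = 1 ∧ ∃ col : G.Coloring (Fin 3), ∀ v : Fin n, σ.mem 1 v = (col v : ℕ) + 1) ∨
  (σ.reg 0 = 0 ∧ ¬ G.Colorable 3)

end WordRAM

/-!
# Coloring clean graphs without `P₇` and `C₃` that contain a `7`-gon

Fix a `7`-gon `C`. Its colorings are constant in number, so one of them may be fixed as well. A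
vertex with a neighbor on `C` then has at most two colors left, but a vertex without one, called
remote, may keep all three. The point is that six further guesses leave at most two colors at
every vertex, after which the problem is of the kind of `2`-satisfiability.

The guesses rest on the following structure. A vertex with neighbors both on `C` and among the
remote vertices meets `C` in one of two patterns (`isPair_or_isTriple`); any other pattern gives
an induced `P₇`. Since the graph has no homogeneous pair of stable sets, a component of the remote
vertices has at most two vertices (`remoteAdj_unique`). Two nonadjacent vertices with disjoint
traces on `C` touch comparable sets of remote components (`touches_comparable`), and two vertices
with a common neighbor on `C` touch comparable sets of components with two vertices
(`touches_mates_comparable`). A numerical weight is strictly monotone for both inclusions. For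
each ordered pair of distinct colors `k`, `c`, guess a heaviest vertex `g k c` of color `c` among
the vertices all of whose neighbors on `C` have color `k`, so that `c` is forbidden at the heavier
ones (if there is no vertex of this kind, a vertex of `C` with color `c` takes its place). If a
remote vertex kept all colors after propagation, then it would be dominated, or its neighbors
would contradict comparability or the choice of the guesses (`IsGuess.exists_forbidden`).

With at most two colors per list no backtracking is needed: give a vertex a color, propagate, and
keep the result unless some list becomes empty. The lists that changed are then single colors that
occur in no neighboring list, so the rest is as colorable as before (`IsSolvable.trial`).

The algorithm is written in a language `WordRAM.Cmd` of loops over the numbers below `n`, for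
which the number of steps is at most a constant times `n ^ depth` (`cost_le`, `exec_compile`). The
six guesses cost six loops, and the solver has depth four: a loop over the vertices to be decided,
one over the rounds of propagation, and two over the pairs of vertices. Searching for the `7`-gon
has depth seven. A coloring is checked before it is accepted, hence a positive answer is always
right (`Sound`), and only the negative answer depends on the structure above.

The registers `2`, `3`, `4` hold `n`, `0`, `1`, the registers `20` to `26` hold the `7`-gon and
the registers `31` to `37` hold the guesses. Array `0` is the input, array `1` the output; array
`2` marks the neighbors of the `7`-gon, array `3` holds the weights, and the arrays `10` to `12`
and `13` to `15` hold forbidden colors, one array for each color.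
-/

namespace CleanGraph

variable {V : Type*} {G : SimpleGraph V}

/-! ### Vertices attached to a `7`-gon -/

/-- A `7`-gon, given by its vertices in cyclic order. -/
def IsGon (G : SimpleGraph V) (C : Fin 7 → V) : Prop :=
  ∀ i j, G.Adj (C i) (C j) ↔ (j = i + 1 ∨ i = j + 1)

/-- The vertices without a neighbor on the `7`-gon `C`. -/
def Remote (G : SimpleGraph V) (C : Fin 7 → V) (x : V) : Prop :=
  ∀ i, ¬ G.Adj x (C i)

theorem exists_isGon (h : (SimpleGraph.cycleGraph 7).IsIndContained G) : ∃ C, IsGon G C := by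
  obtain ⟨f⟩ := h
  refine ⟨f, fun i j => ?_⟩
  rw [f.map_adj_iff, SimpleGraph.cycleGraph_adj]
  revert i j
  decide

/-- Seven vertices with the adjacencies of an induced path are distinct, so they are excluded. -/
theorem false_of_path (h7 : ¬ (SimpleGraph.pathGraph 7).IsIndContained G) {a b c d e f g : V}
    (ab : G.Adj a b) (bc : G.Adj b c) (cd : G.Adj c d) (de : G.Adj d e) (ef : G.Adj e f)
    (fg : G.Adj f g) (ac : ¬ G.Adj a c) (ad : ¬ G.Adj a d) (ae : ¬ G.Adj a e) (af : ¬ G.Adj a f)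
    (ag : ¬ G.Adj a g) (bd : ¬ G.Adj b d) (be : ¬ G.Adj b e) (bf : ¬ G.Adj b f)
    (bg : ¬ G.Adj b g) (ce : ¬ G.Adj c e) (cf : ¬ G.Adj c f) (cg : ¬ G.Adj c g)
    (df : ¬ G.Adj d f) (dg : ¬ G.Adj d g) (eg : ¬ G.Adj e g) : False := by
  apply h7
  have key : ∀ i j, G.Adj (![a, b, c, d, e, f, g] i) (![a, b, c, d, e, f, g] j) ↔
      (SimpleGraph.pathGraph 7).Adj i j := by
    intro i j
    rw [SimpleGraph.pathGraph_adj]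
    fin_cases i <;> fin_cases j <;> simp_all [G.adj_comm]
  refine ⟨⟨⟨_, fun i j hij => ?_⟩, fun {i j} => key i j⟩⟩
  -- distinct vertices of a path on seven vertices have distinct neighborhoods
  have h : ∀ k, (SimpleGraph.pathGraph 7).Adj i k ↔ (SimpleGraph.pathGraph 7).Adj j k := by
    intro k
    rw [← key, ← key, show ![a, b, c, d, e, f, g] i = ![a, b, c, d, e, f, g] j from hij]
  simp only [SimpleGraph.pathGraph_adj] at h
  clear hij key
  revert i j
  decide

theorem not_adj_of_triangleFree (h3 : ¬ (SimpleGraph.cycleGraph 3).IsIndContained G) {a b c : V}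
    (ab : G.Adj a b) (bc : G.Adj b c) : ¬ G.Adj a c := by
  intro ac
  apply h3
  have key : ∀ i j, G.Adj (![a, b, c] i) (![a, b, c] j) ↔
      (SimpleGraph.cycleGraph 3).Adj i j := by
    intro i j
    rw [SimpleGraph.cycleGraph_adj]
    fin_cases i <;> fin_cases j <;> simp_all [G.adj_comm] <;> decide
  refine ⟨⟨⟨_, fun i j hij => ?_⟩, fun {i j} => key i j⟩⟩
  have h : ∀ k, (SimpleGraph.cycleGraph 3).Adj i k ↔ (SimpleGraph.cycleGraph 3).Adj j k := by
    intro k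
    rw [← key, ← key, show ![a, b, c] i = ![a, b, c] j from hij]
  simp only [SimpleGraph.cycleGraph_adj] at h
  clear hij key
  revert i j
  decide

/-- Rotating and reflecting a `7`-gon. -/
theorem IsGon.reparam {C : Fin 7 → V} (hC : IsGon G C) (i : Fin 7) {d : Fin 7}
    (hd : d = 1 ∨ d = 6) : IsGon G (fun k => C (i + k * d)) := by
  intro a b
  simp only [hC _ _]
  clear hC
  rcases hd with rfl | rfl <;> revert i a b <;> decide

theorem Remote.reparam {C : Fin 7 → V} {x : V} (h : Remote G C x) (i d : Fin 7) :
    Remote G (fun k => C (i + k * d)) x := fun k => h (i + k * d)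

theorem IsGon.adj_of {C : Fin 7 → V} (hC : IsGon G C) {i j : Fin 7} (h : j = i + 1 ∨ i = j + 1) :
    G.Adj (C i) (C j) :=
  (hC i j).2 h

theorem IsGon.not_adj_of {C : Fin 7 → V} (hC : IsGon G C) {i j : Fin 7}
    (h : ¬ (j = i + 1 ∨ i = j + 1)) : ¬ G.Adj (C i) (C j) :=
  fun h' => h ((hC i j).1 h')

/-- The neighbors of `y` on `C` are two vertices at distance three on `C`. -/
def IsPair (G : SimpleGraph V) (C : Fin 7 → V) (y : V) (j : Fin 7) : Prop :=
  ∀ i, G.Adj y (C i) ↔ (i = j ∨ i = j + 3)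

/-- The neighbors of `y` on `C` are three vertices, consecutive ones at distance two on `C`. -/
def IsTriple (G : SimpleGraph V) (C : Fin 7 → V) (y : V) (j : Fin 7) : Prop :=
  ∀ i, G.Adj y (C i) ↔ (i = j ∨ i = j + 2 ∨ i = j + 4)

section Paths

variable {C : Fin 7 → V}

/-- If `y` has a remote neighbor, then after a neighbor of `y` on `C`, one of the next four vertices
of `C` is a neighbor too: otherwise there is a path from the remote vertex through `y` along `C`. -/
theorem four_step (h7 : ¬ (SimpleGraph.pathGraph 7).IsIndContained G) (hC : IsGon G C) {x y : V}
    (hx : Remote G C x) (hxy : G.Adj x y) (h0 : G.Adj y (C 0)) (h1 : ¬ G.Adj y (C 1))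
    (h2 : ¬ G.Adj y (C 2)) (h3 : ¬ G.Adj y (C 3)) (h4 : ¬ G.Adj y (C 4)) : False :=
  false_of_path h7 hxy h0 (hC.adj_of (i := 0) (j := 1) (by decide))
    (hC.adj_of (i := 1) (j := 2) (by decide)) (hC.adj_of (i := 2) (j := 3) (by decide))
    (hC.adj_of (i := 3) (j := 4) (by decide)) (hx _) (hx _) (hx _) (hx _) (hx _) h1 h2 h3 h4
    (hC.not_adj_of (by decide)) (hC.not_adj_of (by decide)) (hC.not_adj_of (by decide))
    (hC.not_adj_of (by decide)) (hC.not_adj_of (by decide)) (hC.not_adj_of (by decide))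

/-- As `four_step`, for a path that starts with two remote vertices. -/
theorem three_step (h7 : ¬ (SimpleGraph.pathGraph 7).IsIndContained G) (hC : IsGon G C)
    {w x y : V} (hw : Remote G C w) (hx : Remote G C x) (hwx : G.Adj w x) (hxy : G.Adj x y)
    (hwy : ¬ G.Adj w y) (h0 : G.Adj y (C 0)) (h1 : ¬ G.Adj y (C 1))
    (h2 : ¬ G.Adj y (C 2)) (h3 : ¬ G.Adj y (C 3)) : False :=
  false_of_path h7 hwx hxy h0 (hC.adj_of (i := 0) (j := 1) (by decide))
    (hC.adj_of (i := 1) (j := 2) (by decide)) (hC.adj_of (i := 2) (j := 3) (by decide))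
    hwy (hw _) (hw _) (hw _) (hw _) (hx _) (hx _) (hx _) (hx _) h1 h2 h3
    (hC.not_adj_of (by decide)) (hC.not_adj_of (by decide)) (hC.not_adj_of (by decide))

/-- As `four_step`, for a path that starts with three remote vertices. -/
theorem two_step (h7 : ¬ (SimpleGraph.pathGraph 7).IsIndContained G) (hC : IsGon G C)
    {u w x y : V} (hu : Remote G C u) (hw : Remote G C w) (hx : Remote G C x) (huw : G.Adj u w)
    (hwx : G.Adj w x) (hxy : G.Adj x y) (hux : ¬ G.Adj u x) (huy : ¬ G.Adj u y)
    (hwy : ¬ G.Adj w y) (h0 : G.Adj y (C 0)) (h1 : ¬ G.Adj y (C 1))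
    (h2 : ¬ G.Adj y (C 2)) : False :=
  false_of_path h7 huw hwx hxy h0 (hC.adj_of (i := 0) (j := 1) (by decide))
    (hC.adj_of (i := 1) (j := 2) (by decide)) hux huy (hu _) (hu _) (hu _)
    hwy (hw _) (hw _) (hw _) (hx _) (hx _) (hx _) h1 h2
    (hC.not_adj_of (by decide))

/-- A path that passes from `y` to `y'` through three consecutive vertices of `C` and has a remote
vertex at both ends. -/
theorem cross_step (h7 : ¬ (SimpleGraph.pathGraph 7).IsIndContained G) (hC : IsGon G C)
    {x y x' y' : V} (hx : Remote G C x) (hx' : Remote G C x') (hxy : G.Adj x y)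
    (hxy' : G.Adj x' y') (hxx : ¬ G.Adj x x') (hyy : ¬ G.Adj y y') (h : ¬ G.Adj x y')
    (h' : ¬ G.Adj x' y) (h0 : G.Adj y (C 0)) (h1 : ¬ G.Adj y (C 1)) (h2 : ¬ G.Adj y (C 2))
    (h0' : ¬ G.Adj y' (C 0)) (h1' : ¬ G.Adj y' (C 1)) (h2' : G.Adj y' (C 2)) : False :=
  false_of_path h7 hxy h0 (hC.adj_of (i := 0) (j := 1) (by decide))
    (hC.adj_of (i := 1) (j := 2) (by decide)) h2'.symm hxy'.symm (hx _) (hx _) (hx _) h hxx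
    h1 h2 hyy (fun e => h' e.symm) (hC.not_adj_of (by decide)) (fun e => h0' e.symm)
    (fun e => hx' _ e.symm) (fun e => h1' e.symm) (fun e => hx' _ e.symm) (fun e => hx' _ e.symm)

theorem stable_pattern (h3 : ¬ (SimpleGraph.cycleGraph 3).IsIndContained G) (hC : IsGon G C)
    {y : V} (i : Fin 7) : ¬ (G.Adj y (C i) ∧ G.Adj y (C (i + 1))) :=
  fun h => not_adj_of_triangleFree h3 h.1 (hC.adj_of (Or.inl rfl)) h.2

set_option maxRecDepth 20000 in
/-- A vertex that has neighbors on `C` and a neighbor remote from `C` sees two or three vertices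
of `C`, in one of two ways: any other trace on `C` yields an induced path on seven vertices. -/
theorem isPair_or_isTriple (h7 : ¬ (SimpleGraph.pathGraph 7).IsIndContained G)
    (h3 : ¬ (SimpleGraph.cycleGraph 3).IsIndContained G) (hC : IsGon G C) {x y : V}
    (hx : Remote G C x) (hxy : G.Adj x y) (hy : ¬ Remote G C y) :
    ∃ j, IsPair G C y j ∨ IsTriple G C y j := by
  -- a statement on the subsets of the `7`-gon, checked on all of them
  have key : ∀ s : Fin 7 → Bool, (∃ i, s i = true) → (∀ i, ¬ (s i = true ∧ s (i + 1) = true)) →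
      (∀ i d : Fin 7, (d = 1 ∨ d = 6) → ¬ (s i = true ∧ s (i + d) = false ∧ s (i + 2 * d) = false ∧
        s (i + 3 * d) = false ∧ s (i + 4 * d) = false)) →
      ∃ j, (∀ i, s i = true ↔ (i = j ∨ i = j + 3)) ∨
        (∀ i, s i = true ↔ (i = j ∨ i = j + 2 ∨ i = j + 4)) := by decide
  classical
  have := key (fun i => decide (G.Adj y (C i))) ?_ ?_ ?_
  · simpa [IsPair, IsTriple] using this
  · simpa [Remote] using hy
  · intro i
    simpa using stable_pattern h3 hC i
  · rintro i d hd ⟨h0, h1, h2, h3, h4⟩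
    have hC' := hC.reparam i hd
    refine four_step h7 hC' (hx.reparam i d) hxy ?_ ?_ ?_ ?_ ?_
    · simpa using h0
    · simpa using h1
    · simpa using h2
    · simpa using h3
    · simpa using h4

/-- If moreover the remote neighbor has a remote neighbor, only the second kind occurs. -/
theorem isTriple_of_edge (h7 : ¬ (SimpleGraph.pathGraph 7).IsIndContained G)
    (h3 : ¬ (SimpleGraph.cycleGraph 3).IsIndContained G) (hC : IsGon G C) {w x y : V}
    (hw : Remote G C w) (hx : Remote G C x) (hwx : G.Adj w x) (hxy : G.Adj x y)
    (hy : ¬ Remote G C y) : ∃ j, IsTriple G C y j := by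
  obtain ⟨j, h | h⟩ := isPair_or_isTriple h7 h3 hC hx hxy hy
  · refine (three_step h7 (hC.reparam j (d := 6) (Or.inr rfl)) (hw.reparam j 6) (hx.reparam j 6)
      hwx hxy (not_adj_of_triangleFree h3 hwx hxy) ?_ ?_ ?_ ?_).elim
    all_goals
      rw [h]
      clear h
      revert j
      decide
  · exact ⟨j, h⟩

/-- No induced path on four vertices starts at a vertex that sees `C` and continues remotely. -/
theorem adj_of_remote_walk (h7 : ¬ (SimpleGraph.pathGraph 7).IsIndContained G)
    (h3 : ¬ (SimpleGraph.cycleGraph 3).IsIndContained G) (hC : IsGon G C) {u w x y : V}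
    (hu : Remote G C u) (hw : Remote G C w) (hx : Remote G C x) (huw : G.Adj u w)
    (hwx : G.Adj w x) (hxy : G.Adj x y) (hy : ¬ Remote G C y) : G.Adj u y := by
  by_contra huy
  obtain ⟨j, h⟩ := isTriple_of_edge h7 h3 hC hw hx hwx hxy hy
  refine two_step h7 (hC.reparam j (d := 6) (Or.inr rfl)) (hu.reparam j 6) (hw.reparam j 6)
    (hx.reparam j 6) huw hwx hxy (not_adj_of_triangleFree h3 huw hwx) huy
    (not_adj_of_triangleFree h3 hwx hxy) ?_ ?_ ?_
  all_goals
    rw [h]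
    clear h
    revert j
    decide

/-- Two vertices with disjoint traces on `C` and with private remote neighbors that are not
adjacent to each other are adjacent. -/
theorem adj_of_private_neighbors (h7 : ¬ (SimpleGraph.pathGraph 7).IsIndContained G)
    (h3 : ¬ (SimpleGraph.cycleGraph 3).IsIndContained G) (hC : IsGon G C)
    {x y x' y' : V} (hx : Remote G C x) (hx' : Remote G C x') (hxy : G.Adj x y)
    (hxy' : G.Adj x' y') (hxx : ¬ G.Adj x x') (h : ¬ G.Adj x y')
    (h' : ¬ G.Adj x' y) (hy : ¬ Remote G C y) (hy' : ¬ Remote G C y')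
    (hd : ∀ i, ¬ (G.Adj y (C i) ∧ G.Adj y' (C i))) : G.Adj y y' := by
  by_contra hyy
  have key : ∃ i d : Fin 7, (d = 1 ∨ d = 6) ∧ G.Adj y (C i) ∧ ¬ G.Adj y (C (i + 1 * d)) ∧
      ¬ G.Adj y (C (i + 2 * d)) ∧ ¬ G.Adj y' (C i) ∧ ¬ G.Adj y' (C (i + 1 * d)) ∧
      G.Adj y' (C (i + 2 * d)) := by
    obtain ⟨j, hj | hj⟩ := isPair_or_isTriple h7 h3 hC hx hxy hy <;>
    obtain ⟨j', hj' | hj'⟩ := isPair_or_isTriple h7 h3 hC hx' hxy' hy' <;>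
    · simp only [hj _, hj' _] at hd ⊢
      clear hj hj'
      revert j j'
      decide
  obtain ⟨i, d, hd, h0, h1, h2, h0', h1', h2'⟩ := key
  exact cross_step h7 (hC.reparam i hd) (hx.reparam i d) (hx'.reparam i d) hxy hxy' hxx hyy h h'
    (by simpa using h0) h1 h2 (by simpa using h0') h1' h2'

/-- Two vertices with a common neighbor on `C` do not have private remote edges. -/
theorem false_of_private_edges (h7 : ¬ (SimpleGraph.pathGraph 7).IsIndContained G)
    (h3 : ¬ (SimpleGraph.cycleGraph 3).IsIndContained G)
    {a b y a' b' y' : V} {i : Fin 7} (ha : Remote G C a) (hb : Remote G C b)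
    (ha' : Remote G C a') (hb' : Remote G C b') (hab : G.Adj a b) (hab' : G.Adj a' b')
    (hay : G.Adj a y) (hay' : G.Adj a' y') (hyi : G.Adj y (C i)) (hyi' : G.Adj y' (C i))
    (h1 : ¬ G.Adj a y') (h2 : ¬ G.Adj b y') (h3' : ¬ G.Adj a' y) (h4 : ¬ G.Adj b' y)
    (haa : ¬ G.Adj a a') (hab2 : ¬ G.Adj a b') (hba : ¬ G.Adj b a') (hbb : ¬ G.Adj b b') :
    False :=
  false_of_path h7 hab.symm hay hyi hyi'.symm hay'.symm hab'
    (not_adj_of_triangleFree h3 hab.symm hay) (hb _) h2 hba hbb (ha _) h1 haa hab2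
    (not_adj_of_triangleFree h3 hyi hyi'.symm) (fun e => h3' e.symm) (fun e => h4 e.symm)
    (fun e => ha' _ e.symm) (fun e => hb' _ e.symm)
    (not_adj_of_triangleFree h3 hay'.symm hab')

set_option maxRecDepth 20000 in
/-- The vertices with a remote neighbor whose trace lies in a fixed stable subset of `C` have a
common neighbor on `C`. -/
theorem exists_common_trace (s : Fin 7 → Bool)
    (hs : ∀ i, ¬ (s i = true ∧ s (i + 1) = true)) :
    ∃ v : Fin 7, ∀ j : Fin 7, ((s j = true ∧ s (j + 3) = true) → (v = j ∨ v = j + 3)) ∧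
      ((s j = true ∧ s (j + 2) = true ∧ s (j + 4) = true) →
        (v = j ∨ v = j + 2 ∨ v = j + 4)) := by
  revert s
  decide

end Paths

/-! ### Components of the remote vertices -/

/-- Adjacency between remote vertices. -/
def RemoteAdj (G : SimpleGraph V) (C : Fin 7 → V) (u v : V) : Prop :=
  Remote G C u ∧ Remote G C v ∧ G.Adj u v

theorem not_remote_gon {C : Fin 7 → V} (hC : IsGon G C) (i : Fin 7) : ¬ Remote G C (C i) :=
  fun h => h (i + 1) (hC.adj_of (Or.inl rfl))

theorem RemoteAdj.symm {C : Fin 7 → V} {u v : V} (h : RemoteAdj G C u v) : RemoteAdj G C v u :=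
  ⟨h.2.1, h.1, h.2.2.symm⟩

theorem reflTransGen_remoteAdj_symm {C : Fin 7 → V} {u v : V}
    (h : Relation.ReflTransGen (RemoteAdj G C) u v) :
    Relation.ReflTransGen (RemoteAdj G C) v u := by
  induction h with
  | refl => exact .refl
  | tail _ h ih => exact .head h.symm ih

theorem remote_of_reflTransGen {C : Fin 7 → V} {u v : V} (hu : Remote G C u)
    (h : Relation.ReflTransGen (RemoteAdj G C) u v) : Remote G C v := by
  induction h with
  | refl => exact hu
  | tail _ h _ => exact h.2.1

/-- By connectivity, every component of the remote vertices has a neighbor that is not remote. -/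
theorem exists_attached (hconn : G.Connected) {C : Fin 7 → V} (hC : IsGon G C) {x : V}
    (hx : Remote G C x) :
    ∃ k y, Relation.ReflTransGen (RemoteAdj G C) x k ∧ G.Adj k y ∧ ¬ Remote G C y := by
  by_contra! hcon
  have hr := (SimpleGraph.reachable_iff_reflTransGen x (C 0)).1 (hconn.preconnected x (C 0))
  have : ∀ v, Relation.ReflTransGen G.Adj x v → Relation.ReflTransGen (RemoteAdj G C) x v := by
    intro v hv
    induction hv with
    | refl => exact .refl
    | @tail b c _ h ih =>
      exact ih.tail ⟨remote_of_reflTransGen hx ih, hcon b c ih h, h⟩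
  exact not_remote_gon hC 0 (remote_of_reflTransGen hx (this _ hr))

/-- A vertex with neighbors on `C` that is attached to a component of the remote vertices is
adjacent to exactly one end of each edge of the component. -/
theorem adj_iff_not_adj_of_attached (h7 : ¬ (SimpleGraph.pathGraph 7).IsIndContained G)
    (h3 : ¬ (SimpleGraph.cycleGraph 3).IsIndContained G) {C : Fin 7 → V} (hC : IsGon G C)
    {k₀ k k' y : V} (hy : ¬ Remote G C y) (hy₀ : G.Adj k₀ y)
    (hk : Relation.ReflTransGen (RemoteAdj G C) k₀ k) (hkk : RemoteAdj G C k k') :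
    G.Adj k y ↔ ¬ G.Adj k' y := by
  -- `y` stays within distance two of every vertex of the component
  have hQ : G.Adj k y ∨ ∃ k₁, RemoteAdj G C k k₁ ∧ G.Adj k₁ y := by
    clear hkk
    induction hk with
    | refl => exact Or.inl hy₀
    | @tail b c _ h ih =>
      rcases ih with ih | ⟨k₁, h₁, h₂⟩
      · exact Or.inr ⟨b, h.symm, ih⟩
      · exact Or.inl (adj_of_remote_walk h7 h3 hC h.2.1 h.1 h₁.2.1 h.2.2.symm h₁.2.2 h₂ hy)
  constructor
  · intro h h'
    exact not_adj_of_triangleFree h3 hkk.2.2 h' h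
  · intro h
    rcases hQ with hQ | ⟨k₁, h₁, h₂⟩
    · exact hQ
    · exact (h (adj_of_remote_walk h7 h3 hC hkk.2.1 hkk.1 h₁.2.1 hkk.2.2.symm h₁.2.2 h₂ hy)).elim

/-- In a clean graph the remote vertices induce a graph of maximum degree at most one: the two
sides of a larger component would form a homogeneous pair of stable sets. -/
theorem remoteAdj_unique [Fintype V] (hclean : IsClean G) (hconn : G.Connected)
    (h7 : ¬ (SimpleGraph.pathGraph 7).IsIndContained G)
    (h3 : ¬ (SimpleGraph.cycleGraph 3).IsIndContained G) {C : Fin 7 → V} (hC : IsGon G C)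
    {x a b : V} (hxa : RemoteAdj G C x a) (hxb : RemoteAdj G C x b) : a = b := by
  classical
  by_contra hab
  have hx := hxa.1
  obtain ⟨k₀, y, hk₀, hky, hy⟩ := exists_attached hconn hC hx
  -- the component of `x`, and its sides according to adjacency to `y`
  set K : Finset V := Finset.univ.filter (fun k => Relation.ReflTransGen (RemoteAdj G C) x k)
    with hK
  have memK : ∀ k, k ∈ K ↔ Relation.ReflTransGen (RemoteAdj G C) x k := by simp [hK]
  have alt : ∀ v l, ¬ Remote G C v → l ∈ K → G.Adj l v → ∀ k k', k ∈ K → RemoteAdj G C k k' →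
      (G.Adj k v ↔ ¬ G.Adj k' v) := by
    intro v l hv hl hlv k k' hk hkk
    have hl' := (memK l).1 hl
    exact adj_iff_not_adj_of_attached h7 h3 hC hv hlv
      ((reflTransGen_remoteAdj_symm hl').trans ((memK k).1 hk)) hkk
  have alty := alt y k₀ hy ((memK _).2 hk₀) hky
  have memKr : ∀ k, k ∈ K → Remote G C k := fun k hk => remote_of_reflTransGen hx ((memK k).1 hk)
  refine hclean.2 (K.filter (fun k => G.Adj k y)) (K.filter (fun k => ¬ G.Adj k y))
    ⟨⟨k₀, by simp [memK, hk₀, hky]⟩, ?_, Finset.disjoint_filter_filter_not _ _ _, ?_, ?_, ?_, ?_,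
      ?_⟩
  · by_cases h : G.Adj x y
    · have := (alty x a ((memK x).2 .refl) hxa).1 h
      exact ⟨a, by simp [memK, this, Relation.ReflTransGen.single hxa]⟩
    · exact ⟨x, by simp [memK, h, Relation.ReflTransGen.refl]⟩
  · intro u hu v hv _ huv
    simp only [Finset.coe_filter, Set.mem_ofPred_eq] at hu hv
    exact (alty u v hu.1 ⟨memKr u hu.1, memKr v hv.1, huv⟩).1 hu.2 hv.2
  · intro u hu v hv _ huv
    simp only [Finset.coe_filter, Set.mem_ofPred_eq] at hu hv
    exact hu.2 ((alty u v hu.1 ⟨memKr u hu.1, memKr v hv.1, huv⟩).2 hv.2)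
  · rw [Finset.card_filter_add_card_filter_not]
    have hsub : ({x, a, b} : Finset V) ⊆ K := by
      intro v hv
      simp only [Finset.mem_insert, Finset.mem_singleton] at hv
      rw [memK]
      rcases hv with rfl | rfl | rfl
      · exact .refl
      · exact .single hxa
      · exact .single hxb
    have hcard : ({x, a, b} : Finset V).card = 3 :=
      Finset.card_eq_three.2 ⟨x, a, b, hxa.2.2.ne, hxb.2.2.ne, hab, rfl⟩
    have := Finset.card_le_card hsub
    omega
  · rw [Finset.card_filter_add_card_filter_not, ← Finset.card_univ]
    refine Finset.card_lt_card (Finset.ssubset_univ_iff.2 fun h => ?_)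
    exact not_remote_gon hC 0 (memKr _ (h ▸ Finset.mem_univ _))
  · intro v hvA hvB
    have hvK : v ∉ K := by
      intro h
      by_cases h' : G.Adj v y
      · exact hvA (by simp [h, h'])
      · exact hvB (by simp [h, h'])
    -- `v` sees either nothing, or one side of the bipartition, or the other one
    have key : (∀ k ∈ K, ¬ G.Adj v k) ∨ (∀ k ∈ K, (G.Adj v k ↔ G.Adj k y)) ∨
        (∀ k ∈ K, (G.Adj v k ↔ ¬ G.Adj k y)) := by
      by_cases hne : ∀ k ∈ K, ¬ G.Adj v k
      · exact Or.inl hne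
      right
      push Not at hne
      obtain ⟨l, hl, hvl⟩ := hne
      have hv : ¬ Remote G C v := by
        intro hv
        exact hvK ((memK v).2 (((memK l).1 hl).tail ⟨memKr l hl, hv, hvl.symm⟩))
      have altv := alt v l hv hl hvl.symm
      have hall : ∀ k, Relation.ReflTransGen (RemoteAdj G C) x k →
          ((G.Adj k v ↔ G.Adj k y) ↔ (G.Adj x v ↔ G.Adj x y)) := by
        intro k hk
        induction hk with
        | refl => exact Iff.rfl
        | @tail b c hb h ih =>
          rw [← ih, altv b c ((memK b).2 hb) h, alty b c ((memK b).2 hb) h, not_iff_not]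
      by_cases h : G.Adj x v ↔ G.Adj x y
      · left
        intro k hk
        rw [G.adj_comm v]
        exact (hall k ((memK k).1 hk)).2 h
      · right
        intro k hk
        rw [G.adj_comm v]
        have := hall k ((memK k).1 hk)
        tauto
    unfold IsMixedOn
    simp only [Finset.mem_filter]
    rcases key with key | key | key
    · exact ⟨fun h => h.2.2 fun k hk => key k hk.1, fun h => h.2.2 fun k hk => key k hk.1⟩
    · exact ⟨fun h => h.2.1 fun k hk => (key k hk.1).2 hk.2,
        fun h => h.2.2 fun k hk h' => hk.2 ((key k hk.1).1 h')⟩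
    · exact ⟨fun h => h.2.2 fun k hk h' => (key k hk.1).1 h' hk.2,
        fun h => h.2.1 fun k hk => (key k hk.1).2 hk.2⟩

/-! ### Touching remote components -/

/-- `y` has a neighbor in the component of the remote vertex `x` (a component has at most two
vertices). -/
def Touches (G : SimpleGraph V) (C : Fin 7 → V) (y x : V) : Prop :=
  Remote G C x ∧ (G.Adj y x ∨ ∃ z, Remote G C z ∧ G.Adj x z ∧ G.Adj y z)

/-- `x` has a remote neighbor. -/
def HasMate (G : SimpleGraph V) (C : Fin 7 → V) (x : V) : Prop :=
  ∃ z, Remote G C z ∧ G.Adj x z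

open Classical in
/-- The remote vertices in components touched by `y`, counted so that a single vertex with a mate
outweighs all vertices without one. -/
noncomputable def weight [Fintype V] (G : SimpleGraph V) (C : Fin 7 → V) (y : V) : ℕ :=
  ∑ x with Touches G C y x, (1 + if HasMate G C x then Fintype.card V else 0)

theorem not_touches_gon {C : Fin 7 → V} (i : Fin 7) (x : V) :
    ¬ Touches G C (C i) x := by
  rintro ⟨hx, h | ⟨z, hz, _, h⟩⟩
  · exact hx i h.symm
  · exact hz i h.symm

theorem weight_lt_of_ssubset [Fintype V] {C : Fin 7 → V} {p y x : V}
    (h : ∀ z, Touches G C p z → Touches G C y z) (hy : Touches G C y x)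
    (hp : ¬ Touches G C p x) : weight G C p < weight G C y := by
  classical
  unfold weight
  refine Finset.sum_lt_sum_of_subset (i := x) (fun z hz => ?_) (by simpa using hy)
    (by simpa using hp) (by omega) (fun _ _ _ => Nat.zero_le _)
  simp only [Finset.mem_filter, Finset.mem_univ, true_and] at hz ⊢
  exact h z hz

/-- The remote vertices with a mate decide the comparison of weights: the others contribute less
than a single one of them. -/
theorem weight_lt_of_mates [Fintype V] {C : Fin 7 → V} {p y x : V}
    (h : ∀ z, HasMate G C z → Touches G C p z → Touches G C y z) (hx : HasMate G C x)
    (hy : Touches G C y x) (hp : ¬ Touches G C p x) : weight G C p < weight G C y := by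
  classical
  have expand : ∀ v, weight G C v = (Finset.univ.filter (Touches G C v)).card +
      Fintype.card V * (Finset.univ.filter fun z => Touches G C v z ∧ HasMate G C z).card := by
    intro v
    unfold weight
    rw [Finset.sum_add_distrib, ← Finset.sum_filter, Finset.filter_filter]
    simp [mul_comm]
  have h1 : (Finset.univ.filter (Touches G C p)).card < Fintype.card V := by
    rw [← Finset.card_univ]
    refine Finset.card_lt_card (Finset.ssubset_univ_iff.2 fun h => hp ?_)
    have := Finset.mem_univ x
    rw [← h] at this
    simpa using this
  have h2 : (Finset.univ.filter fun z => Touches G C p z ∧ HasMate G C z).card <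
      (Finset.univ.filter fun z => Touches G C y z ∧ HasMate G C z).card := by
    refine Finset.card_lt_card ((Finset.ssubset_iff_of_subset fun z hz => ?_).2 ⟨x, ?_, ?_⟩)
    · simp only [Finset.mem_filter, Finset.mem_univ, true_and] at hz ⊢
      exact ⟨h z hz.2 hz.1, hz.2⟩
    · simp [hy, hx]
    · simp [hp]
  rw [expand p, expand y]
  nlinarith [Nat.mul_le_mul_left (Fintype.card V) h2]

section Comparable

variable {C : Fin 7 → V}

/-- A component touched by `y` and not by `y'` has a vertex adjacent to `y`. -/
theorem exists_private_neighbor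
    (hU : ∀ {x a b : V}, RemoteAdj G C x a → RemoteAdj G C x b → a = b) {y y' x : V}
    (h : Touches G C y x) (h' : ¬ Touches G C y' x) :
    ∃ a, Remote G C a ∧ G.Adj a y ∧ ¬ Touches G C y' a ∧ (HasMate G C x → HasMate G C a) := by
  obtain ⟨hx, hyx | ⟨z, hz, hxz, hyz⟩⟩ := h
  · exact ⟨x, hx, hyx.symm, h', id⟩
  · refine ⟨z, hz, hyz.symm, ?_, fun _ => ⟨x, hx, hxz.symm⟩⟩
    rintro ⟨_, h | ⟨w, hw, hzw, hyw⟩⟩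
    · exact h' ⟨hx, Or.inr ⟨z, hz, hxz, h⟩⟩
    · obtain rfl := hU ⟨hz, hx, hxz.symm⟩ ⟨hz, hw, hzw⟩
      exact h' ⟨hx, Or.inl hyw⟩

/-- Otherwise private neighbors in two remote components yield an induced path. -/
theorem touches_comparable (h7 : ¬ (SimpleGraph.pathGraph 7).IsIndContained G)
    (h3 : ¬ (SimpleGraph.cycleGraph 3).IsIndContained G) (hC : IsGon G C)
    (hU : ∀ {x a b : V}, RemoteAdj G C x a → RemoteAdj G C x b → a = b) {y y' : V}
    (hy : ¬ Remote G C y) (hy' : ¬ Remote G C y') (hyy : ¬ G.Adj y y')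
    (hd : ∀ i, ¬ (G.Adj y (C i) ∧ G.Adj y' (C i))) :
    (∀ x, Touches G C y x → Touches G C y' x) ∨ (∀ x, Touches G C y' x → Touches G C y x) := by
  by_contra! hcon
  obtain ⟨⟨x, hx, hx'⟩, ⟨x', hx₁, hx₁'⟩⟩ := hcon
  obtain ⟨a, ha, hay, hay', -⟩ := exists_private_neighbor hU hx hx'
  obtain ⟨b, hb, hby, hby', -⟩ := exists_private_neighbor hU hx₁ hx₁'
  exact hyy (adj_of_private_neighbors h7 h3 hC ha hb hay hby
    (fun e => hay' ⟨ha, Or.inr ⟨b, hb, e, hby.symm⟩⟩) (fun e => hay' ⟨ha, Or.inl e.symm⟩)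
    (fun e => hby' ⟨hb, Or.inl e.symm⟩) hy hy' hd)

/-- Otherwise private edges of the remote graph yield an induced path through the common
neighbor. -/
theorem touches_mates_comparable (h7 : ¬ (SimpleGraph.pathGraph 7).IsIndContained G)
    (h3 : ¬ (SimpleGraph.cycleGraph 3).IsIndContained G)
    (hU : ∀ {x a b : V}, RemoteAdj G C x a → RemoteAdj G C x b → a = b) {y y' : V} {i : Fin 7}
    (hy : G.Adj y (C i)) (hy' : G.Adj y' (C i)) :
    (∀ x, HasMate G C x → Touches G C y x → Touches G C y' x) ∨
      (∀ x, HasMate G C x → Touches G C y' x → Touches G C y x) := by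
  by_contra! hcon
  obtain ⟨⟨x, hxm, hx, hx'⟩, ⟨x', hxm', hx₁, hx₁'⟩⟩ := hcon
  obtain ⟨a, ha, hay, hay', ham⟩ := exists_private_neighbor hU hx hx'
  obtain ⟨a', ha', hay₁, hay₁', ham'⟩ := exists_private_neighbor hU hx₁ hx₁'
  obtain ⟨b, hb, hab⟩ := ham hxm
  obtain ⟨b', hb', hab'⟩ := ham' hxm'
  have haa : ¬ G.Adj a a' := fun e => hay' ⟨ha, Or.inr ⟨a', ha', e, hay₁.symm⟩⟩
  have hne : a ≠ a' := by
    rintro rfl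
    exact hay' ⟨ha, Or.inl hay₁.symm⟩
  refine false_of_private_edges h7 h3 ha hb ha' hb' hab hab' hay hay₁ hy hy'
    (fun e => hay' ⟨ha, Or.inl e.symm⟩) (fun e => hay' ⟨ha, Or.inr ⟨b, hb, hab, e.symm⟩⟩)
    (fun e => hay₁' ⟨ha', Or.inl e.symm⟩) (fun e => hay₁' ⟨ha', Or.inr ⟨b', hb', hab', e.symm⟩⟩)
    haa (fun e => ?_) (fun e => ?_) (fun e => ?_)
  · exact hne (hU ⟨hb', ha, e.symm⟩ ⟨hb', ha', hab'.symm⟩)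
  · exact hne (hU ⟨hb, ha, hab.symm⟩ ⟨hb, ha', e⟩)
  · obtain rfl := hU ⟨hb, ha, hab.symm⟩ ⟨hb, hb', e⟩
    exact haa hab'.symm

end Comparable

/-! ### Forbidden colors -/

/-- Some neighbor of `y` on `C` has color `c`. -/
def SeesColor (G : SimpleGraph V) (C : Fin 7 → V) (κ : Fin 7 → Fin 3) (c : Fin 3) (y : V) : Prop :=
  ∃ i, κ i = c ∧ G.Adj y (C i)

/-- The neighbors of `y` on `C` all have color `k`, and there is one. -/
def SeesOnly (G : SimpleGraph V) (C : Fin 7 → V) (κ : Fin 7 → Fin 3) (k : Fin 3) (y : V) : Prop :=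
  ∀ c, SeesColor G C κ c y ↔ c = k

/-- Color `c` is forbidden at `y` once `C` is colored by `κ` and the vertex `g k c'` is guessed to
be a heaviest vertex of color `c'` among those that see only color `k` on `C`. -/
def Forbidden [Fintype V] (G : SimpleGraph V) (C : Fin 7 → V) (κ : Fin 7 → Fin 3)
    (g : Fin 3 → Fin 3 → V) (c : Fin 3) (y : V) : Prop :=
  SeesColor G C κ c y ∨ (∃ i, y = C i ∧ c ≠ κ i) ∨ (∃ k c', k ≠ c' ∧ y = g k c' ∧ c ≠ c') ∨
    (∃ k, k ≠ c ∧ SeesOnly G C κ k y ∧ weight G C (g k c) < weight G C y)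

/-- Forbidden colors are propagated: a vertex with two forbidden colors forbids the third one at
its neighbors. -/
def IsPropagated (G : SimpleGraph V) (F : Fin 3 → V → Prop) : Prop :=
  ∀ c u v, G.Adj u v → F (c + 1) u → F (c + 2) u → F c v

theorem SeesOnly.not_remote {C : Fin 7 → V} {κ : Fin 7 → Fin 3} {k : Fin 3} {y : V}
    (h : SeesOnly G C κ k y) : ¬ Remote G C y := by
  obtain ⟨i, -, hi⟩ := (h k).2 rfl
  exact fun h' => h' i hi

theorem SeesOnly.color_eq {C : Fin 7 → V} {κ : Fin 7 → Fin 3} {k : Fin 3} {y : V}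
    (h : SeesOnly G C κ k y) {i : Fin 7} (hi : G.Adj y (C i)) : κ i = k :=
  (h _).1 ⟨i, rfl, hi⟩

theorem SeesOnly.disjoint {C : Fin 7 → V} {κ : Fin 7 → Fin 3} {k l : Fin 3} {y y' : V}
    (h : SeesOnly G C κ k y) (h' : SeesOnly G C κ l y') (hkl : k ≠ l) (i : Fin 7) :
    ¬ (G.Adj y (C i) ∧ G.Adj y' (C i)) :=
  fun hi => hkl ((h.color_eq hi.1).symm.trans (h'.color_eq hi.2))

theorem IsGon.exists_color_eq {C : Fin 7 → V} (hC : IsGon G C) (col : G.Coloring (Fin 3))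
    (c : Fin 3) : ∃ i, col (C i) = c := by
  by_contra! h
  have step : ∀ i, col (C i) = col (C (i + 1 + 1)) := by
    intro i
    have h1 := col.valid (hC.adj_of (i := i) (j := i + 1) (Or.inl rfl))
    have h2 := col.valid (hC.adj_of (i := i + 1) (j := i + 1 + 1) (Or.inl rfl))
    have aux : ∀ c a b d : Fin 3, ¬ (a ≠ c ∧ b ≠ c ∧ d ≠ c ∧ a ≠ b ∧ b ≠ d ∧ a ≠ d) := by decide
    by_contra hne
    exact aux c _ _ _ ⟨h _, h _, h _, h1, h2, hne⟩
  exact col.valid (hC.adj_of (i := 0) (j := 6) (by decide))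
    ((step 0).trans ((step 2).trans (step 4)))

/-- The vertices with a remote neighbor that see only color `k` have a common neighbor on `C`. -/
theorem exists_common_neighbor (h7 : ¬ (SimpleGraph.pathGraph 7).IsIndContained G)
    (h3 : ¬ (SimpleGraph.cycleGraph 3).IsIndContained G) {C : Fin 7 → V} (hC : IsGon G C)
    (col : G.Coloring (Fin 3)) (k : Fin 3) :
    ∃ v, ∀ x y, Remote G C x → G.Adj x y → SeesOnly G C (fun i => col (C i)) k y →
      G.Adj y (C v) := by
  obtain ⟨v, hv⟩ := exists_common_trace (fun i => decide (col (C i) = k)) (fun i hi => by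
    simp only [decide_eq_true_eq] at hi
    exact col.valid (hC.adj_of (i := i) (j := i + 1) (Or.inl rfl)) (hi.1.trans hi.2.symm))
  refine ⟨v, fun x y hx hxy hy => ?_⟩
  simp only [decide_eq_true_eq] at hv
  obtain ⟨j, hj | hj⟩ := isPair_or_isTriple h7 h3 hC hx hxy hy.not_remote
  · exact (hj v).2 ((hv j).1 ⟨hy.color_eq ((hj _).2 (by simp)), hy.color_eq ((hj _).2 (by simp))⟩)
  · exact (hj v).2 ((hv j).2 ⟨hy.color_eq ((hj _).2 (by simp)), hy.color_eq ((hj _).2 (by simp)),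
      hy.color_eq ((hj _).2 (by simp))⟩)

/-- The guesses that a coloring justifies. The guessed vertex may lie on `C`, where it touches no
remote component and has weight `0`; this covers the case that no vertex qualifies. -/
structure IsGuess [Fintype V] (G : SimpleGraph V) (C : Fin 7 → V) (col : G.Coloring (Fin 3))
    (g : Fin 3 → Fin 3 → V) : Prop where
  mem : ∀ k c, SeesOnly G C (fun i => col (C i)) k (g k c) ∨ ∃ i, g k c = C i
  color : ∀ k c, col (g k c) = c
  weight_le : ∀ k y, SeesOnly G C (fun i => col (C i)) k y →
    weight G C y ≤ weight G C (g k (col y))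

theorem exists_isGuess [Fintype V] {C : Fin 7 → V} (hC : IsGon G C) (col : G.Coloring (Fin 3)) :
    ∃ g, IsGuess G C col g := by
  classical
  have : ∀ k c, ∃ p, ((SeesOnly G C (fun i => col (C i)) k p ∨ ∃ i, p = C i) ∧ col p = c) ∧
      ∀ y, SeesOnly G C (fun i => col (C i)) k y → col y = c → weight G C y ≤ weight G C p := by
    intro k c
    obtain ⟨i, hi⟩ := hC.exists_color_eq col c
    obtain ⟨p, hp, hmax⟩ := Finset.exists_max_image (Finset.univ.filter fun y =>
      (SeesOnly G C (fun i => col (C i)) k y ∨ ∃ i, y = C i) ∧ col y = c) (weight G C)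
      ⟨C i, Finset.mem_filter.2 ⟨Finset.mem_univ _, Or.inr ⟨i, rfl⟩, hi⟩⟩
    refine ⟨p, (Finset.mem_filter.1 hp).2, fun y hy hyc => hmax y ?_⟩
    exact Finset.mem_filter.2 ⟨Finset.mem_univ _, Or.inl hy, hyc⟩
  choose g hg using this
  exact ⟨g, fun k c => (hg k c).1.1, fun k c => (hg k c).1.2, fun k y hy => (hg k _).2 y hy rfl⟩

theorem IsGuess.not_forbidden [Fintype V] {C : Fin 7 → V} {col : G.Coloring (Fin 3)}
    {g : Fin 3 → Fin 3 → V} (hg : IsGuess G C col g) (y : V) :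
    ¬ Forbidden G C (fun i => col (C i)) g (col y) y := by
  rintro (⟨i, hi, h⟩ | ⟨i, rfl, h⟩ | ⟨k, c', -, rfl, h⟩ | ⟨k, -, hk, h⟩)
  · exact col.valid h hi.symm
  · exact h rfl
  · exact h (hg.color _ _)
  · exact absurd (hg.weight_le k y hk) (by omega)

/-- Under a justified guess, propagation leaves at most two colors at every vertex. Suppose that `x`
keeps all colors. Then `x` is remote, no guessed vertex is adjacent to `x`, and a neighbor of `x`
that has neighbors on `C` sees only one color `k` there and is at most as heavy as the guesses for
`k`. If `x` has a mate, then by the choice of the weights these guesses touch the component of `x`,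
so they are adjacent to the mate, which thus loses two colors. If `x` has no mate, then two of its
neighbors `u`, `u'` see different colors, for otherwise a vertex of `C` dominates `x`, and `u'`,
say, touches all that `u` touches. The guess `p` for the color seen by `u'` and for the third color
does not touch `x`. Hence `p` touches less than `u` does, and less than `u'`, so that it is lighter
than `u'`. -/
theorem IsGuess.exists_forbidden [Fintype V] (hclean : IsClean G) (hconn : G.Connected)
    (h7 : ¬ (SimpleGraph.pathGraph 7).IsIndContained G)
    (h3 : ¬ (SimpleGraph.cycleGraph 3).IsIndContained G) {C : Fin 7 → V} (hC : IsGon G C)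
    {col : G.Coloring (Fin 3)} {g : Fin 3 → Fin 3 → V} (hg : IsGuess G C col g)
    {F : Fin 3 → V → Prop} (hF : ∀ c y, Forbidden G C (fun i => col (C i)) g c y → F c y)
    (hprop : IsPropagated G F) (x : V) : ∃ c, F c x := by
  classical
  have hU : ∀ {x a b : V}, RemoteAdj G C x a → RemoteAdj G C x b → a = b :=
    fun ha hb => remoteAdj_unique hclean hconn h7 h3 hC ha hb
  by_contra! hx
  -- no vertex dominates `x`
  have hdom : ∀ v, v ≠ x → ¬ G.Adj x v → ∃ u, G.Adj x u ∧ ¬ G.Adj v u := by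
    intro v hv hxv
    by_contra! h
    exact hclean.1 x ⟨v, hv, hxv, fun u hu => h u hu⟩
  have hxR : Remote G C x := fun i hi => hx _ (hF _ _ (Or.inl ⟨i, rfl, hi⟩))
  -- a neighbor of `x` has at most one forbidden color, for otherwise it would forbid one at `x`
  have one : ∀ u a b, G.Adj x u → F a u → F b u → a = b := by
    intro u a b hu ha hb
    by_contra hab
    have aux : ∀ a b : Fin 3, a ≠ b → ∃ c, (a = c + 1 ∧ b = c + 2) ∨ (b = c + 1 ∧ a = c + 2) := by
      decide
    obtain ⟨c, ⟨rfl, rfl⟩ | ⟨rfl, rfl⟩⟩ := aux a b hab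
    · exact hx c (hprop c u x hu.symm ha hb)
    · exact hx c (hprop c u x hu.symm hb ha)
  -- a guessed vertex has a single color left, which is therefore forbidden at its neighbors
  have guessF : ∀ k c, k ≠ c → ∀ d, d ≠ c → F d (g k c) := fun k c hkc d hd =>
    hF _ _ (Or.inr (Or.inr (Or.inl ⟨k, c, hkc, rfl, hd⟩)))
  have guessAdj : ∀ k c u, k ≠ c → G.Adj (g k c) u → F c u := by
    intro k c u hkc hu
    have aux : ∀ c : Fin 3, c + 1 ≠ c ∧ c + 2 ≠ c := by decide
    exact hprop c _ _ hu (guessF k c hkc _ (aux c).1) (guessF k c hkc _ (aux c).2)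
  have notGuess : ∀ k c, k ≠ c → ¬ G.Adj x (g k c) := fun k c hkc h =>
    hx c (guessAdj k c x hkc h.symm)
  -- a neighbor of `x` sees a single color, and is outweighed by the guesses for that color
  have nbr : ∀ u, G.Adj x u → ¬ Remote G C u → ∃ k, SeesOnly G C (fun i => col (C i)) k u ∧
      F k u ∧ ∀ c, c ≠ k → ¬ F c u ∧ weight G C u ≤ weight G C (g k c) := by
    intro u hu huR
    have : ∃ i, G.Adj u (C i) := by simpa [Remote] using huR
    obtain ⟨i, hi⟩ := this
    have hFi : ∀ j, G.Adj u (C j) → F (col (C j)) u := fun j hj =>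
      hF _ _ (Or.inl ⟨j, rfl, hj⟩)
    have hS : SeesOnly G C (fun i => col (C i)) (col (C i)) u := by
      intro c
      constructor
      · rintro ⟨j, rfl, hj⟩
        exact one u _ _ hu (hFi j hj) (hFi i hi)
      · rintro rfl
        exact ⟨i, rfl, hi⟩
    refine ⟨col (C i), hS, hFi i hi, fun c hc => ⟨fun h => hc (one u _ _ hu h (hFi i hi)), ?_⟩⟩
    by_contra! hlt
    exact hc (one u _ _ hu (hF _ _ (Or.inr (Or.inr (Or.inr ⟨_, hc.symm, hS, hlt⟩)))) (hFi i hi))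
  have third : ∀ k : Fin 3, k + 1 ≠ k ∧ k + 2 ≠ k ∧ k + 1 ≠ k + 2 := by decide
  by_cases hmate : HasMate G C x
  · obtain ⟨a, ha, hxa⟩ := hmate
    have hmate : HasMate G C x := ⟨a, ha, hxa⟩
    have hU' : ∀ z, Remote G C z → G.Adj x z → z = a := fun z hz hxz =>
      hU ⟨hxR, hz, hxz⟩ ⟨hxR, ha, hxa⟩
    -- otherwise a neighbor of the mate dominates `x`
    obtain ⟨u, hxu, huR⟩ : ∃ u, G.Adj x u ∧ ¬ Remote G C u := by
      by_contra! hno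
      obtain ⟨k, y, hk, hky, hy⟩ := exists_attached hconn hC hxR
      have hka : k = x ∨ k = a := by
        clear hky
        induction hk with
        | refl => exact Or.inl rfl
        | tail _ h ih =>
          rcases ih with rfl | rfl
          · exact Or.inr (hU' _ h.2.1 h.2.2)
          · exact Or.inl (hU h ⟨ha, hxR, hxa.symm⟩)
      rcases hka with rfl | rfl
      · exact hy (hno y hky)
      · obtain ⟨z, hz, hz'⟩ := hdom y (fun e => hy (e ▸ hxR))
          (not_adj_of_triangleFree h3 hxa hky)
        obtain rfl := hU' z (hno z hz) hz
        exact hz' hky.symm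
    obtain ⟨k, hS, -, hk⟩ := nbr u hxu huR
    have htu : Touches G C u x := ⟨hxR, Or.inl hxu.symm⟩
    -- the guesses for `k` touch the component of `x`, hence its other vertex
    have touch : ∀ c, c ≠ k → G.Adj (g k c) a := by
      intro c hc
      have ht : Touches G C (g k c) x := by
        by_contra ht
        refine absurd (hk c hc).2 (not_le.2 (weight_lt_of_mates (x := x) ?_ hmate htu ht))
        rcases hg.mem k c with hS' | ⟨i, hi⟩
        · intro z hz hgz
          obtain ⟨v, hv⟩ := exists_common_neighbor h7 h3 hC col k
          have hgv : G.Adj (g k c) (C v) := by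
            obtain ⟨hzR, h | ⟨z', hz'R, -, h⟩⟩ := hgz
            · exact hv z _ hzR h.symm hS'
            · exact hv z' _ hz'R h.symm hS'
          rcases touches_mates_comparable h7 h3 hU (hv x u hxR hxu hS) hgv with h | h
          · exact absurd (h x hmate htu) ht
          · exact h z hz hgz
        · intro z _ hgz
          rw [hi] at hgz
          exact absurd hgz (not_touches_gon i z)
      obtain ⟨-, h | ⟨z, hz, hxz, h⟩⟩ := ht
      · exact absurd h.symm (notGuess k c hc.symm)
      · rwa [hU' z hz hxz] at h
    exact (third k).2.2 (one a _ _ hxa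
      (guessAdj k _ a (third k).1.symm (touch _ (third k).1))
      (guessAdj k _ a (third k).2.1.symm (touch _ (third k).2.1)))
  · have hnbR : ∀ u, G.Adj x u → ¬ Remote G C u := fun u hu huR => hmate ⟨u, huR, hu⟩
    have touch_iff : ∀ p, Touches G C p x → G.Adj x p := by
      rintro p ⟨-, h | ⟨z, hz, hxz, -⟩⟩
      · exact h.symm
      · exact absurd ⟨z, hz, hxz⟩ hmate
    -- the guess for the color seen by `u'` and the third color `m` is lighter than `u'`
    have main : ∀ u u' k l, G.Adj x u → G.Adj x u' → k ≠ l →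
        SeesOnly G C (fun i => col (C i)) k u → SeesOnly G C (fun i => col (C i)) l u' →
        (∀ z, Touches G C u z → Touches G C u' z) → False := by
      intro u u' k l hxu hxu' hkl hS hS' hsub
      obtain ⟨m, hmk, hml⟩ : ∃ m : Fin 3, m ≠ k ∧ m ≠ l := by
        clear hS hS'
        revert k l
        decide
      obtain ⟨k₁, hS₁, -, hk₁⟩ := nbr u hxu (hnbR u hxu)
      obtain rfl : k₁ = k := (hS k₁).1 ((hS₁ k₁).2 rfl)
      obtain ⟨l₁, hS₂, -, hl₁⟩ := nbr u' hxu' (hnbR u' hxu')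
      obtain rfl : l₁ = l := (hS' l₁).1 ((hS₂ l₁).2 rfl)
      have hux : Touches G C u x := ⟨hxR, Or.inl hxu.symm⟩
      have hpx : ¬ Touches G C (g l₁ m) x := fun h => notGuess l₁ m hml.symm (touch_iff _ h)
      refine absurd (hl₁ m hml).2 (not_le.2 (weight_lt_of_ssubset (x := x) ?_ (hsub x hux) hpx))
      rcases hg.mem l₁ m with hSp | ⟨i, hi⟩
      · rcases touches_comparable h7 h3 hC hU hS.not_remote hSp.not_remote
          (fun h => (hk₁ m hmk).1 (guessAdj l₁ m u hml.symm h.symm))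
          (hS.disjoint hSp hkl) with h | h
        · exact absurd (h x hux) hpx
        · exact fun z hz => hsub z (h z hz)
      · intro z hz
        rw [hi] at hz
        exact absurd hz (not_touches_gon i z)
    -- otherwise a vertex of `C` adjacent to all neighbors of `x` dominates `x`
    obtain ⟨u, u', k, l, hxu, hxu', hkl, hS, hS'⟩ : ∃ u u' k l, G.Adj x u ∧ G.Adj x u' ∧ k ≠ l ∧
        SeesOnly G C (fun i => col (C i)) k u ∧ SeesOnly G C (fun i => col (C i)) l u' := by
      by_contra! hno
      have : ∃ k, ∀ u, G.Adj x u → SeesOnly G C (fun i => col (C i)) k u := by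
        by_cases hne : ∃ u, G.Adj x u
        · obtain ⟨u, hu⟩ := hne
          obtain ⟨k, hk, -⟩ := nbr u hu (hnbR u hu)
          refine ⟨k, fun u' hu' => ?_⟩
          obtain ⟨l, hl, -⟩ := nbr u' hu' (hnbR u' hu')
          by_cases hkl : k = l
          · rwa [hkl]
          · exact absurd hl (hno u u' k l hu hu' hkl hk)
        · exact ⟨0, fun u hu => absurd ⟨u, hu⟩ hne⟩
      obtain ⟨k, hk⟩ := this
      obtain ⟨v, hv⟩ := exists_common_neighbor h7 h3 hC col k
      obtain ⟨u, hu, hu'⟩ := hdom (C v) (fun e => not_remote_gon hC v (e ▸ hxR)) (hxR v)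
      exact hu' (hv x u hxR hu (hk u hu)).symm
    rcases touches_comparable h7 h3 hC hU hS.not_remote hS'.not_remote
      (not_adj_of_triangleFree h3 hxu.symm hxu') (hS.disjoint hS' hkl) with h | h
    · exact main u u' k l hxu hxu' hkl hS hS' h
    · exact main u' u l k hxu' hxu hkl.symm hS' hS h

/-! ### List coloring with two colors per list -/

/-- Forbid `c` at the neighbors of the vertices at which the two other colors are forbidden. -/
def propagateColor (G : SimpleGraph V) (c : Fin 3) (F : Fin 3 → V → Prop) : Fin 3 → V → Prop :=
  fun d y => F d y ∨ (d = c ∧ ∃ u, G.Adj u y ∧ F (c + 1) u ∧ F (c + 2) u)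

/-- One round of propagation. -/
def propagateRound (G : SimpleGraph V) (F : Fin 3 → V → Prop) : Fin 3 → V → Prop :=
  propagateColor G 2 (propagateColor G 1 (propagateColor G 0 F))

/-- Enough rounds of propagation to reach a fixed point. -/
def propagate [Fintype V] (G : SimpleGraph V) (F : Fin 3 → V → Prop) : Fin 3 → V → Prop :=
  (propagateRound G)^[Fintype.card V + Fintype.card V + Fintype.card V] F

theorem le_propagateRound (F : Fin 3 → V → Prop) : F ≤ propagateRound G F :=
  fun _ _ h => Or.inl (Or.inl (Or.inl h))

theorem not_propagateRound {F : Fin 3 → V → Prop} {col : G.Coloring (Fin 3)}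
    (h : ∀ y, ¬ F (col y) y) (y : V) : ¬ propagateRound G F (col y) y := by
  have step : ∀ c F, (∀ y, ¬ F (col y) y) → ∀ y, ¬ propagateColor G c F (col y) y := by
    rintro c F h y (h' | ⟨hc, u, hu, h1, h2⟩)
    · exact h y h'
    · have aux : ∀ c d : Fin 3, d ≠ c → d = c + 1 ∨ d = c + 2 := by decide
      rcases aux c (col u) (fun e => col.valid hu (e.trans hc.symm)) with e | e
      · exact h u (e ▸ h1)
      · exact h u (e ▸ h2)
  exact step 2 _ (step 1 _ (step 0 _ h)) y

theorem isPropagated_of_fixed {F : Fin 3 → V → Prop} (h : propagateRound G F = F) :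
    IsPropagated G F := by
  intro c u v huv h1 h2
  rw [← h]
  have hc : ∀ c : Fin 3, c = 0 ∨ c = 1 ∨ c = 2 := by decide
  rcases hc c with rfl | rfl | rfl
  · exact Or.inl (Or.inl (Or.inr ⟨rfl, u, huv, h1, h2⟩))
  · exact Or.inl (Or.inr ⟨rfl, u, huv, Or.inl h1, Or.inl h2⟩)
  · exact Or.inr ⟨rfl, u, huv, Or.inl (Or.inl h1), Or.inl (Or.inl h2)⟩

theorem le_iterate_propagateRound (F : Fin 3 → V → Prop) (k : ℕ) :
    F ≤ (propagateRound G)^[k] F := by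
  induction k with
  | zero => exact le_rfl
  | succ k ih =>
    rw [Function.iterate_succ_apply']
    exact ih.trans (le_propagateRound _)

theorem le_propagate [Fintype V] (F : Fin 3 → V → Prop) : F ≤ propagate G F :=
  le_iterate_propagateRound F _

theorem not_propagate [Fintype V] {F : Fin 3 → V → Prop} {col : G.Coloring (Fin 3)}
    (h : ∀ y, ¬ F (col y) y) (y : V) : ¬ propagate G F (col y) y := by
  have : ∀ k y, ¬ (propagateRound G)^[k] F (col y) y := by
    intro k
    induction k with
    | zero => exact h
    | succ k ih =>
      rw [Function.iterate_succ_apply']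
      exact not_propagateRound ih
  exact this _ y

theorem isPropagated_propagate [Fintype V] (F : Fin 3 → V → Prop) :
    IsPropagated G (propagate G F) := by
  apply isPropagated_of_fixed
  set f := propagateRound G with hf
  let N : (Fin 3 → V → Prop) → ℕ := fun F => {p : Fin 3 × V | F p.1 p.2}.ncard
  -- each round that is not the last one forbids a further color
  have key : ∀ k, f (f^[k] F) = f^[k] F ∨ k ≤ N (f^[k] F) := by
    intro k
    induction k with
    | zero => exact Or.inr (Nat.zero_le _)
    | succ k ih =>
      rw [Function.iterate_succ_apply']
      by_cases h : f (f^[k] F) = f^[k] F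
      · left
        rw [h, h]
      · right
        refine (ih.resolve_left h).trans_lt (Set.ncard_lt_ncard ?_ (Set.toFinite _))
        have hle := le_propagateRound (G := G) (f^[k] F)
        refine ⟨fun p hp => hle _ _ hp, fun hsub => h ?_⟩
        exact le_antisymm (fun c y hp => hsub (a := (c, y)) hp) hle
  rcases key (Fintype.card V + Fintype.card V + Fintype.card V) with h | h
  · exact h
  · have huniv : {p : Fin 3 × V | propagate G F p.1 p.2} = Set.univ := by
      apply Set.eq_of_subset_of_ncard_le (Set.subset_univ _)
      rw [Set.ncard_univ, Nat.card_eq_fintype_card, Fintype.card_prod, Fintype.card_fin]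
      have h' : Fintype.card V + Fintype.card V + Fintype.card V ≤
          {p : Fin 3 × V | propagate G F p.1 p.2}.ncard := h
      omega
    have htop : ∀ c y, propagate G F c y := fun c y =>
      (Set.ext_iff.1 huniv (c, y)).2 (Set.mem_univ _)
    exact le_antisymm (fun c y _ => htop c y) (le_propagateRound _)

/-- Give `v` the color `a` by forbidding the other colors. -/
def assign (v : V) (a : Fin 3) (L : Fin 3 → V → Prop) : Fin 3 → V → Prop :=
  fun c y => L c y ∨ (y = v ∧ c ≠ a)

open Classical in
/-- Give `v` the color `a`, propagate, and keep the result unless some list becomes empty. -/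
noncomputable def trial [Fintype V] (G : SimpleGraph V) (v : V) (a : Fin 3) (L : Fin 3 → V → Prop) :
    Fin 3 → V → Prop :=
  if ∀ y, ∃ c, ¬ propagate G (assign v a L) c y then propagate G (assign v a L) else L

/-- A list assignment, with at most two colors per list, that admits a coloring. The predicate `L`
marks the colors that are missing from the lists. -/
structure IsSolvable (G : SimpleGraph V) (L : Fin 3 → V → Prop) : Prop where
  exists_mark : ∀ y, ∃ c, L c y
  exists_coloring : ∃ col : G.Coloring (Fin 3), ∀ y, ¬ L (col y) y

/-- At most one color is left at `v`. -/
def Decided (L : Fin 3 → V → Prop) (v : V) : Prop := ∃ c, ∀ d, d ≠ c → L d v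

theorem Decided.mono {L L' : Fin 3 → V → Prop} (h : L ≤ L') {v : V} (hv : Decided L v) :
    Decided L' v := by
  obtain ⟨c, hc⟩ := hv
  exact ⟨c, fun d hd => h _ _ (hc d hd)⟩

theorem le_trial [Fintype V] (v : V) (a : Fin 3) (L : Fin 3 → V → Prop) : L ≤ trial G v a L := by
  unfold trial
  split_ifs
  · exact fun c y h => le_propagate _ _ _ (Or.inl h)
  · exact le_rfl

theorem decided_assign [Fintype V] (v : V) (a : Fin 3) (L : Fin 3 → V → Prop) :
    Decided (propagate G (assign v a L)) v :=
  ⟨a, fun _ hd => le_propagate _ _ _ (Or.inr ⟨rfl, hd⟩)⟩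

theorem trial_eq_or_decided [Fintype V] (v : V) (a : Fin 3) (L : Fin 3 → V → Prop) :
    trial G v a L = L ∨ Decided (trial G v a L) v := by
  unfold trial
  split_ifs
  · exact Or.inr (decided_assign v a L)
  · exact Or.inl rfl

/-- Trying the color of a coloring succeeds. -/
theorem decided_trial [Fintype V] {v : V} {L : Fin 3 → V → Prop} {col : G.Coloring (Fin 3)}
    (h : ∀ y, ¬ L (col y) y) : Decided (trial G v (col v) L) v := by
  unfold trial
  rw [if_pos]
  · exact decided_assign v _ L
  · refine fun y => ⟨col y, not_propagate (fun y => ?_) y⟩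
    rintro (h' | ⟨rfl, h'⟩)
    · exact h y h'
    · exact h' rfl

/-- A successful trial keeps the lists solvable: the lists that changed have become single colors,
which propagation has separated from all other lists. -/
theorem IsSolvable.trial [Fintype V] {L : Fin 3 → V → Prop} (h : IsSolvable G L) (v : V)
    (a : Fin 3) : IsSolvable G (trial G v a L) := by
  classical
  by_cases hP : ∀ y, ∃ c, ¬ propagate G (assign v a L) c y
  swap
  · rw [CleanGraph.trial, if_neg hP]
    exact h
  have hle := le_trial (G := G) v a L
  rw [CleanGraph.trial, if_pos hP] at hle ⊢
  set P := propagate G (assign v a L) with hPdef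
  have hprop : IsPropagated G P := isPropagated_propagate _
  refine ⟨fun y => (h.exists_mark y).imp fun c => hle c y, ?_⟩
  obtain ⟨col, hcol⟩ := h.exists_coloring
  choose pk hpk using hP
  -- keep the coloring where the list is unchanged
  let f : V → Fin 3 := fun y => if ∀ c, P c y → L c y then col y else pk y
  have hf : ∀ y, ¬ P (f y) y := by
    intro y
    by_cases hy : ∀ c, P c y → L c y
    · simp only [f, if_pos hy]
      exact fun e => hcol y (hy _ e)
    · simp only [f, if_neg hy]
      exact hpk y
  have hchanged : ∀ u w, G.Adj u w → ¬ (∀ c, P c u → L c u) → f u ≠ f w := by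
    intro u w huw hu
    have hfu : f u = pk u := by simp only [f, if_neg hu]
    have hall : ∀ d, d ≠ f u → P d u := by
      push Not at hu
      obtain ⟨b, hb, hbL⟩ := hu
      obtain ⟨b', hb'⟩ := h.exists_mark u
      have hne : b ≠ b' := by
        rintro rfl
        exact hbL hb'
      have aux : ∀ b b' p d : Fin 3, b ≠ b' ∧ p ≠ b ∧ p ≠ b' ∧ d ≠ p → d = b ∨ d = b' := by
        decide
      intro d hd
      have h1 : f u ≠ b := fun e => hf u (e ▸ hb)
      have h2 : f u ≠ b' := fun e => hf u (e ▸ hle _ _ hb')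
      rcases aux b b' (f u) d ⟨hne, h1, h2, hd⟩ with rfl | rfl
      · exact hb
      · exact hle _ _ hb'
    have aux : ∀ c : Fin 3, c + 1 ≠ c ∧ c + 2 ≠ c := by decide
    have hw := hprop (f u) u w huw (hall _ (aux _).1) (hall _ (aux _).2)
    exact fun e => hf w (e ▸ hw)
  refine ⟨SimpleGraph.Coloring.mk f fun {u w} huw => ?_, hf⟩
  by_cases hu : ∀ c, P c u → L c u
  · by_cases hw : ∀ c, P c w → L c w
    · simp only [f, if_pos hu, if_pos hw]
      exact col.valid huw
    · exact (hchanged w u huw.symm hw).symm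
  · exact hchanged u w huw hu

/-- Try the three colors at `v`. -/
noncomputable def trials [Fintype V] (G : SimpleGraph V) (v : V) (L : Fin 3 → V → Prop) :
    Fin 3 → V → Prop :=
  trial G v 2 (trial G v 1 (trial G v 0 L))

theorem le_trials [Fintype V] (v : V) (L : Fin 3 → V → Prop) : L ≤ trials G v L :=
  (le_trial v 0 L).trans ((le_trial v 1 _).trans (le_trial v 2 _))

theorem IsSolvable.trials [Fintype V] {L : Fin 3 → V → Prop} (h : IsSolvable G L) (v : V) :
    IsSolvable G (trials G v L) :=
  ((h.trial v 0).trial v 1).trial v 2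

theorem IsSolvable.decided_trials [Fintype V] {L : Fin 3 → V → Prop} (h : IsSolvable G L) (v : V) :
    Decided (CleanGraph.trials G v L) v := by
  obtain ⟨col, hcol⟩ := h.exists_coloring
  have hd := decided_trial (v := v) hcol
  unfold CleanGraph.trials
  rcases trial_eq_or_decided (G := G) v 0 L with h0 | h0
  swap
  · exact (h0.mono (le_trial v 1 _)).mono (le_trial v 2 _)
  rw [h0]
  rcases trial_eq_or_decided (G := G) v 1 L with h1 | h1
  swap
  · exact h1.mono (le_trial v 2 _)
  rw [h1]
  have hc : ∀ c : Fin 3, c = 0 ∨ c = 1 ∨ c = 2 := by decide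
  rcases hc (col v) with e | e | e
  · rw [e, h0] at hd
    exact hd.mono (le_trial v 2 _)
  · rw [e, h1] at hd
    exact hd.mono (le_trial v 2 _)
  · rwa [e] at hd

open Classical in
/-- The first color that is not forbidden at `y` (the last color if all are forbidden). -/
noncomputable def firstColor (L : Fin 3 → V → Prop) (y : V) : Fin 3 :=
  if ¬ L 0 y then 0 else if ¬ L 1 y then 1 else 2

/-- Once every list is a single color, that color is the one of any coloring from the lists. -/
theorem IsSolvable.firstColor_ne {L : Fin 3 → V → Prop} (h : IsSolvable G L)
    (hd : ∀ v, Decided L v) {u v : V} (huv : G.Adj u v) : firstColor L u ≠ firstColor L v := by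
  obtain ⟨col, hcol⟩ := h.exists_coloring
  have : ∀ y, firstColor L y = col y := by
    intro y
    obtain ⟨c, hc⟩ := hd y
    have hcc : ∀ d, L d y ↔ d ≠ col y := by
      intro d
      have : col y = c := by
        by_contra hne
        exact hcol y (hc _ hne)
      rw [this]
      exact ⟨fun h e => hcol y (by rwa [this, ← e]), hc d⟩
    unfold firstColor
    rw [hcc, hcc]
    have aux : ∀ a : Fin 3,
        (if ¬ (0 ≠ a) then (0 : Fin 3) else if ¬ (1 ≠ a) then 1 else 2) = a := by
      decide
    convert aux (col y)
  rw [this, this]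
  exact col.valid huv

end CleanGraph

namespace WordRAM

/-! ### Programs with bounded loops -/

/-- Programs whose loops run over the numbers below the content of register `2`. -/
inductive Cmd where
  | skip
  | const (r k : ℕ)
  | arith (r : ℕ) (o : Op) (r₁ r₂ : ℕ)
  | load (r a i : ℕ)
  | store (a i r : ℕ)
  | seq (p q : Cmd)
  | ite (b : Test) (p q : Cmd)
  /-- run `p` with register `i` set to `0`, `1`, … in turn -/
  | upto (i : ℕ) (p : Cmd)

namespace Cmd

/-- Translation into a word RAM program; register `4` is expected to hold `1`. -/
def compile : Cmd → Prog
  | skip => .skip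
  | const r k => .const r k
  | arith r o r₁ r₂ => .arith r o r₁ r₂
  | load r a i => .load r a i
  | store a i r => .store a i r
  | seq p q => .seq p.compile q.compile
  | ite b p q => .branch b p.compile q.compile
  | upto i p => .seq (.const i 0) (.loop (.lt i 2) (.seq p.compile (.arith i .add i 4)))

open Classical in
/-- The state after running a program. A loop leaves the number of iterations in its counter. -/
noncomputable def eval (w : ℕ) : Cmd → State → State
  | skip, σ => σ
  | const r k, σ => σ.setReg w r k
  | arith r o r₁ r₂, σ => σ.setReg w r (o.eval (σ.reg r₁) (σ.reg r₂))
  | load r a i, σ => σ.setReg w r (σ.mem a (σ.reg i))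
  | store a i r, σ => σ.setMem w a (σ.reg i) (σ.reg r)
  | seq p q, σ => q.eval w (p.eval w σ)
  | ite b p q, σ => if b.Holds σ then p.eval w σ else q.eval w σ
  | upto i p, σ =>
    ((List.range (σ.reg 2)).foldl (fun τ k => p.eval w (τ.setReg w i k)) σ).setReg w i (σ.reg 2)

/-- The program writes register `r`. -/
def WritesReg : Cmd → ℕ → Prop
  | skip, _ => False
  | const r _, x => x = r
  | arith r _ _ _, x => x = r
  | load r _ _, x => x = r
  | store _ _ _, _ => False
  | seq p q, x => p.WritesReg x ∨ q.WritesReg x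
  | ite _ p q, x => p.WritesReg x ∨ q.WritesReg x
  | upto i p, x => x = i ∨ p.WritesReg x

/-- The program writes array `a`. -/
def WritesMem : Cmd → ℕ → Prop
  | skip, _ => False
  | const _ _, _ => False
  | arith _ _ _ _, _ => False
  | load _ _ _, _ => False
  | store a _ _, x => x = a
  | seq p q, x => p.WritesMem x ∨ q.WritesMem x
  | ite _ p q, x => p.WritesMem x ∨ q.WritesMem x
  | upto _ p, x => p.WritesMem x

/-- No loop body writes the loop counter, and registers `2` and `4` are never written. -/
def WellFormed : Cmd → Prop
  | seq p q => p.WellFormed ∧ q.WellFormed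
  | ite _ p q => p.WellFormed ∧ q.WellFormed
  | upto i p => p.WellFormed ∧ ¬ p.WritesReg i ∧ i ≠ 2 ∧ i ≠ 4
  | const r _ => r ≠ 2 ∧ r ≠ 4
  | arith r _ _ _ => r ≠ 2 ∧ r ≠ 4
  | load r _ _ => r ≠ 2 ∧ r ≠ 4
  | _ => True

/-- The nesting depth of the loops. -/
def depth : Cmd → ℕ
  | seq p q => max p.depth q.depth
  | ite _ p q => max p.depth q.depth
  | upto _ p => p.depth + 1
  | _ => 0

/-- A bound for the number of steps when register `2` holds `n`. A loop takes one step for setting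
its counter, and one for the test and one for the increment in each iteration. -/
def cost (n : ℕ) : Cmd → ℕ
  | seq p q => p.cost n + q.cost n
  | ite _ p q => 1 + p.cost n + q.cost n
  | upto _ p => 2 + n * (p.cost n + 2)
  | _ => 1

/-- The coefficient of a bound `coef * n ^ depth` for the cost. -/
def coef : Cmd → ℕ
  | seq p q => p.coef + q.coef
  | ite _ p q => 1 + p.coef + q.coef
  | upto _ p => p.coef + 4
  | _ => 1

theorem cost_le {n : ℕ} (hn : 1 ≤ n) (p : Cmd) : p.cost n ≤ p.coef * n ^ p.depth := by
  have mono : ∀ {a b : ℕ}, a ≤ b → n ^ a ≤ n ^ b := fun h => Nat.pow_le_pow_right hn h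
  induction p with
  | skip | const | arith | load | store => simp [cost, coef, depth]
  | seq p q ihp ihq =>
    simp only [cost, coef, depth, Nat.add_mul]
    exact Nat.add_le_add (ihp.trans (Nat.mul_le_mul_left _ (mono (le_max_left _ _))))
      (ihq.trans (Nat.mul_le_mul_left _ (mono (le_max_right _ _))))
  | ite b p q ihp ihq =>
    simp only [cost, coef, depth, Nat.add_mul]
    refine Nat.add_le_add (Nat.add_le_add ?_
      (ihp.trans (Nat.mul_le_mul_left _ (mono (le_max_left _ _)))))
      (ihq.trans (Nat.mul_le_mul_left _ (mono (le_max_right _ _))))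
    simpa using Nat.one_le_pow _ _ hn
  | upto i p ih =>
    simp only [cost, coef, depth, pow_succ]
    have h1 : 1 ≤ n ^ p.depth := Nat.one_le_pow _ _ hn
    have h2 : n ≤ n ^ p.depth * n := Nat.le_mul_of_pos_left _ h1
    have h3 := Nat.mul_le_mul_right n ih
    nlinarith

@[simp] theorem _root_.WordRAM.State.setReg_reg (w : ℕ) (σ : State) (r x s : ℕ) :
    (σ.setReg w r x).reg s = if s = r then x % 2 ^ w else σ.reg s := by
  simp [State.setReg, Function.update_apply]

@[simp] theorem _root_.WordRAM.State.setReg_mem (w : ℕ) (σ : State) (r x : ℕ) :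
    (σ.setReg w r x).mem = σ.mem := rfl

@[simp] theorem _root_.WordRAM.State.setMem_mem (w : ℕ) (σ : State) (a k x b l : ℕ) :
    (σ.setMem w a k x).mem b l = if b = a ∧ l = k then x % 2 ^ w else σ.mem b l := by
  by_cases hb : b = a
  · subst hb
    simp [State.setMem, Function.update_apply]
  · simp [State.setMem, hb]

theorem _root_.WordRAM.State.setReg_setReg (w : ℕ) (σ : State) (r x y : ℕ) :
    (σ.setReg w r x).setReg w r y = σ.setReg w r y := by
  simp [State.setReg]

theorem eval_reg {w : ℕ} (p : Cmd) {r : ℕ} (h : ¬ p.WritesReg r) (σ : State) :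
    (p.eval w σ).reg r = σ.reg r := by
  induction p generalizing σ with
  | skip => rfl
  | const | arith | load =>
    simp only [WritesReg] at h
    simp [eval, h]
  | store => rfl
  | seq p q ihp ihq =>
    simp only [WritesReg, not_or] at h
    simp only [eval]
    rw [ihq h.2, ihp h.1]
  | ite b p q ihp ihq =>
    simp only [WritesReg, not_or] at h
    simp only [eval]
    split_ifs
    · exact ihp h.1 σ
    · exact ihq h.2 σ
  | upto i p ih =>
    simp only [WritesReg, not_or] at h
    simp only [eval, State.setReg_reg, if_neg h.1]
    generalize List.range (σ.reg 2) = l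
    induction l generalizing σ with
    | nil => rfl
    | cons k l ihl =>
      simp only [List.foldl_cons]
      rw [ihl, ih h.2]
      simp [h.1]

theorem eval_mem {w : ℕ} (p : Cmd) {a : ℕ} (h : ¬ p.WritesMem a) (σ : State) :
    (p.eval w σ).mem a = σ.mem a := by
  induction p generalizing σ with
  | skip | const | arith | load => rfl
  | store =>
    simp only [WritesMem] at h
    funext l
    simp [eval, h]
  | seq p q ihp ihq =>
    simp only [WritesMem, not_or] at h
    simp only [eval]
    rw [ihq h.2, ihp h.1]
  | ite b p q ihp ihq =>
    simp only [WritesMem, not_or] at h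
    simp only [eval]
    split_ifs
    · exact ihp h.1 σ
    · exact ihq h.2 σ
  | upto i p ih =>
    simp only [WritesMem] at h
    simp only [eval, State.setReg_mem]
    generalize List.range (σ.reg 2) = l
    induction l generalizing σ with
    | nil => rfl
    | cons k l ihl =>
      simp only [List.foldl_cons]
      rw [ihl, ih h]
      rfl

theorem WellFormed.not_writesReg {p : Cmd} (h : p.WellFormed) :
    ¬ p.WritesReg 2 ∧ ¬ p.WritesReg 4 := by
  induction p with
  | skip | store => simp [WritesReg]
  | const | arith | load =>
    simp only [WellFormed] at h
    exact ⟨h.1.symm, h.2.symm⟩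
  | seq p q ihp ihq =>
    exact ⟨not_or.2 ⟨(ihp h.1).1, (ihq h.2).1⟩, not_or.2 ⟨(ihp h.1).2, (ihq h.2).2⟩⟩
  | ite b p q ihp ihq =>
    exact ⟨not_or.2 ⟨(ihp h.1).1, (ihq h.2).1⟩, not_or.2 ⟨(ihp h.1).2, (ihq h.2).2⟩⟩
  | upto i p ih =>
    exact ⟨not_or.2 ⟨h.2.2.1.symm, (ih h.1).1⟩, not_or.2 ⟨h.2.2.2.symm, (ih h.1).2⟩⟩

/-- A well-formed program halts, in the state given by `eval` and within `cost` steps. -/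
theorem exec_compile {w n : ℕ} (hn : n < 2 ^ w) (p : Cmd) (h : p.WellFormed) (σ : State)
    (h2 : σ.reg 2 = n) (h4 : σ.reg 4 = 1) :
    ∃ t ≤ p.cost n, Exec w p.compile σ (p.eval w σ) t := by
  induction p generalizing σ with
  | skip => exact ⟨1, le_rfl, .skip σ⟩
  | const r k => exact ⟨1, le_rfl, .const σ r k⟩
  | arith r o r₁ r₂ => exact ⟨1, le_rfl, .arith σ r o r₁ r₂⟩
  | load r a i => exact ⟨1, le_rfl, .load σ r a i⟩
  | store a i r => exact ⟨1, le_rfl, .store σ a i r⟩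
  | seq p q ihp ihq =>
    obtain ⟨t, ht, e⟩ := ihp h.1 σ h2 h4
    have hw := h.1.not_writesReg
    obtain ⟨t', ht', e'⟩ := ihq h.2 (p.eval w σ) (by rw [eval_reg p hw.1, h2])
      (by rw [eval_reg p hw.2, h4])
    exact ⟨t + t', Nat.add_le_add ht ht', .seq e e'⟩
  | ite b p q ihp ihq =>
    simp only [eval, cost]
    by_cases hb : b.Holds σ
    · obtain ⟨t, ht, e⟩ := ihp h.1 σ h2 h4
      rw [if_pos hb]
      exact ⟨1 + t, by omega, .branch_true hb e⟩
    · obtain ⟨t, ht, e⟩ := ihq h.2 σ h2 h4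
      rw [if_neg hb]
      exact ⟨1 + t, by omega, .branch_false hb e⟩
  | upto i p ih =>
    obtain ⟨hp, hpi, hi2, hi4⟩ := h
    have hw := hp.not_writesReg
    -- the last `m` iterations, by induction on `m`
    have key : ∀ m k τ, k + m = n → τ.reg 2 = n → τ.reg 4 = 1 →
        ∃ t ≤ 1 + m * (p.cost n + 2), Exec w (.loop (.lt i 2) (.seq p.compile (.arith i .add i 4)))
          (τ.setReg w i k)
          (((List.range' k m).foldl (fun τ k => p.eval w (τ.setReg w i k)) τ).setReg w i n) t := by
      intro m
      induction m with
      | zero =>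
        intro k τ hk hτ2 hτ4
        obtain rfl : k = n := by omega
        refine ⟨1, by omega, .loop_false ?_⟩
        simp [Test.Holds, Nat.mod_eq_of_lt hn, hi2.symm, hτ2]
      | succ m ihm =>
        intro k τ hk hτ2 hτ4
        have hkw : k < 2 ^ w := by omega
        obtain ⟨t, ht, e⟩ := ih hp (τ.setReg w i k) (by simp [hi2.symm, hτ2])
          (by simp [hi4.symm, hτ4])
        have r2 : (p.eval w (τ.setReg w i k)).reg 2 = n := by
          rw [eval_reg p hw.1]
          simp [hi2.symm, hτ2]
        have r4 : (p.eval w (τ.setReg w i k)).reg 4 = 1 := by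
          rw [eval_reg p hw.2]
          simp [hi4.symm, hτ4]
        have ri : (p.eval w (τ.setReg w i k)).reg i = k := by
          rw [eval_reg p hpi]
          simp [Nat.mod_eq_of_lt hkw]
        obtain ⟨t', ht', e'⟩ := ihm (k + 1) (p.eval w (τ.setReg w i k)) (by omega) r2 r4
        refine ⟨1 + (t + 1) + t', ?_, .loop_true ?_ (.seq e (.arith _ i .add i 4)) ?_⟩
        · have : (m + 1) * (p.cost n + 2) = m * (p.cost n + 2) + (p.cost n + 2) := by ring
          omega
        · simp only [Test.Holds, State.setReg_reg, if_neg hi2.symm, if_true, hτ2,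
            Nat.mod_eq_of_lt hkw]
          omega
        · rw [ri, r4]
          exact e'
    obtain ⟨t, ht, e⟩ := key n 0 σ (by omega) h2 h4
    refine ⟨1 + t, by simp only [cost]; omega, .seq (.const σ i 0) ?_⟩
    simp only [eval, h2, List.range_eq_range']
    exact e

/-! ### Reasoning about loops -/

/-- `τ` agrees with `σ` outside of what the program writes. -/
def Frame (p : Cmd) (σ τ : State) : Prop :=
  (∀ r, ¬ p.WritesReg r → τ.reg r = σ.reg r) ∧ (∀ a, ¬ p.WritesMem a → τ.mem a = σ.mem a)

theorem frame_eval (w : ℕ) (p : Cmd) (σ : State) : Frame p σ (p.eval w σ) :=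
  ⟨fun _ h => eval_reg p h σ, fun _ h => eval_mem p h σ⟩

/-- The invariant rule for loops. The invariant must not depend on the loop counter. -/
theorem eval_upto {w n : ℕ} (hn : n < 2 ^ w) {i : ℕ} {p : Cmd} {σ : State} (h2 : σ.reg 2 = n)
    (I : ℕ → State → Prop) (h0 : I 0 σ) (hins : ∀ k τ x, I k τ → I k (τ.setReg w i x))
    (hstep : ∀ (k : Fin n) (τ : State), τ.reg i = k → Frame (.upto i p) σ τ → I k τ →
      I (k + 1) (p.eval w τ)) :
    I n ((Cmd.upto i p).eval w σ) := by
  simp only [eval, h2]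
  apply hins
  have key : ∀ m ≤ n,
      Frame (.upto i p) σ ((List.range m).foldl (fun τ k => p.eval w (τ.setReg w i k)) σ) ∧
      I m ((List.range m).foldl (fun τ k => p.eval w (τ.setReg w i k)) σ) := by
    intro m
    induction m with
    | zero => exact fun _ => ⟨⟨fun _ _ => rfl, fun _ _ => rfl⟩, h0⟩
    | succ m ih =>
      intro hm
      obtain ⟨hF, hI⟩ := ih (by omega)
      rw [List.range_succ, List.foldl_append]
      simp only [List.foldl_cons, List.foldl_nil]
      set τ := (List.range m).foldl (fun τ k => p.eval w (τ.setReg w i k)) σ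
      refine ⟨⟨fun r hr => ?_, fun a ha => ?_⟩, ?_⟩
      · have hr' := hr
        simp only [WritesReg, not_or] at hr'
        rw [eval_reg p hr'.2, State.setReg_reg, if_neg hr'.1, hF.1 r hr]
      · have ha' := ha
        simp only [WritesMem] at ha'
        rw [eval_mem p ha', State.setReg_mem, hF.2 a ha]
      · refine hstep ⟨m, hm⟩ _ (by simp [Nat.mod_eq_of_lt (lt_of_lt_of_le hm hn.le)])
          ⟨fun r hr => ?_, hF.2⟩ (hins _ _ _ hI)
        have hr' := hr
        simp only [WritesReg, not_or] at hr'
        rw [State.setReg_reg, if_neg hr'.1, hF.1 r hr]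
  exact (key n le_rfl).2

/-- Run several programs one after the other. -/
def seqs : List Cmd → Cmd
  | [] => .skip
  | p :: l => .seq p (seqs l)

theorem writesReg_seqs {l : List Cmd} {r : ℕ} :
    (seqs l).WritesReg r ↔ ∃ p ∈ l, p.WritesReg r := by
  induction l with
  | nil => simp [seqs, WritesReg]
  | cons p l ih => simp [seqs, WritesReg, ih]

theorem writesMem_seqs {l : List Cmd} {a : ℕ} :
    (seqs l).WritesMem a ↔ ∃ p ∈ l, p.WritesMem a := by
  induction l with
  | nil => simp [seqs, WritesMem]
  | cons p l ih => simp [seqs, WritesMem, ih]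

theorem wellFormed_seqs {l : List Cmd} : (seqs l).WellFormed ↔ ∀ p ∈ l, p.WellFormed := by
  induction l with
  | nil => simp [seqs, WellFormed]
  | cons p l ih => simp [seqs, WellFormed, ih]

theorem depth_seqs_le {l : List Cmd} {d : ℕ} (h : ∀ p ∈ l, p.depth ≤ d) :
    (seqs l).depth ≤ d := by
  induction l with
  | nil => simp [seqs, depth]
  | cons p l ih =>
    simp only [seqs, depth]
    exact max_le (h p (by simp)) (ih fun q hq => h q (by simp [hq]))

/-- The invariant rule for `seqs`; the invariant may refer to the programs already run. -/
theorem eval_seqs {w : ℕ} {α : Type*} (f : α → Cmd) (l : List α) (I : List α → State → Prop)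
    {σ : State} (h0 : I [] σ)
    (hstep : ∀ (pre : List α) a τ, Frame (seqs (l.map f)) σ τ → I pre τ → a ∈ l →
      I (pre ++ [a]) ((f a).eval w τ)) :
    I l ((seqs (l.map f)).eval w σ) := by
  have key : ∀ (l' pre : List α) τ, pre ++ l' = l → Frame (seqs (l.map f)) σ τ → I pre τ →
      I l ((seqs (l'.map f)).eval w τ) := by
    intro l'
    induction l' with
    | nil =>
      intro pre τ hl _ h
      simp only [List.append_nil] at hl
      subst hl
      exact h
    | cons a l' ih =>
      intro pre τ hl hF h
      have ha : a ∈ l := by simp [← hl]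
      simp only [List.map_cons, seqs, eval]
      refine ih (pre ++ [a]) _ (by simp [← hl]) ⟨fun r hr => ?_, fun b hb => ?_⟩
        (hstep pre a τ hF h ha)
      · rw [eval_reg (f a) (fun hw => hr (writesReg_seqs.2 ⟨f a, List.mem_map_of_mem ha, hw⟩)),
          hF.1 r hr]
      · rw [eval_mem (f a) (fun hw => hb (writesMem_seqs.2 ⟨f a, List.mem_map_of_mem ha, hw⟩)),
          hF.2 b hb]
  exact key l [] σ rfl ⟨fun _ _ => rfl, fun _ _ => rfl⟩ h0

/-- Nested loops with the given counters. -/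
def nest : List ℕ → Cmd → Cmd
  | [], p => p
  | i :: l, p => .upto i (nest l p)

theorem writesReg_nest {l : List ℕ} {p : Cmd} {r : ℕ} :
    (nest l p).WritesReg r ↔ r ∈ l ∨ p.WritesReg r := by
  induction l with
  | nil => simp [nest]
  | cons i l ih => simp [nest, WritesReg, ih, or_assoc]

theorem writesMem_nest {l : List ℕ} {p : Cmd} {a : ℕ} :
    (nest l p).WritesMem a ↔ p.WritesMem a := by
  induction l with
  | nil => simp [nest]
  | cons i l ih => simp [nest, WritesMem, ih]

theorem wellFormed_nest {l : List ℕ} {p : Cmd} (hp : p.WellFormed) (hl : l.Nodup)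
    (h : ∀ i ∈ l, ¬ p.WritesReg i ∧ i ≠ 2 ∧ i ≠ 4) : (nest l p).WellFormed := by
  induction l with
  | nil => exact hp
  | cons i l ih =>
    have hl' := List.nodup_cons.1 hl
    refine ⟨ih hl'.2 fun j hj => h j (by simp [hj]), ?_, (h i (by simp)).2⟩
    rw [writesReg_nest]
    exact not_or.2 ⟨hl'.1, (h i (by simp)).1⟩

theorem depth_nest {l : List ℕ} {p : Cmd} : (nest l p).depth = l.length + p.depth := by
  induction l with
  | nil => simp [nest]
  | cons i l ih =>
    simp only [nest, depth, ih, List.length_cons]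
    omega

/-- The rule for exhaustive search: if `p` preserves `J` and `F`, and reaches `F` from `J` when the
loop counters take the values `val`, then the nested loops reach `F`. -/
theorem eval_nest {w n : ℕ} (hn : n < 2 ^ w) {l : List ℕ} (hl : l.Nodup) {p : Cmd}
    (hp : ∀ i ∈ l, ¬ p.WritesReg i) (J F : State → Prop) (val : ℕ → Fin n)
    (hJ2 : ∀ τ, J τ → τ.reg 2 = n)
    (hJins : ∀ τ, ∀ i ∈ l, ∀ x, J τ → J (τ.setReg w i x))
    (hFins : ∀ τ, ∀ i ∈ l, ∀ x, F τ → F (τ.setReg w i x))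
    (hJ : ∀ τ : State, (∀ i ∈ l, ∃ v : Fin n, τ.reg i = v) → J τ → J (p.eval w τ))
    (hF : ∀ τ : State, (∀ i ∈ l, ∃ v : Fin n, τ.reg i = v) → J τ → F τ → F (p.eval w τ))
    (hreach : ∀ τ : State, (∀ i ∈ l, τ.reg i = val i) → J τ → F (p.eval w τ))
    {σ : State} (hσ : J σ) :
    J ((nest l p).eval w σ) ∧ F ((nest l p).eval w σ) := by
  induction l generalizing J F σ with
  | nil => exact ⟨hJ σ (by simp) hσ, hreach σ (by simp) hσ⟩
  | cons i l ih =>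
    have hl' := List.nodup_cons.1 hl
    have hnei : ∀ j ∈ l, i ≠ j := by
      rintro j hj rfl
      exact hl'.1 hj
    have hregi : ∀ τ, (p.eval w τ).reg i = τ.reg i := fun τ => eval_reg p (hp i (by simp)) τ
    -- one iteration keeps `J` and `F`
    have keepF : ∀ (k : Fin n) (τ : State), τ.reg i = k → J τ → F τ →
        J ((nest l p).eval w τ) ∧ F ((nest l p).eval w τ) := by
      intro k τ hk hτ hτF
      have := ih hl'.2 (fun j hj => hp j (by simp [hj])) (fun τ => J τ ∧ F τ ∧ τ.reg i = k) F
        (fun τ h => hJ2 τ h.1)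
        (fun τ j hj x h => ⟨hJins τ j (by simp [hj]) x h.1, hFins τ j (by simp [hj]) x h.2.1,
          by simp [hnei j hj, h.2.2]⟩)
        (fun τ j hj x h => hFins τ j (by simp [hj]) x h)
        (fun τ hv h => ?_) (fun τ hv h _ => ?_) (fun τ hv h => ?_) (σ := τ) ⟨hτ, hτF, hk⟩
      · exact ⟨this.1.1, this.2⟩
      · have hv' : ∀ j ∈ i :: l, ∃ v : Fin n, τ.reg j = v := by
          simp only [List.mem_cons, forall_eq_or_imp]
          exact ⟨⟨k, h.2.2⟩, hv⟩
        exact ⟨hJ τ hv' h.1, hF τ hv' h.1 h.2.1, by rw [hregi, h.2.2]⟩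
      · have hv' : ∀ j ∈ i :: l, ∃ v : Fin n, τ.reg j = v := by
          simp only [List.mem_cons, forall_eq_or_imp]
          exact ⟨⟨k, h.2.2⟩, hv⟩
        exact hF τ hv' h.1 h.2.1
      · have hv' : ∀ j ∈ i :: l, ∃ v : Fin n, τ.reg j = v := by
          simp only [List.mem_cons, forall_eq_or_imp]
          exact ⟨⟨k, h.2.2⟩, fun j hj => ⟨val j, hv j hj⟩⟩
        exact hF τ hv' h.1 h.2.1
    have keepJ : ∀ (k : Fin n) (τ : State), τ.reg i = k → J τ → J ((nest l p).eval w τ) := by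
      intro k τ hk hτ
      have := ih hl'.2 (fun j hj => hp j (by simp [hj])) (fun τ => J τ ∧ τ.reg i = k)
        (fun _ => True) (fun τ h => hJ2 τ h.1)
        (fun τ j hj x h => ⟨hJins τ j (by simp [hj]) x h.1, by simp [hnei j hj, h.2]⟩)
        (fun _ _ _ _ _ => trivial)
        (fun τ hv h => ?_) (fun _ _ _ _ => trivial) (fun _ _ _ => trivial) (σ := τ) ⟨hτ, hk⟩
      · exact this.1.1
      · have hv' : ∀ j ∈ i :: l, ∃ v : Fin n, τ.reg j = v := by
          simp only [List.mem_cons, forall_eq_or_imp]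
          exact ⟨⟨k, h.2⟩, hv⟩
        exact ⟨hJ τ hv' h.1, by rw [hregi, h.2]⟩
    have reach : ∀ τ : State, τ.reg i = val i → J τ → F ((nest l p).eval w τ) := by
      intro τ hk hτ
      refine (ih hl'.2 (fun j hj => hp j (by simp [hj])) (fun τ => J τ ∧ τ.reg i = val i) F
        (fun τ h => hJ2 τ h.1)
        (fun τ j hj x h => ⟨hJins τ j (by simp [hj]) x h.1, by simp [hnei j hj, h.2]⟩)
        (fun τ j hj x h => hFins τ j (by simp [hj]) x h)
        (fun τ hv h => ?_) (fun τ hv h hτF => ?_) (fun τ hv h => ?_) (σ := τ) ⟨hτ, hk⟩).2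
      · have hv' : ∀ j ∈ i :: l, ∃ v : Fin n, τ.reg j = v := by
          simp only [List.mem_cons, forall_eq_or_imp]
          exact ⟨⟨_, h.2⟩, hv⟩
        exact ⟨hJ τ hv' h.1, by rw [hregi, h.2]⟩
      · have hv' : ∀ j ∈ i :: l, ∃ v : Fin n, τ.reg j = v := by
          simp only [List.mem_cons, forall_eq_or_imp]
          exact ⟨⟨_, h.2⟩, hv⟩
        exact hF τ hv' h.1 hτF
      · refine hreach τ ?_ h.1
        simp only [List.mem_cons, forall_eq_or_imp]
        exact ⟨h.2, hv⟩
    have := eval_upto hn (i := i) (p := nest l p) (hJ2 σ hσ)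
      (fun k τ => J τ ∧ ((val i : ℕ) < k → F τ)) ⟨hσ, by simp⟩
      (fun k τ x h => ⟨hJins τ i (by simp) x h.1, fun hk => hFins τ i (by simp) x (h.2 hk)⟩)
      (fun k τ hk _ h => ?_)
    · exact ⟨this.1, this.2 (val i).isLt⟩
    · refine ⟨keepJ k τ hk h.1, fun hlt => ?_⟩
      rcases Nat.lt_succ_iff_lt_or_eq.1 hlt with hlt | heq
      · exact (keepF k τ hk h.1 (h.2 hlt)).2
      · exact reach τ (by rw [hk, heq]) h.1

open CleanGraph

/-! ### Building blocks -/

/-- Branch on whether register `t` is zero. -/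
def ifZero (t : ℕ) (p q : Cmd) : Cmd := .ite (.eq t 3) p q

/-- Branch on whether the vertices in registers `u` and `v` are adjacent; uses register `t`. -/
def ifAdj (t u v : ℕ) (p q : Cmd) : Cmd :=
  .seq (.arith t .mul 2 u) (.seq (.arith t .add t v) (.seq (.load t 0 t) (ifZero t q p)))

/-- Run a family of programs indexed by the colors. -/
def all3 (f : Fin 3 → Cmd) : Cmd := .seq (f 0) (.seq (f 1) (f 2))

/-- The invariants of the computation: registers `2`, `3` and `4` hold `n`, `0` and `1`, and
array `0` holds the adjacency matrix. -/
structure Base {n : ℕ} (G : SimpleGraph (Fin n)) (σ : State) : Prop where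
  reg_two : σ.reg 2 = n
  reg_three : σ.reg 3 = 0
  reg_four : σ.reg 4 = 1
  mem_zero : σ.mem 0 = (graphInput G).mem 0

/-- The program writes neither the registers nor the array that `Base` is about. -/
structure Safe (p : Cmd) : Prop where
  reg_two : ¬ p.WritesReg 2
  reg_three : ¬ p.WritesReg 3
  reg_four : ¬ p.WritesReg 4
  mem_zero : ¬ p.WritesMem 0

variable {n w : ℕ} {G : SimpleGraph (Fin n)} {σ τ : State}

theorem Base.frame (hσ : Base G σ) {p : Cmd} (hp : Safe p) (h : Frame p σ τ) : Base G τ :=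
  ⟨(h.1 _ hp.1).trans hσ.1, (h.1 _ hp.2).trans hσ.2, (h.1 _ hp.3).trans hσ.3,
    (h.2 _ hp.4).trans hσ.4⟩

theorem Base.eval (hσ : Base G σ) {p : Cmd} (hp : Safe p) : Base G (p.eval w σ) :=
  hσ.frame hp (frame_eval w p σ)

theorem Base.setReg (hσ : Base G σ) {r x : ℕ} (h2 : r ≠ 2) (h3 : r ≠ 3) (h4 : r ≠ 4) :
    Base G (σ.setReg w r x) :=
  ⟨by simp [h2.symm, hσ.1], by simp [h3.symm, hσ.2], by simp [h4.symm, hσ.3], hσ.4⟩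

theorem eval_ifZero (hσ : σ.reg 3 = 0) (t : ℕ) (p q : Cmd) :
    (ifZero t p q).eval w σ = if σ.reg t = 0 then p.eval w σ else q.eval w σ := by
  simp [ifZero, Cmd.eval, Test.Holds, hσ]

/-- Branch on whether the cell of array `a` addressed by register `i` is zero; uses register `t`. -/
def ifCell (t a i : ℕ) (p q : Cmd) : Cmd := .seq (.load t a i) (ifZero t q p)

theorem eval_ifCell (hσ : σ.reg 3 = 0) {t : ℕ} (ht : t ≠ 3) (a i : ℕ) (p q : Cmd) :
    (ifCell t a i p q).eval w σ =
      if σ.mem a (σ.reg i) % 2 ^ w ≠ 0 then p.eval w (σ.setReg w t (σ.mem a (σ.reg i)))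
      else q.eval w (σ.setReg w t (σ.mem a (σ.reg i))) := by
  unfold ifCell
  simp only [Cmd.eval]
  rw [eval_ifZero (by simp [ht.symm, hσ])]
  by_cases h : σ.mem a (σ.reg i) % 2 ^ w = 0 <;> simp [h]

open Classical in
theorem graphInput_mem (u v : Fin n) :
    (graphInput G).mem 0 (n * (u : ℕ) + (v : ℕ)) = if G.Adj u v then 1 else 0 := by
  have : (∃ i j : Fin n, n * (u : ℕ) + (v : ℕ) = n * (i : ℕ) + (j : ℕ) ∧ G.Adj i j) ↔
      G.Adj u v := by
    constructor
    · rintro ⟨i, j, h, hij⟩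
      have hn : 0 < n := i.pos
      have h1 := congrArg (· / n) h
      have h2 := congrArg (· % n) h
      simp only [Nat.mul_add_div hn, Nat.mul_add_mod,
        Nat.div_eq_of_lt v.isLt, Nat.div_eq_of_lt j.isLt, Nat.mod_eq_of_lt v.isLt,
        Nat.mod_eq_of_lt j.isLt, add_zero] at h1 h2
      rwa [Fin.ext h1, Fin.ext h2]
    · exact fun h => ⟨u, v, rfl, h⟩
  simp [graphInput, this]

open Classical in
theorem eval_ifAdj (hw : n * (n + 1) < 2 ^ w) (hσ : Base G σ) {t u v : ℕ} {a b : Fin n}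
    (hu : σ.reg u = a) (hv : σ.reg v = b) (htv : t ≠ v) (h3 : t ≠ 3) (p q : Cmd) :
    (ifAdj t u v p q).eval w σ =
      if G.Adj a b then p.eval w (σ.setReg w t 1) else q.eval w (σ.setReg w t 0) := by
  have h1 : n * (a : ℕ) < 2 ^ w :=
    lt_of_le_of_lt (Nat.mul_le_mul_left n (by have := a.isLt; omega)) hw
  have h1' : n * (a : ℕ) + (b : ℕ) < 2 ^ w := by
    refine lt_of_le_of_lt ?_ hw
    have := Nat.mul_le_mul_left n a.isLt
    have := b.isLt
    nlinarith
  have key : ∀ x, (((σ.setReg w t (n * (a : ℕ))).setReg w t (n * (a : ℕ) + (b : ℕ))).setReg w t x)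
      = σ.setReg w t x := by
    intro x
    rw [State.setReg_setReg, State.setReg_setReg]
  have hpos : (1 : ℕ) < 2 ^ w := by
    have := a.pos
    nlinarith
  unfold ifAdj
  simp only [Cmd.eval, Op.eval, State.setReg_reg, if_true, hσ.reg_two, hu, if_neg htv.symm, hv,
    Nat.mod_eq_of_lt h1, Nat.mod_eq_of_lt h1', State.setReg_mem, hσ.mem_zero, graphInput_mem, key]
  rw [eval_ifZero (by simp [h3.symm, hσ.reg_three])]
  by_cases hab : G.Adj a b
  · simp [hab, Nat.mod_eq_of_lt hpos]
  · simp [hab]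

theorem forall_lt_succ_iff {P : Fin n → Prop} (k : Fin n) :
    (∀ v : Fin n, (v : ℕ) < k + 1 → P v) ↔ (∀ v : Fin n, (v : ℕ) < k → P v) ∧ P k := by
  constructor
  · exact fun h => ⟨fun y hy => h y (by omega), h k (by omega)⟩
  · rintro ⟨h, hk⟩ y hy
    rcases Nat.lt_succ_iff_lt_or_eq.1 hy with hy | hy
    · exact h y hy
    · rwa [Fin.ext hy]

theorem exists_lt_succ_iff {P : Fin n → Prop} (k : Fin n) :
    (∃ v : Fin n, (v : ℕ) < k + 1 ∧ P v) ↔ (∃ v : Fin n, (v : ℕ) < k ∧ P v) ∨ P k := by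
  constructor
  · rintro ⟨v, hv, h⟩
    rcases Nat.lt_succ_iff_lt_or_eq.1 hv with hv | hv
    · exact Or.inl ⟨v, hv, h⟩
    · exact Or.inr (Fin.ext hv ▸ h)
  · rintro (⟨v, hv, h⟩ | h)
    · exact ⟨v, by omega, h⟩
    · exact ⟨k, by omega, h⟩

/-- The marks stored in the arrays `b`, `b + 1` and `b + 2`, one array for each color. Reading a
cell reduces its content modulo `2 ^ w`. -/
def view (n w b : ℕ) (σ : State) : Fin 3 → Fin n → Prop :=
  fun c y => σ.mem (b + c) y % 2 ^ w ≠ 0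

theorem view_eq_of_frame {p : Cmd} (h : Frame p σ τ) {b : ℕ}
    (hp : ∀ c : Fin 3, ¬ p.WritesMem (b + c)) : view n w b τ = view n w b σ := by
  funext c y
  unfold view
  rw [h.2 _ (hp c)]

theorem view_eval {p : Cmd} {b : ℕ} (hp : ∀ c : Fin 3, ¬ p.WritesMem (b + c)) :
    view n w b (p.eval w σ) = view n w b σ :=
  view_eq_of_frame (frame_eval w p σ) hp

/-- Storing a `1` sets a mark. -/
theorem view_mark (hw : 1 < 2 ^ w) (hσ : σ.reg 4 = 1) {b r : ℕ} {v : Fin n} (hr : σ.reg r = v)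
    (c d : Fin 3) (y : Fin n) :
    view n w b ((Cmd.store (b + c) r 4).eval w σ) d y ↔ view n w b σ d y ∨ (d = c ∧ y = v) := by
  simp only [view, Cmd.eval, State.setMem_mem, hσ, hr]
  by_cases h : d = c ∧ y = v
  · obtain ⟨rfl, rfl⟩ := h
    simp [Nat.mod_eq_of_lt hw]
  · rw [if_neg]
    · simp [h]
    · rintro ⟨h1, h2⟩
      exact h ⟨Fin.ext (by omega), Fin.ext h2⟩

/-- A loop each of whose iterations adds marks. -/
theorem view_upto (hn : n < 2 ^ w) {b i : ℕ} {p : Cmd} (h2 : σ.reg 2 = n)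
    (S : Fin n → Fin 3 → Fin n → Prop)
    (hstep : ∀ (k : Fin n) (τ : State), τ.reg i = k → Frame (.upto i p) σ τ →
      (∀ c y, view n w b τ c y ↔ view n w b σ c y ∨ ∃ j < k, S j c y) →
      ∀ c y, view n w b (p.eval w τ) c y ↔ view n w b τ c y ∨ S k c y) (c : Fin 3) (y : Fin n) :
    view n w b ((Cmd.upto i p).eval w σ) c y ↔ view n w b σ c y ∨ ∃ k, S k c y := by
  have := eval_upto hn (i := i) (p := p) h2 (fun m τ => ∀ c y, view n w b τ c y ↔
    view n w b σ c y ∨ ∃ k : Fin n, (k : ℕ) < m ∧ S k c y) (by simp) (fun _ _ _ h => h)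
    (fun k τ hk hF h => ?_)
  · rw [this c y]
    exact or_congr_right (exists_congr fun k => and_iff_right k.isLt)
  · intro c y
    rw [hstep k τ hk hF h c y, h c y, or_assoc]
    refine or_congr_right ⟨?_, ?_⟩
    · rintro (⟨j, hj, hS⟩ | hS)
      · exact ⟨j, by omega, hS⟩
      · exact ⟨k, by omega, hS⟩
    · rintro ⟨j, hj, hS⟩
      rcases Nat.lt_succ_iff_lt_or_eq.1 hj with hj | hj
      · exact Or.inl ⟨j, hj, hS⟩
      · exact Or.inr (Fin.ext hj ▸ hS)

/-- A sequence of programs each of which adds marks. -/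
theorem view_seqs {b : ℕ} {α : Type*} (f : α → Cmd) (l : List α)
    (S : α → Fin 3 → Fin n → Prop)
    (hstep : ∀ a ∈ l, ∀ (τ : State), Frame (seqs (l.map f)) σ τ →
      ∀ c y, view n w b ((f a).eval w τ) c y ↔ view n w b τ c y ∨ S a c y) (c : Fin 3) (y : Fin n) :
    view n w b ((seqs (l.map f)).eval w σ) c y ↔ view n w b σ c y ∨ ∃ a ∈ l, S a c y := by
  refine eval_seqs f l (fun pre τ => ∀ c y, view n w b τ c y ↔
    view n w b σ c y ∨ ∃ a ∈ pre, S a c y) (by simp) (fun pre a τ hF h ha c y => ?_) c y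
  rw [hstep a ha τ hF c y, h c y]
  simp only [List.mem_append, List.mem_singleton, or_and_right, exists_or, exists_eq_left,
    or_assoc]

/-- The analogue of `view_seqs` for three programs indexed by the colors. -/
theorem view_all3 {b : ℕ} (f : Fin 3 → Cmd) (S : Fin 3 → Fin 3 → Fin n → Prop)
    (hstep : ∀ a, ∀ (τ : State), Frame (all3 f) σ τ →
      ∀ c y, view n w b ((f a).eval w τ) c y ↔ view n w b τ c y ∨ S a c y) (c : Fin 3) (y : Fin n) :
    view n w b ((all3 f).eval w σ) c y ↔ view n w b σ c y ∨ ∃ a, S a c y := by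
  have fr : ∀ τ' a, Frame (all3 f) σ τ' → Frame (all3 f) σ ((f a).eval w τ') := by
    intro τ' a h
    have hc : ∀ a : Fin 3, a = 0 ∨ a = 1 ∨ a = 2 := by decide
    refine ⟨fun r hr => ?_, fun x hx => ?_⟩
    · rw [eval_reg _ _ _, h.1 r hr]
      simp only [all3, WritesReg, not_or] at hr
      rcases hc a with rfl | rfl | rfl
      · exact hr.1
      · exact hr.2.1
      · exact hr.2.2
    · rw [eval_mem _ _ _, h.2 x hx]
      simp only [all3, WritesMem, not_or] at hx
      rcases hc a with rfl | rfl | rfl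
      · exact hx.1
      · exact hx.2.1
      · exact hx.2.2
  have f0 : Frame (all3 f) σ σ := ⟨fun _ _ => rfl, fun _ _ => rfl⟩
  have f1 := fr σ 0 f0
  have f2 := fr _ 1 f1
  have : (all3 f).eval w σ = (f 2).eval w ((f 1).eval w ((f 0).eval w σ)) := rfl
  rw [this, hstep 2 _ f2, hstep 1 _ f1, hstep 0 _ f0, Fin.exists_fin_succ, Fin.exists_fin_two]
  simp only [or_assoc]
  rfl

/-! ### Propagation -/

/-- Propagation of one color in the arrays `10`, `11` and `12`. -/
def propagateColorCmd (c : Fin 3) : Cmd :=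
  .upto 60 (.upto 61 (ifAdj 62 60 61
    (ifCell 62 (10 + (c + 1 : Fin 3)) 60 (ifCell 62 (10 + (c + 2 : Fin 3)) 60
      (.store (10 + c) 61 4) .skip) .skip) .skip))

/-- One round of propagation. -/
def propagateRoundCmd : Cmd := all3 propagateColorCmd

/-- Propagation in the arrays `10`, `11` and `12`, with `3 * n` rounds. -/
def propagateCmd : Cmd :=
  .seq (.upto 63 propagateRoundCmd) (.seq (.upto 63 propagateRoundCmd) (.upto 63 propagateRoundCmd))

theorem propagateColorCmd_writesReg {c : Fin 3} {r : ℕ} (h : (propagateColorCmd c).WritesReg r) :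
    60 ≤ r ∧ r ≤ 62 := by
  simp [propagateColorCmd, ifAdj, ifCell, ifZero, WritesReg] at h
  omega

theorem propagateColorCmd_writesMem {c : Fin 3} {a : ℕ} :
    (propagateColorCmd c).WritesMem a ↔ a = 10 + c := by
  simp [propagateColorCmd, ifAdj, ifCell, ifZero, WritesMem]

theorem propagateRoundCmd_writesReg {r : ℕ} (h : propagateRoundCmd.WritesReg r) :
    60 ≤ r ∧ r ≤ 62 := by
  rcases h with h | h | h <;> exact propagateColorCmd_writesReg h

theorem propagateRoundCmd_writesMem {a : ℕ} (h : propagateRoundCmd.WritesMem a) :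
    10 ≤ a ∧ a ≤ 12 := by
  rcases h with h | h | h <;> rw [propagateColorCmd_writesMem] at h <;> simp at h <;> omega

theorem propagateCmd_writesReg {r : ℕ} (h : propagateCmd.WritesReg r) : 60 ≤ r ∧ r ≤ 63 := by
  rcases h with (rfl | h) | (rfl | h) | (rfl | h)
  all_goals first | omega | (have := propagateRoundCmd_writesReg h; omega)

theorem propagateCmd_writesMem {a : ℕ} (h : propagateCmd.WritesMem a) : 10 ≤ a ∧ a ≤ 12 := by
  rcases h with h | h | h <;> exact propagateRoundCmd_writesMem h

theorem Safe.of_bounds {p : Cmd} (h : ∀ r, p.WritesReg r → r < 2 ∨ 4 < r)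
    (h' : ∀ a, p.WritesMem a → 0 < a) : Safe p :=
  ⟨fun e => by simpa using h _ e, fun e => by simpa using h _ e, fun e => by simpa using h _ e,
    fun e => by simpa using h' _ e⟩

theorem safe_propagateColorCmd (c : Fin 3) : Safe (propagateColorCmd c) :=
  .of_bounds (fun r h => by have := propagateColorCmd_writesReg h; omega)
    (fun a h => by rw [propagateColorCmd_writesMem] at h; omega)

theorem safe_propagateCmd : Safe propagateCmd :=
  .of_bounds (fun r h => by have := propagateCmd_writesReg h; omega)
    (fun a h => by have := propagateCmd_writesMem h; omega)

theorem lt_of_bound (hw : n * (n + 1) < 2 ^ w) : n < 2 ^ w := by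
  rcases Nat.eq_zero_or_pos n with rfl | h
  · positivity
  · nlinarith

theorem one_lt_of_bound (hw : n * (n + 1) < 2 ^ w) (v : Fin n) : 1 < 2 ^ w := by
  have := v.pos
  nlinarith

theorem view_propagateColorCmd (hw : n * (n + 1) < 2 ^ w) (hσ : Base G σ) (c : Fin 3) :
    view n w 10 ((propagateColorCmd c).eval w σ) = propagateColor G c (view n w 10 σ) := by
  have hne : ∀ c : Fin 3, c + 1 ≠ c ∧ c + 2 ≠ c := by decide
  have hne' : ∀ d, d ≠ c → 10 + (d : ℕ) ≠ 10 + (c : ℕ) := fun d hd e => hd (Fin.ext (by omega))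
  have hn := lt_of_bound hw
  funext d y
  refine propext ?_
  have hsafe := safe_propagateColorCmd c
  unfold propagateColorCmd at hsafe ⊢
  rw [view_upto (b := 10) hn hσ.reg_two
    (fun u d y => d = c ∧ G.Adj u y ∧ view n w 10 σ (c + 1) u ∧ view n w 10 σ (c + 2) u)]
  · simp only [propagateColor]
    tauto
  intro u τ hu hF _ d y
  have hτ := hσ.frame hsafe hF
  rw [view_upto (b := 10) (i := 61) hn hτ.reg_two (fun v d y => (d = c ∧ y = v) ∧ G.Adj u v ∧
    view n w 10 σ (c + 1) u ∧ view n w 10 σ (c + 2) u)]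
  · apply or_congr_right
    constructor
    · rintro ⟨v, ⟨rfl, rfl⟩, h⟩
      exact ⟨rfl, h⟩
    · rintro ⟨rfl, h⟩
      exact ⟨y, ⟨rfl, rfl⟩, h⟩
  intro v τ' hv hF' _ d y
  have hτ' : Base G τ' := by
    refine hτ.frame (.of_bounds ?_ ?_) hF' <;>
      simp [ifAdj, ifCell, ifZero, WritesReg, WritesMem]
  have hu' : τ'.reg 60 = u := by
    rw [hF'.1 60 (by simp [ifAdj, ifCell, ifZero, WritesReg]), hu]
  have hmem : ∀ d, d ≠ c → τ'.mem (10 + d) = σ.mem (10 + d) := by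
    intro d hd
    have h1 := hne' d hd
    rw [hF'.2 _ (by simpa [ifAdj, ifCell, ifZero, WritesMem] using h1),
      hF.2 _ (by simpa [ifAdj, ifCell, ifZero, WritesMem] using h1)]
  have h1w := one_lt_of_bound hw u
  have hc1 := hmem _ (hne c).1
  have hc2 := hmem _ (hne c).2
  rw [eval_ifAdj hw hτ' hu' hv (by decide) (by decide), eval_ifCell (by simp [hτ'.reg_three])
    (by decide), eval_ifCell (by simp [hτ'.reg_three]) (by decide)]
  simp only [State.setReg_mem, State.setReg_reg, hu', hc1, hc2, Nat.reduceEqDiff, if_false,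
    Cmd.eval.eq_1]
  have e : ∀ x y z, view n w 10 (((σ.setReg w x y).setReg w x z).setReg w x z) = view n w 10 σ :=
    fun _ _ _ => rfl
  split_ifs with h1 h2 h3
  · rw [view_mark h1w (by simp [hτ'.reg_four]) (v := v) (by simp [hv])]
    exact or_congr Iff.rfl ⟨fun h => ⟨h, h1, h2, h3⟩, fun h => h.1⟩
  · exact ⟨fun h => Or.inl h, fun h => h.resolve_right fun h => h3 h.2.2.2⟩
  · exact ⟨fun h => Or.inl h, fun h => h.resolve_right fun h => h2 h.2.2.1⟩
  · exact ⟨fun h => Or.inl h, fun h => h.resolve_right fun h => h1 h.2.1⟩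

theorem view_propagateRoundCmd (hw : n * (n + 1) < 2 ^ w) (hσ : Base G σ) :
    view n w 10 (propagateRoundCmd.eval w σ) = propagateRound G (view n w 10 σ) := by
  have h0 : Base G ((propagateColorCmd 0).eval w σ) := hσ.eval (safe_propagateColorCmd 0)
  have h1 : Base G ((propagateColorCmd 1).eval w ((propagateColorCmd 0).eval w σ)) :=
    h0.eval (safe_propagateColorCmd 1)
  simp only [propagateRoundCmd, all3, Cmd.eval]
  rw [view_propagateColorCmd hw h1, view_propagateColorCmd hw h0, view_propagateColorCmd hw hσ]
  rfl

theorem view_propagateCmd (hw : n * (n + 1) < 2 ^ w) (hσ : Base G σ) :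
    view n w 10 (propagateCmd.eval w σ) = propagate G (view n w 10 σ) := by
  have hsafe : Safe (.upto 63 propagateRoundCmd) :=
    .of_bounds (by rintro r (rfl | h); · omega
                   have := propagateRoundCmd_writesReg h; omega)
      (fun a h => by have := propagateRoundCmd_writesMem h; omega)
  have key : ∀ σ, Base G σ → view n w 10 ((Cmd.upto 63 propagateRoundCmd).eval w σ) =
      (propagateRound G)^[n] (view n w 10 σ) := by
    intro σ hσ
    refine eval_upto (lt_of_bound hw) hσ.reg_two
      (fun k τ => view n w 10 τ = (propagateRound G)^[k] (view n w 10 σ)) rfl (fun _ _ _ h => h)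
      (fun k τ _ hF h => ?_)
    rw [view_propagateRoundCmd hw (hσ.frame hsafe hF), h, Function.iterate_succ_apply']
  have h0 : Base G ((Cmd.upto 63 propagateRoundCmd).eval w σ) := hσ.eval hsafe
  have h1 : Base G ((Cmd.upto 63 propagateRoundCmd).eval w
      ((Cmd.upto 63 propagateRoundCmd).eval w σ)) := h0.eval hsafe
  simp only [propagateCmd, Cmd.eval.eq_6]
  rw [key _ h1, key _ h0, key _ hσ, propagate, Fintype.card_fin, ← Function.iterate_add_apply,
    ← Function.iterate_add_apply, add_assoc]

/-! ### Trials -/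

/-- Copy the nonzero pattern of array `s` to array `d`. -/
def copyArray (s d : ℕ) : Cmd := .upto 64 (ifCell 65 s 64 (.store d 64 4) (.store d 64 3))

/-- Copy the marks at `s` to `d`. -/
def copyMarks (s d : ℕ) : Cmd := all3 fun c => copyArray (s + c) (d + c)

theorem copyMarks_writesReg {s d r : ℕ} (h : (copyMarks s d).WritesReg r) : 64 ≤ r ∧ r ≤ 65 := by
  simp [copyMarks, all3, copyArray, ifCell, ifZero, WritesReg] at h
  omega

theorem copyMarks_writesMem {s d a : ℕ} (h : (copyMarks s d).WritesMem a) :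
    d ≤ a ∧ a ≤ d + 2 := by
  simp [copyMarks, all3, copyArray, ifCell, ifZero, WritesMem] at h
  omega

theorem safe_copyMarks {s d : ℕ} (hd : 0 < d) : Safe (copyMarks s d) :=
  .of_bounds (fun r h => by have := copyMarks_writesReg h; omega)
    (fun a h => by have := copyMarks_writesMem h; omega)

theorem eval_copyArray (hw : n * (n + 1) < 2 ^ w) (hσ : Base G σ) {s d : ℕ} (hsd : s ≠ d)
    (hd : 0 < d) (y : Fin n) :
    ((copyArray s d).eval w σ).mem d y % 2 ^ w ≠ 0 ↔ σ.mem s y % 2 ^ w ≠ 0 := by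
  have hsafe : Safe (copyArray s d) := by
    refine .of_bounds ?_ ?_ <;> simp [copyArray, ifCell, ifZero, WritesReg, WritesMem, hd]
  unfold copyArray at hsafe ⊢
  refine eval_upto (lt_of_bound hw) hσ.reg_two (fun k τ => ∀ y : Fin n, (y : ℕ) < k →
    (τ.mem d y % 2 ^ w ≠ 0 ↔ σ.mem s y % 2 ^ w ≠ 0)) (by simp) (fun _ _ _ h => h)
    (fun k τ hk hF h => ?_) y y.isLt
  intro y hy
  have hτ := hσ.frame hsafe hF
  have hs : τ.mem s = σ.mem s := hF.2 s (by simpa [ifCell, ifZero, WritesMem] using hsd)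
  have h1w := one_lt_of_bound hw y
  rw [eval_ifCell (by simp [hτ.reg_three]) (by decide), hk, hs]
  by_cases hyk : y = k
  · subst hyk
    split_ifs with h1
    · simp [Cmd.eval, hk, hτ.reg_four, Nat.mod_eq_of_lt h1w, h1]
    · simpa [Cmd.eval, hk, hτ.reg_three] using h1
  · have hne : (y : ℕ) ≠ k := fun e => hyk (Fin.ext e)
    rw [← h y (by omega)]
    split_ifs with h1 <;> simp [Cmd.eval, hk, hne]

theorem view_copyMarks (hw : n * (n + 1) < 2 ^ w) (hσ : Base G σ) {s d : ℕ}
    (hsd : s + 2 < d ∨ d + 2 < s) (hd : 0 < d) :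
    view n w d ((copyMarks s d).eval w σ) = view n w s σ := by
  have hsafe : ∀ c : Fin 3, Safe (copyArray (s + c) (d + c)) := fun c => by
    refine .of_bounds ?_ ?_ <;> simp [copyArray, ifCell, ifZero, WritesReg, WritesMem]
    omega
  have hmem : ∀ (c : Fin 3) (a : ℕ) (σ : State), a ≠ d + c →
      ((copyArray (s + c) (d + c)).eval w σ).mem a = σ.mem a := fun c a σ h =>
    eval_mem _ (by simpa [copyArray, ifCell, ifZero, WritesMem] using h) σ
  have h0 : Base G _ := hσ.eval (w := w) (hsafe 0)
  have h1 : Base G _ := h0.eval (w := w) (hsafe 1)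
  funext c y
  refine propext ?_
  have hc : c = 0 ∨ c = 1 ∨ c = 2 := by
    revert c
    decide
  simp only [copyMarks, all3, Cmd.eval.eq_6, view]
  rcases hc with rfl | rfl | rfl
  · rw [hmem 2 _ _ (by simp), hmem 1 _ _ (by simp)]
    exact eval_copyArray hw hσ (by simp; omega) (by simp; omega) y
  · rw [hmem 2 _ _ (by simp), ← hmem 0 (s + (1 : Fin 3)) σ (by simp; omega)]
    exact eval_copyArray hw h0 (by simp; omega) (by simp) y
  · rw [← hmem 0 (s + (2 : Fin 3)) σ (by simp; omega),
      ← hmem 1 (s + (2 : Fin 3)) _ (by simp; omega)]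
    exact eval_copyArray hw h1 (by simp; omega) (by simp) y

/-- Set register `66` unless some color is left at every vertex. -/
def checkEmpty : Cmd :=
  .seq (.const 66 0) (.upto 67 (ifCell 68 10 67 (ifCell 68 11 67 (ifCell 68 12 67
    (.const 66 1) .skip) .skip) .skip))

theorem safe_checkEmpty : Safe checkEmpty := by
  refine .of_bounds ?_ ?_ <;> simp [checkEmpty, ifCell, ifZero, WritesReg, WritesMem]

theorem eval_checkEmpty (hw : n * (n + 1) < 2 ^ w) (hσ : Base G σ) :
    (checkEmpty.eval w σ).reg 66 = 0 ↔ ∀ y, ∃ c, ¬ view n w 10 σ c y := by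
  have hsafe := safe_checkEmpty
  unfold checkEmpty at hsafe ⊢
  simp only [Cmd.eval.eq_6, Cmd.eval.eq_2]
  have hσ' : Base G (σ.setReg w 66 0) := hσ.setReg (by decide) (by decide) (by decide)
  have := eval_upto (lt_of_bound hw) (i := 67) (p := ifCell 68 10 67 (ifCell 68 11 67
    (ifCell 68 12 67 (.const 66 1) .skip) .skip) .skip) hσ'.reg_two (fun k τ => τ.reg 66 = 0 ↔
    ∀ y : Fin n, (y : ℕ) < k → ∃ c, ¬ view n w 10 σ c y) (by simp) (fun k τ x h => by simpa using h)
    (fun k τ hk hF h => ?_)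
  · rw [this]
    exact forall_congr' fun y => ⟨fun h => h y.isLt, fun h _ => h⟩
  have hτ := hσ'.frame ⟨fun h => hsafe.1 (Or.inr h), fun h => hsafe.2 (Or.inr h),
    fun h => hsafe.3 (Or.inr h), fun h => hsafe.4 (Or.inr h)⟩ hF
  have hmem : ∀ a, τ.mem a = σ.mem a := fun a => hF.2 a (by simp [ifCell, ifZero, WritesMem])
  have h1w := one_lt_of_bound hw k
  rw [forall_lt_succ_iff, ← h, eval_ifCell (by simp [hτ.reg_three]) (by decide),
    eval_ifCell (by simp [hτ.reg_three]) (by decide),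
    eval_ifCell (by simp [hτ.reg_three]) (by decide), Fin.exists_fin_succ, Fin.exists_fin_two]
  simp only [State.setReg_mem, State.setReg_reg, hk, hmem, Nat.reduceEqDiff, if_false]
  split_ifs with h1 h2 h3
  · have : ¬ (¬ view n w 10 σ 0 k ∨ ¬ view n w 10 σ 1 k ∨ ¬ view n w 10 σ 2 k) := by
      rintro (h | h | h)
      · exact h h1
      · exact h h2
      · exact h h3
    simp only [Fin.succ_zero_eq_one, Fin.succ_one_eq_two]
    simp [Cmd.eval, Nat.mod_eq_of_lt h1w]
    exact fun _ => by simpa using this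
  · have : ¬ view n w 10 σ 2 k := h3
    simp [Cmd.eval, this]
  · have : ¬ view n w 10 σ 1 k := h2
    simp [Cmd.eval, this]
  · have : ¬ view n w 10 σ 0 k := h1
    simp [Cmd.eval, this]

/-- Try color `a` for the vertex in register `50`; the lists are stored at `13`. -/
def trialCmd (a : Fin 3) : Cmd :=
  .seq (copyMarks 13 10) (.seq (all3 fun c => if c = a then .skip else .store (10 + c) 50 4)
    (.seq propagateCmd (.seq checkEmpty (ifZero 66 (copyMarks 10 13) .skip))))

theorem trialCmd_writesReg {a : Fin 3} {r : ℕ} (h : (trialCmd a).WritesReg r) :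
    60 ≤ r ∧ r ≤ 68 := by
  have hst : ¬ (all3 fun c => if c = a then Cmd.skip else .store (10 + c) 50 4).WritesReg r := by
    simp only [all3, WritesReg]
    split_ifs <;> simp [WritesReg]
  rcases h with h | h | h | h | h | h
  · have := copyMarks_writesReg h
    omega
  · exact absurd h hst
  · have := propagateCmd_writesReg h
    omega
  · simp [checkEmpty, ifCell, ifZero, WritesReg] at h
    omega
  · have := copyMarks_writesReg h
    omega
  · exact h.elim

theorem trialCmd_writesMem {a : Fin 3} {b : ℕ} (h : (trialCmd a).WritesMem b) :
    10 ≤ b ∧ b ≤ 15 := by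
  have hst : (all3 fun c => if c = a then Cmd.skip else .store (10 + c) 50 4).WritesMem b →
      10 ≤ b ∧ b ≤ 12 := by
    simp only [all3, WritesMem]
    split_ifs <;> simp [WritesMem] <;> omega
  rcases h with h | h | h | h | h | h
  · have := copyMarks_writesMem h
    omega
  · have := hst h
    omega
  · have := propagateCmd_writesMem h
    omega
  · simp [checkEmpty, ifCell, ifZero, WritesMem] at h
  · have := copyMarks_writesMem h
    omega
  · exact h.elim

theorem safe_trialCmd (a : Fin 3) : Safe (trialCmd a) :=
  .of_bounds (fun r h => by have := trialCmd_writesReg h; omega)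
    (fun r h => by have := trialCmd_writesMem h; omega)

theorem view_trialCmd (hw : n * (n + 1) < 2 ^ w) (hσ : Base G σ) {v : Fin n}
    (hv : σ.reg 50 = v) (a : Fin 3) :
    view n w 13 ((trialCmd a).eval w σ) = trial G v a (view n w 13 σ) := by
  have hst : Safe (all3 fun c => if c = a then Cmd.skip else .store (10 + c) 50 4) := by
    refine .of_bounds ?_ ?_ <;> simp only [all3, WritesReg, WritesMem] <;> split_ifs <;>
      simp [WritesReg, WritesMem]
  unfold trialCmd
  simp only [Cmd.eval.eq_6]
  set σ₁ := (copyMarks 13 10).eval w σ with hσ₁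
  have B₁ : Base G σ₁ := hσ.eval (safe_copyMarks (by decide))
  have v₁ : view n w 10 σ₁ = view n w 13 σ := view_copyMarks hw hσ (by decide) (by decide)
  have u₁ : view n w 13 σ₁ = view n w 13 σ :=
    view_eval fun c h => by have := copyMarks_writesMem h; omega
  have r₁ : σ₁.reg 50 = v := by
    rw [hσ₁, eval_reg _ (fun h => by have := copyMarks_writesReg h; omega), hv]
  set σ₂ := (all3 fun c => if c = a then Cmd.skip else .store (10 + c) 50 4).eval w σ₁ with hσ₂
  have B₂ : Base G σ₂ := B₁.eval hst
  have v₂ : view n w 10 σ₂ = assign v a (view n w 13 σ) := by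
    funext d y
    refine propext ?_
    rw [hσ₂, view_all3 _ (fun c d y => c ≠ a ∧ d = c ∧ y = v), v₁]
    · refine or_congr Iff.rfl ⟨?_, ?_⟩
      · rintro ⟨c, h1, rfl, h2⟩
        exact ⟨h2, h1⟩
      · rintro ⟨h2, h1⟩
        exact ⟨d, h1, rfl, h2⟩
    · intro c τ hF d y
      have hτ := B₁.frame hst hF
      split_ifs with hc
      · simp [hc, Cmd.eval]
      · have hr : τ.reg 50 = v := by
          rw [hF.1 50, r₁]
          simp only [all3, WritesReg]
          split_ifs <;> simp [WritesReg]
        rw [view_mark (one_lt_of_bound hw v) hτ.reg_four hr]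
        simp [hc]
  have u₂ : view n w 13 σ₂ = view n w 13 σ := by
    rw [hσ₂, view_eval, u₁]
    intro c
    simp only [all3, WritesMem]
    split_ifs <;> simp [WritesMem] <;> omega
  set σ₃ := propagateCmd.eval w σ₂ with hσ₃
  have B₃ : Base G σ₃ := B₂.eval safe_propagateCmd
  have v₃ : view n w 10 σ₃ = propagate G (assign v a (view n w 13 σ)) := by
    rw [hσ₃, view_propagateCmd hw B₂, v₂]
  have u₃ : view n w 13 σ₃ = view n w 13 σ := by
    rw [hσ₃, view_eval, u₂]
    intro c h
    have := propagateCmd_writesMem h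
    omega
  have hE := eval_checkEmpty hw B₃
  set σ₄ := checkEmpty.eval w σ₃ with hσ₄
  have B₄ : Base G σ₄ := B₃.eval safe_checkEmpty
  have m₄ : ∀ b, view n w b σ₄ = view n w b σ₃ := fun b =>
    view_eval fun c => by simp [checkEmpty, ifCell, ifZero, WritesMem]
  rw [eval_ifZero B₄.reg_three, trial, ← v₃]
  by_cases h : σ₄.reg 66 = 0
  · rw [if_pos h, if_pos (hE.1 h), view_copyMarks hw B₄ (by decide) (by decide), m₄]
  · rw [if_neg h, if_neg (fun h' => h (hE.2 h'))]
    simp only [Cmd.eval, m₄, u₃]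

/-- Reduce the lists stored at `13` to single colors, vertex by vertex. -/
def solveCmd : Cmd := .upto 50 (all3 trialCmd)

theorem solveCmd_writesReg {r : ℕ} (h : solveCmd.WritesReg r) : 50 ≤ r ∧ r ≤ 68 := by
  rcases h with rfl | h | h | h
  · omega
  all_goals
    have := trialCmd_writesReg h
    omega

theorem solveCmd_writesMem {a : ℕ} (h : solveCmd.WritesMem a) : 10 ≤ a ∧ a ≤ 15 := by
  rcases h with h | h | h <;> exact trialCmd_writesMem h

theorem safe_solveCmd : Safe solveCmd :=
  .of_bounds (fun r h => by have := solveCmd_writesReg h; omega)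
    (fun r h => by have := solveCmd_writesMem h; omega)

/-- Solvability is kept, and after the iteration for a vertex its list is a single color. -/
theorem isSolvable_solveCmd (hw : n * (n + 1) < 2 ^ w) (hσ : Base G σ)
    (h : IsSolvable G (view n w 13 σ)) :
    IsSolvable G (view n w 13 (solveCmd.eval w σ)) ∧
      ∀ v, Decided (view n w 13 (solveCmd.eval w σ)) v := by
  have := eval_upto (lt_of_bound hw) (i := 50) (p := all3 trialCmd) hσ.reg_two
    (fun k τ => IsSolvable G (view n w 13 τ) ∧
      ∀ v : Fin n, (v : ℕ) < k → Decided (view n w 13 τ) v) ⟨h, by simp⟩ (fun _ _ _ h => h)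
    (fun k τ hk hF h => ?_)
  · exact ⟨this.1, fun v => this.2 v v.isLt⟩
  have hτ := hσ.frame safe_solveCmd hF
  have hreg : ∀ (a : Fin 3) (τ : State), τ.reg 50 = k → ((trialCmd a).eval w τ).reg 50 = k := by
    intro a τ h
    rw [eval_reg _ (fun h => by have := trialCmd_writesReg h; omega), h]
  have h1 : Base G _ := hτ.eval (w := w) (safe_trialCmd 0)
  have h2 : Base G _ := h1.eval (w := w) (safe_trialCmd 1)
  have key : view n w 13 ((all3 trialCmd).eval w τ) = trials G k (view n w 13 τ) := by
    simp only [all3, Cmd.eval.eq_6]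
    rw [view_trialCmd hw h2 (hreg 1 _ (hreg 0 _ hk)), view_trialCmd hw h1 (hreg 0 _ hk),
      view_trialCmd hw hτ hk]
    rfl
  rw [key]
  refine ⟨h.1.trials k, fun v hv => ?_⟩
  rcases Nat.lt_succ_iff_lt_or_eq.1 hv with hv | hv
  · exact (h.2 v hv).mono (le_trials k _)
  · rw [Fin.ext hv]
    exact h.1.decided_trials k

/-! ### The forbidden colors of a guess -/

/-- Register `20 + i` holds the vertex `C i`. -/
def HoldsGon (C : Fin 7 → Fin n) (σ : State) : Prop := ∀ i : Fin 7, σ.reg (20 + i) = C i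

/-- The ordered pairs of distinct colors. -/
def colorPairs : List (Fin 3 × Fin 3) := [(0, 1), (0, 2), (1, 0), (1, 2), (2, 0), (2, 1)]

theorem mem_colorPairs {p : Fin 3 × Fin 3} : p ∈ colorPairs ↔ p.1 ≠ p.2 := by
  revert p
  decide

/-- The register of the guess for a pair of colors. -/
def guessReg (p : Fin 3 × Fin 3) : ℕ := 30 + 3 * p.1 + p.2

theorem guessReg_bounds (p : Fin 3 × Fin 3) : 30 ≤ guessReg p ∧ guessReg p ≤ 38 := by
  unfold guessReg
  omega

/-- The guess registers hold the vertices given by `g`. -/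
def HoldsGuess (g : Fin 3 → Fin 3 → Fin n) (σ : State) : Prop :=
  ∀ p ∈ colorPairs, σ.reg (guessReg p) = g p.1 p.2

/-- Array `3` holds the weights. -/
def HoldsWeights (G : SimpleGraph (Fin n)) (C : Fin 7 → Fin n) (σ : State) : Prop :=
  ∀ y : Fin n, σ.mem 3 y = weight G C y

theorem HoldsGon.frame {C : Fin 7 → Fin n} (h : HoldsGon C σ) {p : Cmd} (hF : Frame p σ τ)
    (hp : ∀ r, p.WritesReg r → r < 20 ∨ 26 < r) : HoldsGon C τ := by
  intro i
  rw [hF.1 _ (fun e => by have := hp _ e; omega), h i]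

theorem HoldsGuess.frame {g : Fin 3 → Fin 3 → Fin n} (h : HoldsGuess g σ) {p : Cmd}
    (hF : Frame p σ τ) (hp : ∀ r, p.WritesReg r → r < 30 ∨ 38 < r) : HoldsGuess g τ := by
  intro q hq
  have := guessReg_bounds q
  rw [hF.1 _ (fun e => by have := hp _ e; omega), h q hq]

theorem HoldsWeights.frame {C : Fin 7 → Fin n} (h : HoldsWeights G C σ) {p : Cmd}
    (hF : Frame p σ τ) (hp : ¬ p.WritesMem 3) : HoldsWeights G C τ := by
  intro y
  rw [hF.2 _ hp, h y]

/-- The bound by which weights fit into words. -/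
theorem weight_le (C : Fin 7 → Fin n) (y : Fin n) : weight G C y ≤ n * (n + 1) := by
  classical
  unfold weight
  calc _ ≤ ∑ x : Fin n with Touches G C y x, (n + 1) := by
        refine Finset.sum_le_sum fun x _ => ?_
        split_ifs
        · rw [Fintype.card_fin]
          omega
        · omega
    _ ≤ n * (n + 1) := by
        rw [Finset.sum_const, smul_eq_mul]
        refine Nat.mul_le_mul_right _ ((Finset.card_le_univ _).trans ?_)
        simp

/-- Remove all marks at `10`. -/
def clearMarks : Cmd := all3 fun c => .upto 64 (.store (10 + c) 64 3)

/-- Mark the colors of the neighbors on the `7`-gon, in the arrays from `b` on. -/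
def markSeen (b : ℕ) (κ : Fin 7 → Fin 3) : Cmd :=
  .upto 64 (seqs ((List.finRange 7).map fun i : Fin 7 =>
    ifAdj 62 64 (20 + i) (.store (b + κ i) 64 4) .skip))

/-- Mark color `p.2` at the vertex in register `64` if that vertex sees only color `p.1` and
outweighs the guess for `p`. -/
def markHeavyAt (p : Fin 3 × Fin 3) : Cmd :=
  ifZero (70 + p.1) .skip (ifZero (70 + (p.1 + 1 : Fin 3)) (ifZero (70 + (p.1 + 2 : Fin 3))
    (.seq (.load 62 3 (guessReg p)) (.seq (.load 63 3 64)
      (.ite (.lt 62 63) (.store (10 + p.2) 64 4) .skip))) .skip) .skip)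

/-- Load the marks at the vertex in register `64` into registers `70`, `71` and `72`. -/
def loadMarks : Cmd := .seq (.load 70 10 64) (.seq (.load 71 11 64) (.load 72 12 64))

/-- Mark color `c` at the vertices that see only one color `k ≠ c` and outweigh the guess for `k`
and `c`. -/
def markHeavy : Cmd := .upto 64 (.seq loadMarks (seqs (colorPairs.map markHeavyAt)))

/-- Mark all colors but `a` at the vertex in register `r`. -/
def markAllBut (a : Fin 3) (r : ℕ) : Cmd :=
  all3 fun c => if c = a then .skip else .store (10 + c) r 4

/-- Mark all colors but `κ i` at the vertex `i` of the `7`-gon. -/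
def markGon (κ : Fin 7 → Fin 3) : Cmd :=
  seqs ((List.finRange 7).map fun i : Fin 7 => markAllBut (κ i) (20 + i))

/-- Mark all colors but the guessed one at the guessed vertices. -/
def markGuess : Cmd := seqs (colorPairs.map fun p => markAllBut p.2 (guessReg p))

/-- Store the forbidden colors at `10`. -/
def buildCmd (κ : Fin 7 → Fin 3) : Cmd :=
  .seq clearMarks (.seq (markSeen 10 κ) (.seq markHeavy (.seq (markGon κ) markGuess)))

theorem clearMarks_writesReg {r : ℕ} (h : clearMarks.WritesReg r) : r = 64 := by
  simpa [clearMarks, all3, WritesReg] using h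

theorem clearMarks_writesMem {a : ℕ} (h : clearMarks.WritesMem a) : 10 ≤ a ∧ a ≤ 12 := by
  simp [clearMarks, all3, WritesMem] at h
  omega

theorem markSeen_writesReg {b : ℕ} {κ : Fin 7 → Fin 3} {r : ℕ} (h : (markSeen b κ).WritesReg r) :
    r = 62 ∨ r = 64 := by
  simp [markSeen, writesReg_seqs, ifAdj, ifZero, WritesReg] at h
  omega

theorem markSeen_writesMem {b : ℕ} {κ : Fin 7 → Fin 3} {a : ℕ}
    (h : (markSeen b κ).WritesMem a) : b ≤ a ∧ a ≤ b + 2 := by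
  simp [markSeen, writesMem_seqs, ifAdj, ifZero, WritesMem] at h
  obtain ⟨i, rfl⟩ := h
  omega

theorem markHeavyAt_writesReg {p : Fin 3 × Fin 3} {r : ℕ} (h : (markHeavyAt p).WritesReg r) :
    r = 62 ∨ r = 63 := by
  simp [markHeavyAt, ifZero, WritesReg] at h
  omega

theorem markHeavyAt_writesMem {p : Fin 3 × Fin 3} {a : ℕ} (h : (markHeavyAt p).WritesMem a) :
    10 ≤ a ∧ a ≤ 12 := by
  simp [markHeavyAt, ifZero, WritesMem] at h
  omega

theorem markHeavyAts_writesReg {r : ℕ} (h : (seqs (colorPairs.map markHeavyAt)).WritesReg r) :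
    r = 62 ∨ r = 63 := by
  rw [writesReg_seqs] at h
  obtain ⟨_, hp, h⟩ := h
  obtain ⟨p, -, rfl⟩ := List.mem_map.1 hp
  exact markHeavyAt_writesReg h

theorem markHeavyAts_writesMem {r : ℕ} (h : (seqs (colorPairs.map markHeavyAt)).WritesMem r) :
    10 ≤ r ∧ r ≤ 12 := by
  rw [writesMem_seqs] at h
  obtain ⟨_, hp, h⟩ := h
  obtain ⟨p, -, rfl⟩ := List.mem_map.1 hp
  exact markHeavyAt_writesMem h

theorem markHeavy_writesReg {r : ℕ} (h : markHeavy.WritesReg r) : 62 ≤ r ∧ r ≤ 72 := by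
  rcases h with rfl | h | h
  · omega
  · simp only [loadMarks, WritesReg] at h
    omega
  · have := markHeavyAts_writesReg h
    omega

theorem markHeavy_writesMem {a : ℕ} (h : markHeavy.WritesMem a) : 10 ≤ a ∧ a ≤ 12 := by
  rcases h with h | h
  · simp [loadMarks, WritesMem] at h
  · exact markHeavyAts_writesMem h

theorem markAllBut_writesReg {a : Fin 3} {r s : ℕ} : ¬ (markAllBut a r).WritesReg s := by
  simp only [markAllBut, all3, WritesReg]
  split_ifs <;> simp [WritesReg]

theorem markAllBut_writesMem {a : Fin 3} {r b : ℕ} (h : (markAllBut a r).WritesMem b) :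
    10 ≤ b ∧ b ≤ 12 := by
  revert h
  simp only [markAllBut, all3, WritesMem]
  split_ifs <;> simp [WritesMem] <;> omega

theorem markGon_writesReg {κ : Fin 7 → Fin 3} {r : ℕ} : ¬ (markGon κ).WritesReg r := by
  simp [markGon, writesReg_seqs, markAllBut_writesReg]

theorem markGon_writesMem {κ : Fin 7 → Fin 3} {a : ℕ} (h : (markGon κ).WritesMem a) :
    10 ≤ a ∧ a ≤ 12 := by
  simp only [markGon, writesMem_seqs, List.mem_map] at h
  obtain ⟨_, ⟨i, -, rfl⟩, h⟩ := h
  exact markAllBut_writesMem h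

theorem markGuess_writesReg {r : ℕ} : ¬ markGuess.WritesReg r := by
  simp [markGuess, writesReg_seqs, markAllBut_writesReg]

theorem markGuess_writesMem {a : ℕ} (h : markGuess.WritesMem a) : 10 ≤ a ∧ a ≤ 12 := by
  simp only [markGuess, writesMem_seqs, List.mem_map] at h
  obtain ⟨_, ⟨i, -, rfl⟩, h⟩ := h
  exact markAllBut_writesMem h

theorem buildCmd_writesReg {κ : Fin 7 → Fin 3} {r : ℕ} (h : (buildCmd κ).WritesReg r) :
    62 ≤ r ∧ r ≤ 72 := by
  rcases h with h | h | h | h | h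
  · have := clearMarks_writesReg h
    omega
  · have := markSeen_writesReg h
    omega
  · exact markHeavy_writesReg h
  · exact absurd h markGon_writesReg
  · exact absurd h markGuess_writesReg

theorem buildCmd_writesMem {κ : Fin 7 → Fin 3} {a : ℕ} (h : (buildCmd κ).WritesMem a) :
    10 ≤ a ∧ a ≤ 12 := by
  rcases h with h | h | h | h | h
  · exact clearMarks_writesMem h
  · exact markSeen_writesMem h
  · exact markHeavy_writesMem h
  · exact markGon_writesMem h
  · exact markGuess_writesMem h

theorem safe_clearMarks : Safe clearMarks :=
  .of_bounds (fun r h => by have := clearMarks_writesReg h; omega)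
    (fun r h => by have := clearMarks_writesMem h; omega)

theorem safe_markSeen {b : ℕ} (hb : 0 < b) (κ : Fin 7 → Fin 3) : Safe (markSeen b κ) :=
  .of_bounds (fun r h => by have := markSeen_writesReg h; omega)
    (fun r h => by have := markSeen_writesMem h; omega)

theorem safe_markHeavy : Safe markHeavy :=
  .of_bounds (fun r h => by have := markHeavy_writesReg h; omega)
    (fun r h => by have := markHeavy_writesMem h; omega)

theorem safe_markAllBut (a : Fin 3) (r : ℕ) : Safe (markAllBut a r) :=
  .of_bounds (fun r h => absurd h markAllBut_writesReg)
    (fun r h => by have := markAllBut_writesMem h; omega)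

theorem safe_markGon (κ : Fin 7 → Fin 3) : Safe (markGon κ) :=
  .of_bounds (fun r h => absurd h markGon_writesReg)
    (fun r h => by have := markGon_writesMem h; omega)

theorem safe_markGuess : Safe markGuess :=
  .of_bounds (fun r h => absurd h markGuess_writesReg)
    (fun r h => by have := markGuess_writesMem h; omega)

theorem view_clearMarks (hw : n * (n + 1) < 2 ^ w) (hσ : Base G σ) (c : Fin 3) (y : Fin n) :
    ¬ view n w 10 (clearMarks.eval w σ) c y := by
  have hsafe : ∀ c : Fin 3, Safe (.upto 64 (.store (10 + c) 64 3)) := fun c => by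
    refine .of_bounds ?_ ?_ <;> simp [WritesReg, WritesMem]
  have one : ∀ (c : Fin 3) (σ : State), Base G σ →
      ¬ view n w 10 ((Cmd.upto 64 (.store (10 + c) 64 3)).eval w σ) c y := by
    intro c σ hσ
    refine eval_upto (lt_of_bound hw) hσ.reg_two (fun k τ => ∀ y : Fin n, (y : ℕ) < k →
      ¬ view n w 10 τ c y) (by simp) (fun _ _ _ h => h) (fun k τ hk hF h => ?_) y y.isLt
    intro y hy
    have hτ := hσ.frame (hsafe c) hF
    by_cases hyk : y = k
    · simp [view, Cmd.eval, hk, hyk, hτ.reg_three]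
    · have hne : (y : ℕ) ≠ k := fun e => hyk (Fin.ext e)
      have := h y (by omega)
      simpa [view, Cmd.eval, hk, hne] using this
  have keep : ∀ (c d : Fin 3) (σ : State), c ≠ d → ¬ view n w 10 σ c y →
      ¬ view n w 10 ((Cmd.upto 64 (.store (10 + d) 64 3)).eval w σ) c y := by
    intro c d σ hcd h
    unfold view
    rw [eval_mem]
    · exact h
    · simp only [WritesMem]
      exact fun e => hcd (Fin.ext (by omega))
  have h0 : Base G _ := hσ.eval (w := w) (hsafe 0)
  have h1 : Base G _ := h0.eval (w := w) (hsafe 1)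
  have hc : c = 0 ∨ c = 1 ∨ c = 2 := by
    clear keep one
    revert c
    decide
  rcases hc with rfl | rfl | rfl
  · exact keep _ _ _ (by decide) (keep _ _ _ (by decide) (one 0 _ hσ))
  · exact keep _ _ _ (by decide) (one 1 _ h0)
  · exact one 2 _ h1

theorem view_markSeen (hw : n * (n + 1) < 2 ^ w) (hσ : Base G σ) {b : ℕ} (hb : 0 < b)
    {C : Fin 7 → Fin n} (hC : HoldsGon C σ) (κ : Fin 7 → Fin 3) (c : Fin 3) (y : Fin n) :
    view n w b ((markSeen b κ).eval w σ) c y ↔ view n w b σ c y ∨ SeesColor G C κ c y := by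
  have hsafe := safe_markSeen hb κ
  have hwr := @markSeen_writesReg b κ
  unfold markSeen at hsafe hwr ⊢
  rw [view_upto (lt_of_bound hw) hσ.reg_two (fun k d y => y = k ∧ SeesColor G C κ d y)]
  · simp
  intro k τ hk hF _ d y
  have hτ := hσ.frame hsafe hF
  have hCτ := hC.frame hF fun r h => by have := hwr h; omega
  rw [view_seqs _ _ (fun i d y => (d = κ i ∧ y = k) ∧ G.Adj k (C i))]
  · refine or_congr Iff.rfl ⟨?_, ?_⟩
    · rintro ⟨i, -, ⟨rfl, rfl⟩, h⟩
      exact ⟨rfl, i, rfl, h⟩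
    · rintro ⟨rfl, i, rfl, h⟩
      exact ⟨i, List.mem_finRange i, ⟨rfl, rfl⟩, h⟩
  intro i _ τ' hF' d y
  have hwr' : ∀ r, (seqs ((List.finRange 7).map fun i : Fin 7 =>
      ifAdj 62 64 (20 + i) (.store (b + κ i) 64 4) .skip)).WritesReg r → r = 62 := by
    intro r h
    simp [writesReg_seqs, ifAdj, ifZero, WritesReg] at h
    omega
  have hτ' : Base G τ' := hτ.frame (.of_bounds (fun r h => by have := hwr' r h; omega)
    (fun a h => by simp [writesMem_seqs, ifAdj, ifZero, WritesMem] at h; omega)) hF'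
  have hCτ' := hCτ.frame hF' fun r h => by have := hwr' r h; omega
  have hk' : τ'.reg 64 = k := by
    rw [hF'.1 64 (fun h => by simpa using hwr' _ h), hk]
  rw [eval_ifAdj hw hτ' hk' (hCτ' i) (by omega) (by decide)]
  split_ifs with h
  · rw [view_mark (one_lt_of_bound hw k) (by simp [hτ'.reg_four]) (v := k) (by simp [hk'])]
    exact or_congr Iff.rfl ⟨fun e => ⟨e, h⟩, fun e => e.1⟩
  · exact ⟨Or.inl, fun e => e.resolve_right fun e => h e.2⟩

theorem seesOnly_iff {C : Fin 7 → Fin n} {κ : Fin 7 → Fin 3} {k : Fin 3} {y : Fin n} :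
    SeesOnly G C κ k y ↔ SeesColor G C κ k y ∧ ¬ SeesColor G C κ (k + 1) y ∧
      ¬ SeesColor G C κ (k + 2) y := by
  have aux : ∀ k : Fin 3, k + 1 ≠ k ∧ k + 2 ≠ k := by decide
  have aux' : ∀ k c : Fin 3, c = k ∨ c = k + 1 ∨ c = k + 2 := by decide
  constructor
  · exact fun h => ⟨(h k).2 rfl, fun e => (aux k).1 ((h _).1 e), fun e => (aux k).2 ((h _).1 e)⟩
  · rintro ⟨h0, h1, h2⟩ c
    rcases aux' k c with rfl | rfl | rfl
    · exact ⟨fun _ => rfl, fun _ => h0⟩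
    · exact ⟨fun e => absurd e h1, fun e => absurd e (aux k).1⟩
    · exact ⟨fun e => absurd e h2, fun e => absurd e (aux k).2⟩

theorem view_markHeavy (hw : n * (n + 1) < 2 ^ w) (hσ : Base G σ) {C : Fin 7 → Fin n}
    {κ : Fin 7 → Fin 3} {g : Fin 3 → Fin 3 → Fin n} (hg : HoldsGuess g σ)
    (hwt : HoldsWeights G C σ) (hv : ∀ c y, view n w 10 σ c y ↔ SeesColor G C κ c y)
    (c : Fin 3) (y : Fin n) :
    view n w 10 (markHeavy.eval w σ) c y ↔ view n w 10 σ c y ∨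
      ∃ k, k ≠ c ∧ SeesOnly G C κ k y ∧ weight G C (g k c) < weight G C y := by
  have hsafe := safe_markHeavy
  have hwr := @markHeavy_writesReg
  have hwm := @markHeavy_writesMem
  unfold markHeavy at hsafe hwr hwm ⊢
  rw [view_upto (lt_of_bound hw) hσ.reg_two (fun z c y => y = z ∧
    ∃ k, k ≠ c ∧ SeesOnly G C κ k y ∧ weight G C (g k c) < weight G C y)]
  · simp
  intro z τ hz hF hprev d y
  have hτ := hσ.frame hsafe hF
  have hgτ := hg.frame hF fun r h => by have := hwr h; omega
  have hwtτ := hwt.frame hF fun h => by simpa using hwm h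
  -- the marks at `z` are still those of the colors seen on the `7`-gon
  have hzv : ∀ c, view n w 10 τ c z ↔ SeesColor G C κ c z := by
    intro c
    rw [hprev, hv]
    refine ⟨fun h => h.resolve_right ?_, Or.inl⟩
    rintro ⟨j, hj, e, -⟩
    exact absurd hj (by rw [e]; exact lt_irrefl _)
  have h1w := one_lt_of_bound hw z
  have regs : ∀ c : Fin 3, (loadMarks.eval w τ).reg (70 + c) = τ.mem (10 + c) z % 2 ^ w := by
    intro c
    have hc : c = 0 ∨ c = 1 ∨ c = 2 := by
      revert c
      decide
    rcases hc with rfl | rfl | rfl <;> simp [loadMarks, Cmd.eval, hz]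
  have F₁ := frame_eval w loadMarks τ
  have hlr : ∀ r, loadMarks.WritesReg r → 70 ≤ r := by
    intro r h
    simp only [loadMarks, WritesReg] at h
    omega
  have v₁ : view n w 10 (loadMarks.eval w τ) = view n w 10 τ :=
    view_eval fun c => by simp [loadMarks, WritesMem]
  rw [Cmd.eval.eq_6]
  generalize loadMarks.eval w τ = τ₁ at regs F₁ v₁ ⊢
  have seen : ∀ c : Fin 3, τ₁.reg (70 + c) = 0 ↔ ¬ SeesColor G C κ c z := by
    intro c
    rw [regs, ← hzv, view, not_not]
  have B₁ : Base G τ₁ := hτ.frame (.of_bounds (fun r h => by have := hlr r h; omega)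
    (fun a h => by simp [loadMarks, WritesMem] at h)) F₁
  have g₁ := hgτ.frame F₁ fun r h => by have := hlr r h; omega
  have wt₁ := hwtτ.frame F₁ (by simp [loadMarks, WritesMem])
  have z₁ : τ₁.reg 64 = z := by
    rw [F₁.1 64 (fun h => by have := hlr _ h; omega), hz]
  rw [view_seqs markHeavyAt colorPairs (fun p d y => (d = p.2 ∧ y = z) ∧
    SeesOnly G C κ p.1 z ∧ weight G C (g p.1 p.2) < weight G C z), v₁]
  · refine or_congr Iff.rfl ⟨?_, ?_⟩
    · rintro ⟨p, hp, ⟨rfl, rfl⟩, h⟩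
      exact ⟨rfl, p.1, mem_colorPairs.1 hp, h⟩
    · rintro ⟨rfl, k, hk, h⟩
      exact ⟨(k, d), mem_colorPairs.2 hk, ⟨rfl, rfl⟩, h⟩
  intro p hp τ' hF' d y
  have hr' : ∀ r, r ≠ 62 → r ≠ 63 → τ'.reg r = τ₁.reg r := fun r h1 h2 =>
    hF'.1 r fun h => by have := markHeavyAts_writesReg h; omega
  have hτ' : Base G τ' := B₁.frame (.of_bounds
    (fun r h => by have := markHeavyAts_writesReg h; omega)
    (fun r h => by have := markHeavyAts_writesMem h; omega)) hF'
  have g' := g₁.frame hF' fun r h => by have := markHeavyAts_writesReg h; omega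
  have wt' := wt₁.frame hF' fun h => by simpa using markHeavyAts_writesMem h
  have z' : τ'.reg 64 = z := by rw [hr' 64 (by decide) (by decide), z₁]
  have seen' : ∀ c : Fin 3, τ'.reg (70 + c) = 0 ↔ ¬ SeesColor G C κ c z := fun c => by
    rw [hr' _ (by omega) (by omega), seen]
  have wlt : ∀ v, weight G C v % 2 ^ w = weight G C v := fun v =>
    Nat.mod_eq_of_lt (lt_of_le_of_lt (weight_le C v) hw)
  have hgp := guessReg_bounds p
  unfold markHeavyAt
  rw [eval_ifZero hτ'.reg_three, eval_ifZero hτ'.reg_three, eval_ifZero hτ'.reg_three]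
  simp only [seesOnly_iff]
  split_ifs with h1 h2 h3
  · exact ⟨Or.inl, fun e => e.resolve_right fun e => (seen' _).1 h1 e.2.1.1⟩
  · have t : ∀ r, r ≠ 62 → r ≠ 63 →
        ((Cmd.load 63 3 64).eval w ((Cmd.load 62 3 (guessReg p)).eval w τ')).reg r = τ'.reg r := by
      intro r hr1 hr2
      simp [Cmd.eval, hr1, hr2]
    have t1 : ((Cmd.load 63 3 64).eval w ((Cmd.load 62 3 (guessReg p)).eval w τ')).reg 62 =
        weight G C (g p.1 p.2) := by
      simp [Cmd.eval, g' p hp, wt' _, wlt]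
    have t2 : ((Cmd.load 63 3 64).eval w ((Cmd.load 62 3 (guessReg p)).eval w τ')).reg 63 =
        weight G C z := by
      simp [Cmd.eval, z', wt' _, wlt]
    have t3 : view n w 10 ((Cmd.load 63 3 64).eval w ((Cmd.load 62 3 (guessReg p)).eval w τ')) =
        view n w 10 τ' := rfl
    rw [Cmd.eval.eq_6, Cmd.eval.eq_6]
    generalize (Cmd.load 63 3 64).eval w ((Cmd.load 62 3 (guessReg p)).eval w τ') = τ₂
      at t t1 t2 t3 ⊢
    rw [Cmd.eval.eq_7, Test.Holds, t1, t2]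
    split_ifs with h4
    · rw [view_mark h1w (by rw [t 4 (by decide) (by decide), hτ'.reg_four]) (v := z)
        (by rw [t 64 (by decide) (by decide), z']), t3]
      exact or_congr Iff.rfl ⟨fun e => ⟨e, ⟨by simpa [seen'] using h1, (seen' _).1 h2,
        (seen' _).1 h3⟩, h4⟩, fun e => e.1⟩
    · rw [Cmd.eval.eq_1, t3]
      exact ⟨Or.inl, fun e => e.resolve_right fun e => h4 e.2.2⟩
  · exact ⟨Or.inl, fun e => e.resolve_right fun e => h3 ((seen' _).2 e.2.1.2.2)⟩
  · exact ⟨Or.inl, fun e => e.resolve_right fun e => h2 ((seen' _).2 e.2.1.2.1)⟩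

theorem view_markAllBut (hw : n * (n + 1) < 2 ^ w) (hσ : Base G σ) {r : ℕ} {v : Fin n}
    (hr : σ.reg r = v) (a c : Fin 3) (y : Fin n) :
    view n w 10 ((markAllBut a r).eval w σ) c y ↔ view n w 10 σ c y ∨ (y = v ∧ c ≠ a) := by
  have hst := safe_markAllBut a r
  have hwr := @markAllBut_writesReg a r
  unfold markAllBut at hst hwr ⊢
  rw [view_all3 _ (fun c d y => c ≠ a ∧ d = c ∧ y = v)]
  · refine or_congr Iff.rfl ⟨?_, ?_⟩
    · rintro ⟨c, h1, rfl, h2⟩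
      exact ⟨h2, h1⟩
    · rintro ⟨h2, h1⟩
      exact ⟨_, h1, rfl, h2⟩
  · intro c τ hF d y
    have hτ := hσ.frame hst hF
    split_ifs with hc
    · simp [hc, Cmd.eval]
    · rw [view_mark (one_lt_of_bound hw v) hτ.reg_four (v := v) (by rw [hF.1 r hwr, hr])]
      simp [hc]

theorem view_markGon (hw : n * (n + 1) < 2 ^ w) (hσ : Base G σ) {C : Fin 7 → Fin n}
    (hC : HoldsGon C σ) (κ : Fin 7 → Fin 3) (c : Fin 3) (y : Fin n) :
    view n w 10 ((markGon κ).eval w σ) c y ↔ view n w 10 σ c y ∨ ∃ i, y = C i ∧ c ≠ κ i := by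
  have hsafe := safe_markGon κ
  have hwr := @markGon_writesReg κ
  unfold markGon at hsafe hwr ⊢
  rw [view_seqs _ _ (fun i c y => y = C i ∧ c ≠ κ i)]
  · simp
  intro i _ τ hF d y
  exact view_markAllBut hw (hσ.frame hsafe hF) (hC.frame hF (fun r h => absurd h hwr) i) _ _ _

theorem view_markGuess (hw : n * (n + 1) < 2 ^ w) (hσ : Base G σ) {g : Fin 3 → Fin 3 → Fin n}
    (hg : HoldsGuess g σ) (c : Fin 3) (y : Fin n) :
    view n w 10 (markGuess.eval w σ) c y ↔
      view n w 10 σ c y ∨ ∃ k c', k ≠ c' ∧ y = g k c' ∧ c ≠ c' := by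
  have hsafe := safe_markGuess
  have hwr := @markGuess_writesReg
  unfold markGuess at hsafe hwr ⊢
  rw [view_seqs _ _ (fun p c y => y = g p.1 p.2 ∧ c ≠ p.2)]
  · simp [mem_colorPairs]
  intro p hp τ hF d y
  exact view_markAllBut hw (hσ.frame hsafe hF) (hg.frame hF (fun r h => absurd h hwr) p hp) _ _ _

theorem view_buildCmd (hw : n * (n + 1) < 2 ^ w) (hσ : Base G σ) {C : Fin 7 → Fin n}
    (hC : HoldsGon C σ) (hwt : HoldsWeights G C σ) {g : Fin 3 → Fin 3 → Fin n}
    (hg : HoldsGuess g σ) (κ : Fin 7 → Fin 3) :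
    view n w 10 ((buildCmd κ).eval w σ) = Forbidden G C κ g := by
  simp only [buildCmd, Cmd.eval.eq_6]
  have v₁ := view_clearMarks hw hσ
  have F₁ := frame_eval w clearMarks σ
  generalize clearMarks.eval w σ = σ₁ at v₁ F₁ ⊢
  have B₁ := hσ.frame safe_clearMarks F₁
  have C₁ := hC.frame F₁ fun r h => by have := clearMarks_writesReg h; omega
  have g₁ := hg.frame F₁ fun r h => by have := clearMarks_writesReg h; omega
  have w₁ := hwt.frame F₁ fun h => by simpa using clearMarks_writesMem h
  have v₂ := view_markSeen hw B₁ (b := 10) (by decide) C₁ κ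
  simp only [v₁, false_or] at v₂
  have F₂ := frame_eval w (markSeen 10 κ) σ₁
  generalize (markSeen 10 κ).eval w σ₁ = σ₂ at v₂ F₂ ⊢
  have B₂ := B₁.frame (safe_markSeen (by decide) κ) F₂
  have C₂ := C₁.frame F₂ fun r h => by have := markSeen_writesReg h; omega
  have g₂ := g₁.frame F₂ fun r h => by have := markSeen_writesReg h; omega
  have w₂ := w₁.frame F₂ fun h => by simpa using markSeen_writesMem h
  have v₃ := view_markHeavy hw B₂ g₂ w₂ v₂
  simp only [v₂] at v₃
  have F₃ := frame_eval w markHeavy σ₂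
  generalize markHeavy.eval w σ₂ = σ₃ at v₃ F₃ ⊢
  have B₃ := B₂.frame safe_markHeavy F₃
  have C₃ := C₂.frame F₃ fun r h => by have := markHeavy_writesReg h; omega
  have g₃ := g₂.frame F₃ fun r h => by have := markHeavy_writesReg h; omega
  have v₄ := view_markGon hw B₃ C₃ κ
  simp only [v₃] at v₄
  have F₄ := frame_eval w (markGon κ) σ₃
  generalize (markGon κ).eval w σ₃ = σ₄ at v₄ F₄ ⊢
  have B₄ := B₃.frame (safe_markGon κ) F₄
  have g₄ := g₃.frame F₄ fun r h => absurd h markGon_writesReg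
  have v₅ := view_markGuess hw B₄ g₄
  simp only [v₄] at v₅
  funext c y
  refine propext ((v₅ c y).trans ⟨?_, ?_⟩)
  · rintro (((h | h) | h) | h)
    · exact Or.inl h
    · exact Or.inr (Or.inr (Or.inr h))
    · exact Or.inr (Or.inl h)
    · exact Or.inr (Or.inr (Or.inl h))
  · rintro (h | h | h | h)
    · exact Or.inl (Or.inl (Or.inl h))
    · exact Or.inl (Or.inr h)
    · exact Or.inr h
    · exact Or.inl (Or.inl (Or.inr h))

/-! ### Testing one guess -/

/-- Store a color from each list at `13`, as a number from `1` to `3`, in array `1`. -/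
def extractCmd : Cmd :=
  .upto 64 (.seq (ifCell 65 13 64 (ifCell 65 14 64 (.const 66 3) (.const 66 2)) (.const 66 1))
    (.store 1 64 66))

theorem extractCmd_writesReg {r : ℕ} (h : extractCmd.WritesReg r) : 64 ≤ r ∧ r ≤ 66 := by
  simp [extractCmd, ifCell, ifZero, WritesReg] at h
  omega

theorem extractCmd_writesMem {a : ℕ} (h : extractCmd.WritesMem a) : a = 1 := by
  simpa [extractCmd, ifCell, ifZero, WritesMem] using h

theorem safe_extractCmd : Safe extractCmd :=
  .of_bounds (fun r h => by have := extractCmd_writesReg h; omega)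
    (fun r h => by have := extractCmd_writesMem h; omega)

theorem three_lt_of_bound (hw : n * (n + 1) < 2 ^ w) (v : Fin n) : 3 < 2 ^ w := by
  have := v.pos
  have h2 : 2 < 2 ^ w := by nlinarith
  have : 2 ≤ w := by
    by_contra! h
    interval_cases w <;> omega
  exact lt_of_lt_of_le (by norm_num) (Nat.pow_le_pow_right (n := 2) (by norm_num) this)

theorem eval_extractCmd (hw : n * (n + 1) < 2 ^ w) (hσ : Base G σ) (y : Fin n) :
    (extractCmd.eval w σ).mem 1 y = (firstColor (view n w 13 σ) y : ℕ) + 1 := by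
  have hsafe := safe_extractCmd
  unfold extractCmd at hsafe ⊢
  refine eval_upto (lt_of_bound hw) hσ.reg_two (fun k τ => ∀ y : Fin n, (y : ℕ) < k →
    τ.mem 1 y = (firstColor (view n w 13 σ) y : ℕ) + 1) (by simp) (fun _ _ _ h => h)
    (fun k τ hk hF h => ?_) y y.isLt
  intro y hy
  have hτ := hσ.frame hsafe hF
  have h3 := three_lt_of_bound hw y
  have hmem : ∀ a, a ≠ 1 → τ.mem a = σ.mem a := fun a ha =>
    hF.2 a (by simpa [ifCell, ifZero, WritesMem] using ha)
  -- the color of the current vertex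
  have hcell : ((ifCell 65 13 64 (ifCell 65 14 64 (.const 66 3) (.const 66 2))
      (.const 66 1)).eval w τ).reg 66 = (firstColor (view n w 13 σ) k : ℕ) + 1 := by
    rw [eval_ifCell hτ.reg_three (by decide), eval_ifCell (by simp [hτ.reg_three]) (by decide)]
    simp only [State.setReg_mem, State.setReg_reg, hk, hmem 13 (by decide), hmem 14 (by decide),
      Nat.reduceEqDiff, if_false, firstColor]
    have e0 : view n w 13 σ 0 k ↔ σ.mem 13 k % 2 ^ w ≠ 0 := Iff.rfl
    have e1 : view n w 13 σ 1 k ↔ σ.mem 14 k % 2 ^ w ≠ 0 := Iff.rfl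
    rw [e0, e1]
    split_ifs with a b <;> first | (exfalso; tauto) | simp [Cmd.eval, Nat.mod_eq_of_lt h3,
      Nat.mod_eq_of_lt (show 2 < 2 ^ w by omega), Nat.mod_eq_of_lt (show 1 < 2 ^ w by omega)]
  rw [Cmd.eval.eq_6, Cmd.eval.eq_5, hcell, State.setMem_mem]
  rw [eval_reg _ (by simp [ifCell, ifZero, WritesReg]), hk, eval_mem _ (by simp [ifCell, ifZero,
    WritesMem])]
  by_cases hyk : y = k
  · subst hyk
    rw [if_pos ⟨rfl, rfl⟩, Nat.mod_eq_of_lt]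
    have := (firstColor (view n w 13 σ) y).isLt
    omega
  · have hne : (y : ℕ) ≠ k := fun e => hyk (Fin.ext e)
    rw [if_neg (fun e => hne e.2), h y (by omega)]

/-- Set register `66` unless array `1` gives different values to adjacent vertices. -/
def checkProper : Cmd :=
  .seq (.const 66 0) (.upto 60 (.upto 61 (ifAdj 62 60 61 (.seq (.load 67 1 60)
    (.seq (.load 68 1 61) (.ite (.eq 67 68) (.const 66 1) .skip))) .skip)))

theorem checkProper_writesReg {r : ℕ} (h : checkProper.WritesReg r) : 60 ≤ r ∧ r ≤ 68 := by
  simp [checkProper, ifAdj, ifZero, WritesReg] at h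
  omega

theorem checkProper_writesMem {a : ℕ} : ¬ checkProper.WritesMem a := by
  simp [checkProper, ifAdj, ifZero, WritesMem]

theorem safe_checkProper : Safe checkProper :=
  .of_bounds (fun r h => by have := checkProper_writesReg h; omega)
    (fun r h => absurd h checkProper_writesMem)

theorem eval_checkProper (hw : n * (n + 1) < 2 ^ w) (hσ : Base G σ) {f : Fin n → Fin 3}
    (hf : ∀ y : Fin n, σ.mem 1 y = (f y : ℕ) + 1) :
    (checkProper.eval w σ).reg 66 = 0 ↔ ∀ u v, G.Adj u v → f u ≠ f v := by
  have hsafe := safe_checkProper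
  unfold checkProper at hsafe ⊢
  simp only [Cmd.eval.eq_6, Cmd.eval.eq_2]
  have hσ' : Base G (σ.setReg w 66 0) := hσ.setReg (by decide) (by decide) (by decide)
  have hn := lt_of_bound hw
  have safe1 : Safe (.upto 60 (.upto 61 (ifAdj 62 60 61 (.seq (.load 67 1 60)
      (.seq (.load 68 1 61) (.ite (.eq 67 68) (.const 66 1) .skip))) .skip))) :=
    ⟨fun h => hsafe.1 (Or.inr h), fun h => hsafe.2 (Or.inr h),
      fun h => hsafe.3 (Or.inr h), fun h => hsafe.4 (Or.inr h)⟩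
  have := eval_upto hn (i := 60) (p := .upto 61 (ifAdj 62 60 61 (.seq (.load 67 1 60)
    (.seq (.load 68 1 61) (.ite (.eq 67 68) (.const 66 1) .skip))) .skip)) hσ'.reg_two
    (fun k τ => τ.reg 66 = 0 ↔ ∀ u : Fin n, (u : ℕ) < k → ∀ v, G.Adj u v → f u ≠ f v)
    (by simp) (fun k τ x h => by simpa using h) (fun k τ hk hF h => ?_)
  · rw [this]
    exact forall_congr' fun y => ⟨fun h => h y.isLt, fun h _ => h⟩
  have hτ := hσ'.frame safe1 hF
  rw [forall_lt_succ_iff, ← h]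
  have := eval_upto hn (i := 61) (p := ifAdj 62 60 61 (.seq (.load 67 1 60)
    (.seq (.load 68 1 61) (.ite (.eq 67 68) (.const 66 1) .skip))) .skip) hτ.reg_two
    (fun m τ' => τ'.reg 66 = 0 ↔ (τ.reg 66 = 0 ∧
      ∀ v : Fin n, (v : ℕ) < m → G.Adj k v → f k ≠ f v))
    (by simp) (fun k τ x h => by simpa using h) (fun m τ' hm hF' h' => ?_)
  · rw [this]
    exact and_congr_right fun _ => forall_congr' fun y => ⟨fun h => h y.isLt, fun h _ => h⟩
  have hτ' : Base G τ' := hτ.frame ⟨fun h => safe1.1 (Or.inr h), fun h => safe1.2 (Or.inr h),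
    fun h => safe1.3 (Or.inr h), safe1.4⟩ hF'
  have hk' : τ'.reg 60 = k := by
    rw [hF'.1 60 (by simp [ifAdj, ifZero, WritesReg]), hk]
  have hmem : τ'.mem 1 = σ.mem 1 := by
    rw [hF'.2 1 (by simp [ifAdj, ifZero, WritesMem]), hF.2 1 (by simp [ifAdj, ifZero, WritesMem])]
    rfl
  have h3 := three_lt_of_bound hw k
  have hmod : ∀ y, ((f y : ℕ) + 1) % 2 ^ w = f y + 1 := fun y =>
    Nat.mod_eq_of_lt (by have := (f y).isLt; omega)
  rw [forall_lt_succ_iff, ← and_assoc, ← h', eval_ifAdj hw hτ' hk' hm (by decide) (by decide)]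
  by_cases hkm : G.Adj k m
  · simp only [hkm, if_true, Cmd.eval, Test.Holds, State.setReg_reg, State.setReg_mem, hmem, hk',
      hm, Nat.reduceEqDiff, if_false, hf, hmod, add_left_inj, Fin.val_inj, forall_const]
    split_ifs with e
    · simp [e, Nat.mod_eq_of_lt (show 1 < 2 ^ w by omega)]
    · simp [e]
  · simp [hkm, Cmd.eval]

/-- Test one guess; on success set register `0` and leave the coloring in array `1`. -/
def guessCmd (κ : Fin 7 → Fin 3) : Cmd :=
  .seq (buildCmd κ) (.seq propagateCmd (.seq (copyMarks 10 13) (.seq solveCmd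
    (.seq extractCmd (.seq checkProper (ifZero 66 (.const 0 1) .skip))))))

theorem guessCmd_writesReg {κ : Fin 7 → Fin 3} {r : ℕ} (h : (guessCmd κ).WritesReg r) :
    r = 0 ∨ 50 ≤ r := by
  rcases h with h | h | h | h | h | h | h
  · have := buildCmd_writesReg h
    omega
  · have := propagateCmd_writesReg h
    omega
  · have := copyMarks_writesReg h
    omega
  · have := solveCmd_writesReg h
    omega
  · have := extractCmd_writesReg h
    omega
  · have := checkProper_writesReg h
    omega
  · simp [ifZero, WritesReg] at h
    omega

theorem guessCmd_writesMem {κ : Fin 7 → Fin 3} {a : ℕ} (h : (guessCmd κ).WritesMem a) :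
    a = 1 ∨ 10 ≤ a := by
  rcases h with h | h | h | h | h | h | h
  · have := buildCmd_writesMem h
    omega
  · have := propagateCmd_writesMem h
    omega
  · have := copyMarks_writesMem h
    omega
  · have := solveCmd_writesMem h
    omega
  · have := extractCmd_writesMem h
    omega
  · exact absurd h checkProper_writesMem
  · simp [ifZero, WritesMem] at h

theorem safe_guessCmd (κ : Fin 7 → Fin 3) : Safe (guessCmd κ) :=
  .of_bounds (fun r h => by have := guessCmd_writesReg h; omega)
    (fun r h => by have := guessCmd_writesMem h; omega)

/-- Register `0` is set only if array `1` holds a coloring. -/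
def Sound (G : SimpleGraph (Fin n)) (σ : State) : Prop :=
  σ.reg 0 = 0 ∨
    (σ.reg 0 = 1 ∧ ∃ col : G.Coloring (Fin 3), ∀ v : Fin n, σ.mem 1 v = (col v : ℕ) + 1)

/-- Testing a guess is sound in any case, and succeeds if propagation of its forbidden colors yields
a solvable list assignment. -/
theorem guessCmd_spec (hw : n * (n + 1) < 2 ^ w) (hσ : Base G σ) {C : Fin 7 → Fin n}
    (hC : HoldsGon C σ) (hwt : HoldsWeights G C σ) {g : Fin 3 → Fin 3 → Fin n}
    (hg : HoldsGuess g σ) (h0 : σ.reg 0 = 0) (κ : Fin 7 → Fin 3) :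
    Sound G ((guessCmd κ).eval w σ) ∧
      (IsSolvable G (propagate G (Forbidden G C κ g)) → ((guessCmd κ).eval w σ).reg 0 = 1) := by
  simp only [guessCmd, Cmd.eval.eq_6]
  have v₁ := view_buildCmd hw hσ hC hwt hg κ
  have F₁ := frame_eval w (buildCmd κ) σ
  generalize (buildCmd κ).eval w σ = σ₁ at v₁ F₁ ⊢
  have B₁ : Base G σ₁ := hσ.frame (.of_bounds
    (fun r h => by have := buildCmd_writesReg h; omega)
    (fun r h => by have := buildCmd_writesMem h; omega)) F₁
  have z₁ : σ₁.reg 0 = 0 := by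
    rw [F₁.1 0 (fun h => by have := buildCmd_writesReg h; omega), h0]
  have v₂ := view_propagateCmd hw B₁
  rw [v₁] at v₂
  have F₂ := frame_eval w propagateCmd σ₁
  generalize propagateCmd.eval w σ₁ = σ₂ at v₂ F₂ ⊢
  have B₂ : Base G σ₂ := B₁.frame safe_propagateCmd F₂
  have z₂ : σ₂.reg 0 = 0 := by
    rw [F₂.1 0 (fun h => by have := propagateCmd_writesReg h; omega), z₁]
  have v₃ := view_copyMarks hw B₂ (s := 10) (d := 13) (by decide) (by decide)
  rw [v₂] at v₃
  have F₃ := frame_eval w (copyMarks 10 13) σ₂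
  generalize (copyMarks 10 13).eval w σ₂ = σ₃ at v₃ F₃ ⊢
  have B₃ : Base G σ₃ := B₂.frame (safe_copyMarks (by decide)) F₃
  have z₃ : σ₃.reg 0 = 0 := by
    rw [F₃.1 0 (fun h => by have := copyMarks_writesReg h; omega), z₂]
  have v₄ := isSolvable_solveCmd hw B₃
  rw [v₃] at v₄
  have F₄ := frame_eval w solveCmd σ₃
  generalize solveCmd.eval w σ₃ = σ₄ at v₄ F₄ ⊢
  have B₄ : Base G σ₄ := B₃.frame safe_solveCmd F₄
  have z₄ : σ₄.reg 0 = 0 := by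
    rw [F₄.1 0 (fun h => by have := solveCmd_writesReg h; omega), z₃]
  have v₅ := eval_extractCmd hw B₄
  have F₅ := frame_eval w extractCmd σ₄
  generalize extractCmd.eval w σ₄ = σ₅ at v₅ F₅ ⊢
  have B₅ : Base G σ₅ := B₄.frame safe_extractCmd F₅
  have z₅ : σ₅.reg 0 = 0 := by
    rw [F₅.1 0 (fun h => by have := extractCmd_writesReg h; omega), z₄]
  have v₆ := eval_checkProper hw B₅ v₅
  have F₆ := frame_eval w checkProper σ₅
  generalize checkProper.eval w σ₅ = σ₆ at v₆ F₆ ⊢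
  have B₆ : Base G σ₆ := B₅.frame safe_checkProper F₆
  have z₆ : σ₆.reg 0 = 0 := by
    rw [F₆.1 0 (fun h => by have := checkProper_writesReg h; omega), z₅]
  have m₆ : σ₆.mem 1 = σ₅.mem 1 := F₆.2 1 checkProper_writesMem
  rw [eval_ifZero B₆.reg_three]
  by_cases h : σ₆.reg 66 = 0
  · have hp := v₆.1 h
    rw [if_pos h]
    have hone : (1 : ℕ) % 2 ^ w = 1 := by
      rcases Nat.eq_zero_or_pos w with rfl | hw0
      · exfalso
        -- there is a vertex, so words are longer than `0` bits
        have := one_lt_of_bound hw (C 0)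
        simp at this
      · exact Nat.mod_eq_of_lt (Nat.one_lt_two_pow (by omega))
    refine ⟨Or.inr ⟨by simp [Cmd.eval, hone], SimpleGraph.Coloring.mk _ fun {u v} => hp u v, ?_⟩,
      fun _ => by simp [Cmd.eval, hone]⟩
    intro v
    have : ((Cmd.const 0 1).eval w σ₆).mem 1 v = σ₅.mem 1 v := by
      rw [← m₆]
      rfl
    rw [this, v₅]
    rfl
  · rw [if_neg h, Cmd.eval.eq_1]
    refine ⟨Or.inl z₆, fun hs => absurd (v₆.2 fun u v huv => ?_) h⟩
    exact (v₄ hs).1.firstColor_ne (v₄ hs).2 huv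

/-! ### Finding a `7`-gon -/

/-- Set register `6` unless the adjacency of two vertices in the registers `10 + i` is as in a
`7`-gon. -/
def testPair (p : Fin 7 × Fin 7) : Cmd :=
  if p.2 = p.1 + 1 ∨ p.1 = p.2 + 1 then ifAdj 7 (10 + p.1) (10 + p.2) .skip (.const 6 1)
  else ifAdj 7 (10 + p.1) (10 + p.2) (.const 6 1) .skip

/-- All pairs of indices of vertices of a `7`-gon. -/
def indexPairs : List (Fin 7 × Fin 7) := (List.finRange 7).product (List.finRange 7)

/-- Store the tuple in the registers `10 + i` in the registers `20 + i` if it is a `7`-gon. -/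
def testGon : Cmd :=
  .seq (.const 6 0) (.seq (seqs (indexPairs.map testPair))
    (ifZero 6 (seqs ((List.finRange 7).map fun i : Fin 7 => .arith (20 + i) .add (10 + i) 3))
      .skip))

/-- Run through all tuples of seven vertices; the last `7`-gon among them is kept. -/
def findGon : Cmd := nest [10, 11, 12, 13, 14, 15, 16] testGon

theorem testPairs_writesReg {r : ℕ} (h : (seqs (indexPairs.map testPair)).WritesReg r) :
    r = 6 ∨ r = 7 := by
  rw [writesReg_seqs] at h
  obtain ⟨_, hp, h⟩ := h
  obtain ⟨p, -, rfl⟩ := List.mem_map.1 hp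
  revert h
  unfold testPair
  split_ifs <;> simp [ifAdj, ifZero, WritesReg] <;> omega

theorem testPairs_writesMem {r : ℕ} : ¬ (seqs (indexPairs.map testPair)).WritesMem r := by
  rw [writesMem_seqs]
  rintro ⟨_, hp, h⟩
  obtain ⟨p, -, rfl⟩ := List.mem_map.1 hp
  revert h
  unfold testPair
  split_ifs <;> simp [ifAdj, ifZero, WritesMem]

theorem testGon_writesReg {r : ℕ} (h : testGon.WritesReg r) :
    r = 6 ∨ r = 7 ∨ (20 ≤ r ∧ r ≤ 26) := by
  rcases h with h | h | h | h
  · exact Or.inl h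
  · have := testPairs_writesReg h
    omega
  · simp only [writesReg_seqs, List.mem_map] at h
    obtain ⟨_, ⟨i, -, rfl⟩, h⟩ := h
    simp only [WritesReg] at h
    omega
  · exact h.elim

theorem testGon_writesMem {r : ℕ} : ¬ testGon.WritesMem r := by
  rintro (h | h | h | h)
  · exact h
  · exact testPairs_writesMem h
  · simp [writesMem_seqs, WritesMem] at h
  · exact h

theorem findGon_writesReg {r : ℕ} (h : findGon.WritesReg r) : 6 ≤ r ∧ r ≤ 26 := by
  rw [findGon, writesReg_nest] at h
  rcases h with h | h
  · simp only [List.mem_cons, List.not_mem_nil, or_false] at h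
    omega
  · have := testGon_writesReg h
    omega

theorem findGon_writesMem {r : ℕ} : ¬ findGon.WritesMem r := by
  rw [findGon, writesMem_nest]
  exact testGon_writesMem

theorem safe_testGon : Safe testGon :=
  .of_bounds (fun r h => by have := testGon_writesReg h; omega)
    (fun r h => absurd h testGon_writesMem)

theorem safe_findGon : Safe findGon :=
  .of_bounds (fun r h => by have := findGon_writesReg h; omega)
    (fun r h => absurd h findGon_writesMem)

theorem eval_testGon (hw : n * (n + 1) < 2 ^ w) (hσ : Base G σ) {v : Fin 7 → Fin n}
    (hv : ∀ i : Fin 7, σ.reg (10 + i) = v i) :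
    (IsGon G v → HoldsGon v (testGon.eval w σ)) ∧
      (¬ IsGon G v → ∀ r, 20 ≤ r → (testGon.eval w σ).reg r = σ.reg r) := by
  have hn := lt_of_bound hw
  have h1w := one_lt_of_bound hw (v 0)
  unfold testGon
  simp only [Cmd.eval.eq_6, Cmd.eval.eq_2]
  have B₁ : Base G (σ.setReg w 6 0) := hσ.setReg (by decide) (by decide) (by decide)
  have r₁ : ∀ r, r ≠ 6 → (σ.setReg w 6 0).reg r = σ.reg r := fun r h => by simp [h]
  have z₁ : (σ.setReg w 6 0).reg 6 = 0 := by simp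
  generalize σ.setReg w 6 0 = σ₁ at B₁ r₁ z₁ ⊢
  have hP : Safe (seqs (indexPairs.map testPair)) :=
    .of_bounds (fun r h => by have := testPairs_writesReg h; omega)
      (fun r h => absurd h testPairs_writesMem)
  have F₂ := frame_eval w (seqs (indexPairs.map testPair)) σ₁
  have key := eval_seqs (w := w) testPair indexPairs (fun pre τ => τ.reg 6 = 0 ↔ ∀ p ∈ pre,
    (G.Adj (v p.1) (v p.2) ↔ (p.2 = p.1 + 1 ∨ p.1 = p.2 + 1))) (σ := σ₁) (by simp [z₁])
    (fun pre p τ hF h _ => ?_)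
  · have hgon : ((seqs (indexPairs.map testPair)).eval w σ₁).reg 6 = 0 ↔ IsGon G v := by
      rw [key]
      constructor
      · exact fun h i j => h (i, j) (by simp [indexPairs])
      · exact fun h p _ => h p.1 p.2
    generalize (seqs (indexPairs.map testPair)).eval w σ₁ = σ₂ at F₂ hgon ⊢
    have B₂ := B₁.frame hP F₂
    have r₂ : ∀ r, 10 ≤ r → σ₂.reg r = σ.reg r := by
      intro r hr
      rw [F₂.1 r (fun h => by have := testPairs_writesReg h; omega), r₁ r (by omega)]
    rw [eval_ifZero B₂.reg_three]
    constructor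
    · intro h i
      rw [if_pos (hgon.2 h)]
      refine eval_seqs (w := w) (fun i : Fin 7 => Cmd.arith (20 + i) .add (10 + i) 3)
        (List.finRange 7) (fun pre τ => ∀ i ∈ pre, τ.reg (20 + (i : ℕ)) = v i) (σ := σ₂) (by simp)
        (fun pre i τ hF h _ => ?_) i (List.mem_finRange i)
      intro j hj
      have hr : ∀ r, r < 20 → τ.reg r = σ₂.reg r := by
        intro r hr
        refine hF.1 r fun h => ?_
        simp only [writesReg_seqs, List.mem_map] at h
        obtain ⟨_, ⟨i, -, rfl⟩, h⟩ := h
        simp only [WritesReg] at h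
        omega
      simp only [Cmd.eval, Op.eval, State.setReg_reg]
      split_ifs with e
      · have hij : i = j := Fin.ext (by omega)
        rw [hr _ (by omega), hr 3 (by decide), B₂.reg_three, r₂ _ (by omega), hv, hij, add_zero,
          Nat.mod_eq_of_lt ((v j).isLt.trans hn)]
      · rw [List.mem_append, List.mem_singleton] at hj
        rcases hj with hj | rfl
        · exact h j hj
        · exact absurd rfl e
    · intro h r hr
      rw [if_neg (fun e => h (hgon.1 e)), Cmd.eval.eq_1, r₂ r (by omega)]
  · have hτ := B₁.frame hP hF
    have hr : ∀ i : Fin 7, τ.reg (10 + i) = v i := by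
      intro i
      rw [hF.1 _ (fun h => by have := testPairs_writesReg h; omega), r₁ _ (by omega), hv]
    have hsnoc : (∀ q ∈ pre ++ [p], (G.Adj (v q.1) (v q.2) ↔ (q.2 = q.1 + 1 ∨ q.1 = q.2 + 1))) ↔
        (τ.reg 6 = 0 ∧ (G.Adj (v p.1) (v p.2) ↔ (p.2 = p.1 + 1 ∨ p.1 = p.2 + 1))) := by
      rw [h]
      simp only [List.mem_append, List.mem_singleton, or_imp, forall_and, forall_eq]
    rw [hsnoc, testPair]
    split_ifs with hp
    all_goals
      rw [eval_ifAdj hw hτ (hr p.1) (hr p.2) (by omega) (by decide)]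
      split_ifs with ha <;> simp [hp, ha, Cmd.eval, Nat.mod_eq_of_lt h1w]

theorem eval_findGon (hw : n * (n + 1) < 2 ^ w) (hσ : Base G σ) {C : Fin 7 → Fin n}
    (hC : IsGon G C) : ∃ C', IsGon G C' ∧ HoldsGon C' (findGon.eval w σ) := by
  have hlist : ∀ r : ℕ, r ∈ [10, 11, 12, 13, 14, 15, 16] ↔ 10 ≤ r ∧ r ≤ 16 := by
    intro r
    simp only [List.mem_cons, List.not_mem_nil, or_false]
    omega
  have key := eval_nest (lt_of_bound hw) (l := [10, 11, 12, 13, 14, 15, 16]) (by decide)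
    (p := testGon) (fun i hi h => by rw [hlist] at hi; have := testGon_writesReg h; omega)
    (Base G) (fun τ => ∃ C', IsGon G C' ∧ HoldsGon C' τ) (fun r => C (Fin.ofNat 7 (r - 10)))
    (fun τ h => h.reg_two)
    (fun τ i hi x h => by rw [hlist] at hi; exact h.setReg (by omega) (by omega) (by omega))
    (fun τ i hi x ⟨C', h, h'⟩ => ⟨C', h, fun j => by
      rw [hlist] at hi
      rw [State.setReg_reg, if_neg (by omega), h' j]⟩)
    (fun τ _ h => h.eval safe_testGon) (fun τ hv h hF => ?_) (fun τ hv h => ?_) hσ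
  · exact key.2
  · choose f hf using hv
    obtain ⟨h1, h2⟩ := eval_testGon hw h (v := fun i => f (10 + i) (by rw [hlist]; omega))
      (fun i => hf _ _)
    by_cases hg : IsGon G fun i : Fin 7 => f (10 + i) (by rw [hlist]; omega)
    · exact ⟨_, hg, h1 hg⟩
    · obtain ⟨C', hC', hh⟩ := hF
      exact ⟨C', hC', fun i => by rw [h2 hg _ (by omega), hh i]⟩
  · refine ⟨C, hC, (eval_testGon hw h (v := C) fun i => ?_).1 hC⟩
    rw [hv _ (by rw [hlist]; omega)]
    congr 2
    apply Fin.ext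
    simp

/-! ### The weights -/

/-- Array `2` marks the vertices with a neighbor on the `7`-gon. -/
def HoldsAttached (w : ℕ) (G : SimpleGraph (Fin n)) (C : Fin 7 → Fin n) (σ : State) : Prop :=
  ∀ x : Fin n, σ.mem 2 x % 2 ^ w ≠ 0 ↔ ¬ Remote G C x

/-- Take the vertex in register `70` into account as a mate of the vertex in register `66`: register
`69` receives `n` if it is one, and register `68` is set if moreover it is adjacent to the vertex in
register `64`. -/
def mateCmd : Cmd :=
  ifCell 67 2 70 .skip (ifAdj 67 66 70
    (.seq (.arith 69 .add 2 3) (ifAdj 67 64 70 (.const 68 1) .skip)) .skip)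

/-- Add to register `65` the contribution of the remote vertex in register `66` to the weight of
the vertex in register `64`. -/
def touchCmd : Cmd :=
  .seq (.const 68 0) (.seq (.const 69 0) (.seq (ifAdj 67 64 66 (.const 68 1) .skip)
    (.seq (.upto 70 mateCmd)
      (ifZero 68 .skip (.seq (.arith 65 .add 65 4) (.arith 65 .add 65 69))))))

/-- Store the weights in array `3`. -/
def weightsCmd : Cmd :=
  .upto 64 (.seq (.const 65 0) (.seq (.upto 66 (ifCell 67 2 66 .skip touchCmd)) (.store 3 64 65)))

theorem mateCmd_writesReg {r : ℕ} (h : mateCmd.WritesReg r) : 67 ≤ r ∧ r ≤ 69 := by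
  simp [mateCmd, ifCell, ifAdj, ifZero, WritesReg] at h
  omega

theorem mateCmd_writesMem {a : ℕ} : ¬ mateCmd.WritesMem a := by
  simp [mateCmd, ifCell, ifAdj, ifZero, WritesMem]

theorem touchCmd_writesReg {r : ℕ} (h : touchCmd.WritesReg r) :
    r = 65 ∨ (67 ≤ r ∧ r ≤ 70) := by
  simp [touchCmd, mateCmd, ifCell, ifAdj, ifZero, WritesReg] at h
  omega

theorem touchCmd_writesMem {a : ℕ} : ¬ touchCmd.WritesMem a := by
  simp [touchCmd, mateCmd, ifCell, ifAdj, ifZero, WritesMem]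

theorem weightsCmd_writesReg {r : ℕ} (h : weightsCmd.WritesReg r) : 64 ≤ r ∧ r ≤ 70 := by
  simp [weightsCmd, touchCmd, mateCmd, ifCell, ifAdj, ifZero, WritesReg] at h
  omega

theorem weightsCmd_writesMem {a : ℕ} (h : weightsCmd.WritesMem a) : a = 3 := by
  simpa [weightsCmd, touchCmd, mateCmd, ifCell, ifAdj, ifZero, WritesMem] using h

theorem safe_weightsCmd : Safe weightsCmd :=
  .of_bounds (fun r h => by have := weightsCmd_writesReg h; omega)
    (fun r h => by have := weightsCmd_writesMem h; omega)

open Classical in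
/-- The bound on the sum excludes an overflow. -/
theorem eval_touchCmd (hw : n * (n + 1) < 2 ^ w) (hσ : Base G σ) {C : Fin 7 → Fin n}
    (hA : HoldsAttached w G C σ) {x y : Fin n} (hy : σ.reg 64 = y) (hx : σ.reg 66 = x)
    (hxR : Remote G C x)
    (hs : σ.reg 65 + (if Touches G C y x then 1 + (if HasMate G C x then n else 0) else 0) <
      2 ^ w) :
    (touchCmd.eval w σ).reg 65 =
      σ.reg 65 + (if Touches G C y x then 1 + (if HasMate G C x then n else 0) else 0) := by
  have hn := lt_of_bound hw
  have h1w := one_lt_of_bound hw x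
  unfold touchCmd
  rw [Cmd.eval.eq_6, Cmd.eval.eq_6, Cmd.eval.eq_6, Cmd.eval.eq_6]
  have B₁ : Base G ((Cmd.const 69 0).eval w ((Cmd.const 68 0).eval w σ)) :=
    (hσ.setReg (by decide) (by decide) (by decide)).setReg (by decide) (by decide) (by decide)
  have r₁ : ∀ r, r ≠ 68 → r ≠ 69 →
      ((Cmd.const 69 0).eval w ((Cmd.const 68 0).eval w σ)).reg r = σ.reg r := by
    intro r h1 h2
    simp [Cmd.eval, h1, h2]
  have z₁ : ((Cmd.const 69 0).eval w ((Cmd.const 68 0).eval w σ)).reg 68 = 0 ∧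
      ((Cmd.const 69 0).eval w ((Cmd.const 68 0).eval w σ)).reg 69 = 0 := by simp [Cmd.eval]
  have m₁ : ((Cmd.const 69 0).eval w ((Cmd.const 68 0).eval w σ)).mem = σ.mem := rfl
  generalize (Cmd.const 69 0).eval w ((Cmd.const 68 0).eval w σ) = σ₁ at B₁ r₁ z₁ m₁ ⊢
  have F₂ := frame_eval w (ifAdj 67 64 66 (.const 68 1) .skip) σ₁
  have z₂ : ((ifAdj 67 64 66 (.const 68 1) .skip).eval w σ₁).reg 68 = 0 ↔ ¬ G.Adj y x := by
    rw [eval_ifAdj hw B₁ (a := y) (b := x) (by rw [r₁ 64 (by decide) (by decide), hy])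
      (by rw [r₁ 66 (by decide) (by decide), hx]) (by decide) (by decide)]
    split_ifs with h
    · simp [Cmd.eval, h, Nat.mod_eq_of_lt h1w]
    · simp [Cmd.eval, h, z₁]
  have wr : ∀ r, (ifAdj 67 64 66 (.const 68 1) .skip).WritesReg r → r = 67 ∨ r = 68 := by
    intro r h
    simp [ifAdj, ifZero, WritesReg] at h
    omega
  have wm : ∀ a, ¬ (ifAdj 67 64 66 (.const 68 1) .skip).WritesMem a := by
    intro a
    simp [ifAdj, ifZero, WritesMem]
  generalize (ifAdj 67 64 66 (.const 68 1) .skip).eval w σ₁ = σ₂ at F₂ z₂ ⊢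
  have B₂ : Base G σ₂ := B₁.frame (.of_bounds (fun r h => by have := wr r h; omega)
    (fun a h => absurd h (wm a))) F₂
  have r₂ : ∀ r, r < 67 ∨ 70 ≤ r → σ₂.reg r = σ.reg r := by
    intro r hr
    rw [F₂.1 r (fun h => by have := wr r h; omega), r₁ r (by omega) (by omega)]
  have m₂ : ∀ a, σ₂.mem a = σ.mem a := fun a => by rw [F₂.2 a (wm a), m₁]
  have z₂' : σ₂.reg 69 = 0 := by
    rw [F₂.1 69 (fun h => by simpa using wr _ h), z₁.2]
  have hsafe : Safe (.upto 70 mateCmd) :=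
    .of_bounds (by
      rintro r (rfl | h)
      · omega
      · have := mateCmd_writesReg h
        omega)
      (fun a h => absurd h mateCmd_writesMem)
  have key := eval_upto (w := w) hn (i := 70) (p := mateCmd) B₂.reg_two
    (fun m τ => (τ.reg 68 = 0 ↔ ¬ G.Adj y x ∧
        ¬ ∃ z : Fin n, (z : ℕ) < m ∧ Remote G C z ∧ G.Adj x z ∧ G.Adj y z) ∧
      τ.reg 69 = if ∃ z : Fin n, (z : ℕ) < m ∧ Remote G C z ∧ G.Adj x z then n else 0)
    (by simp [z₂, z₂']) (fun m τ x h => by simpa using h) (fun z τ hz hF h => ?_)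
  · have F₃ := frame_eval w (.upto 70 mateCmd) σ₂
    generalize (Cmd.upto 70 mateCmd).eval w σ₂ = σ₃ at key F₃ ⊢
    have B₃ := B₂.frame hsafe F₃
    have htouch : σ₃.reg 68 = 0 ↔ ¬ Touches G C y x := by
      rw [key.1, Touches]
      simp only [Fin.is_lt, true_and, hxR, not_or]
    have hmate : σ₃.reg 69 = if HasMate G C x then n else 0 := by
      rw [key.2]
      by_cases hm : HasMate G C x
      · rw [if_pos hm, if_pos (hm.imp fun z hz => ⟨z.isLt, hz⟩)]
      · rw [if_neg hm, if_neg (fun ⟨z, _, hz⟩ => hm ⟨z, hz⟩)]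
    have hs₃ : σ₃.reg 65 = σ.reg 65 := by
      rw [F₃.1 65, r₂ 65 (by omega)]
      rintro (h | h)
      · omega
      · have := mateCmd_writesReg h
        omega
    rw [eval_ifZero B₃.reg_three]
    by_cases ht : Touches G C y x
    · rw [if_neg (fun h => htouch.1 h ht)]
      rw [if_pos ht] at hs ⊢
      simp only [Cmd.eval, Op.eval, State.setReg_reg, if_true, hs₃, B₃.reg_four, hmate,
        Nat.reduceEqDiff, if_false]
      rw [Nat.mod_eq_of_lt (show σ.reg 65 + 1 < 2 ^ w by omega), Nat.mod_eq_of_lt (by omega),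
        add_assoc]
    · rw [if_pos (htouch.2 ht), if_neg ht, Cmd.eval.eq_1, hs₃, add_zero]
  · have hτ := B₂.frame hsafe hF
    have hr : ∀ r, r < 67 → τ.reg r = σ.reg r := by
      intro r hr
      rw [hF.1 r, r₂ r (by omega)]
      rintro (h | h)
      · omega
      · have := mateCmd_writesReg h
        omega
    have hm : τ.mem 2 = σ.mem 2 := by
      rw [hF.2 2 mateCmd_writesMem, m₂]
    simp only [exists_lt_succ_iff]
    rw [not_or, ← and_assoc, ← h.1]
    have hr69 := h.2
    unfold mateCmd
    rw [eval_ifCell hτ.reg_three (by decide), hz, hm]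
    by_cases hzR : Remote G C z
    · rw [if_neg (fun h => (hA z).1 h hzR)]
      have hτ₁ : Base G (τ.setReg w 67 (σ.mem 2 z)) :=
        hτ.setReg (by decide) (by decide) (by decide)
      rw [eval_ifAdj hw hτ₁ (a := x) (b := z) (by simp [hr, hx]) (by simp [hz]) (by decide)
        (by decide)]
      by_cases hxz : G.Adj x z
      · rw [if_pos hxz, Cmd.eval.eq_6]
        have hτ₂ : Base G ((Cmd.arith 69 .add 2 3).eval w
            ((τ.setReg w 67 (σ.mem 2 z)).setReg w 67 1)) :=
          (hτ₁.setReg (by decide) (by decide) (by decide)).setReg (by decide) (by decide)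
            (by decide)
        rw [eval_ifAdj hw hτ₂ (a := y) (b := z) (by simp [Cmd.eval, hr, hy])
          (by simp [Cmd.eval, hz]) (by decide) (by decide)]
        by_cases hyz : G.Adj y z
        · simp [hyz, hzR, hxz, Cmd.eval, Op.eval, hτ.reg_two, hτ.reg_three, Nat.mod_eq_of_lt h1w,
            Nat.mod_eq_of_lt hn]
        · simp [hyz, hzR, hxz, Cmd.eval, Op.eval, hτ.reg_two, hτ.reg_three,
            Nat.mod_eq_of_lt hn]
      · simp [hxz, Cmd.eval, hr69]
    · rw [if_pos ((hA z).2 hzR)]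
      simp [hzR, Cmd.eval, hr69]

theorem eval_weightsCmd (hw : n * (n + 1) < 2 ^ w) (hσ : Base G σ) {C : Fin 7 → Fin n}
    (hA : HoldsAttached w G C σ) : HoldsWeights G C (weightsCmd.eval w σ) := by
  classical
  have hn := lt_of_bound hw
  have hsafe := safe_weightsCmd
  intro y
  unfold weightsCmd at hsafe ⊢
  refine eval_upto hn hσ.reg_two (fun k τ => ∀ y : Fin n, (y : ℕ) < k →
    τ.mem 3 y = weight G C y) (by simp) (fun _ _ _ h => h) (fun k τ hk hF h => ?_) y y.isLt
  have hτ := hσ.frame hsafe hF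
  have hAτ : HoldsAttached w G C τ := by
    intro x
    rw [hF.2 2 (fun h => by simpa using weightsCmd_writesMem h), hA]
  rw [Cmd.eval.eq_6, Cmd.eval.eq_6]
  have B₁ : Base G ((Cmd.const 65 0).eval w τ) :=
    hτ.setReg (by decide) (by decide) (by decide)
  have r₁ : ((Cmd.const 65 0).eval w τ).reg 64 = k := by simp [Cmd.eval, hk]
  have z₁ : ((Cmd.const 65 0).eval w τ).reg 65 = 0 := by simp [Cmd.eval]
  have m₁ : ((Cmd.const 65 0).eval w τ).mem = τ.mem := rfl
  generalize (Cmd.const 65 0).eval w τ = σ₁ at B₁ r₁ z₁ m₁ ⊢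
  -- the contribution of a vertex
  let f : Fin n → ℕ := fun x =>
    if Touches G C k x then 1 + (if HasMate G C x then n else 0) else 0
  let S : ℕ → Finset (Fin n) := fun m => Finset.univ.filter fun z => (z : ℕ) < m
  have hweight : weight G C k = ∑ x, f x := by
    unfold weight
    rw [Finset.sum_filter]
    simp [f]
  have hsucc : ∀ x : Fin n, ∑ z ∈ S (x + 1), f z = ∑ z ∈ S x, f z + f x := by
    intro x
    have : S (x + 1) = insert x (S x) := by
      ext z
      simp only [S, Finset.mem_filter, Finset.mem_univ, true_and, Finset.mem_insert, Fin.ext_iff]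
      omega
    rw [this, Finset.sum_insert (by simp [S]), add_comm]
  have hbound : ∀ m, ∑ z ∈ S m, f z < 2 ^ w := fun m =>
    lt_of_le_of_lt ((Finset.sum_le_sum_of_subset (Finset.filter_subset _ _)).trans
      (hweight.symm.le.trans (weight_le C k))) hw
  have wr : ∀ r, (Cmd.upto 66 (ifCell 67 2 66 .skip touchCmd)).WritesReg r → 65 ≤ r := by
    rintro r (h | h)
    · omega
    · simp only [ifCell, ifZero, WritesReg] at h
      have := @touchCmd_writesReg r
      grind
  have wm : ∀ a, ¬ (Cmd.upto 66 (ifCell 67 2 66 .skip touchCmd)).WritesMem a := by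
    intro a
    simp [ifCell, ifZero, WritesMem, touchCmd_writesMem]
  have safe₂ : Safe (.upto 66 (ifCell 67 2 66 .skip touchCmd)) :=
    .of_bounds (fun r h => by have := wr r h; omega) (fun a h => absurd h (wm a))
  have key := eval_upto (w := w) hn (i := 66) (p := ifCell 67 2 66 .skip touchCmd) B₁.reg_two
    (fun m τ => τ.reg 65 = ∑ z ∈ S m, f z)
    (by simp [z₁, S]) (fun m τ x h => by simpa using h) (fun x τ' hx hF' h' => ?_)
  · have F₂ := frame_eval w (.upto 66 (ifCell 67 2 66 .skip touchCmd)) σ₁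
    generalize (Cmd.upto 66 (ifCell 67 2 66 .skip touchCmd)).eval w σ₁ = σ₂ at key F₂ ⊢
    have hsum : σ₂.reg 65 = weight G C k := by
      rw [key, hweight]
      congr 1
      ext z
      simp [S]
    have hk₂ : σ₂.reg 64 = k := by
      rw [F₂.1 64 (fun h => by have := wr _ h; omega), r₁]
    have hm₂ : σ₂.mem 3 = τ.mem 3 := by rw [F₂.2 3 (wm 3), m₁]
    intro y hy
    rw [Cmd.eval.eq_5, State.setMem_mem, hk₂, hsum, hm₂]
    by_cases hyk : y = k
    · subst hyk
      rw [if_pos ⟨rfl, rfl⟩, Nat.mod_eq_of_lt (lt_of_le_of_lt (weight_le C y) hw)]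
    · have hne : (y : ℕ) ≠ k := fun e => hyk (Fin.ext e)
      rw [if_neg (fun e => hne e.2), h y (by omega)]
  · have hτ' := B₁.frame safe₂ hF'
    have hm' : τ'.mem 2 = τ.mem 2 := by rw [hF'.2 2 (wm 2), m₁]
    have hk' : τ'.reg 64 = k := by
      rw [hF'.1 64 (fun h => by have := wr _ h; omega), r₁]
    have hAτ' : HoldsAttached w G C τ' := fun x => by rw [hm', hAτ]
    have hb := hbound (x + 1)
    rw [hsucc] at hb ⊢
    rw [eval_ifCell hτ'.reg_three (by decide), hx]
    by_cases hxR : Remote G C x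
    · rw [if_neg (fun h => (hAτ' x).1 h hxR), eval_touchCmd hw
        (hτ'.setReg (by decide) (by decide) (by decide)) (C := C) (x := x) (y := k) hAτ'
        (by simp [hk']) (by simp [hx]) hxR]
      · simp [h', f]
      · simpa [h', f] using hb
    · rw [if_pos ((hAτ' x).2 hxR)]
      have : f x = 0 := if_neg fun h => hxR h.1
      simp [Cmd.eval, h', this]

/-! ### The program -/

/-- Test all guesses for a coloring `κ` of the `7`-gon, until one succeeds. -/
def searchCmd (κ : Fin 7 → Fin 3) : Cmd :=
  nest (colorPairs.map guessReg) (ifZero 0 (guessCmd κ) .skip)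

/-- All maps from the `7`-gon to the colors. The definition is irreducible to keep the `3 ^ 7`
entries from being unfolded. -/
@[irreducible] def gonColorings : List (Fin 7 → Fin 3) := FinEnum.toList (Fin 7 → Fin 3)

theorem mem_gonColorings (κ : Fin 7 → Fin 3) : κ ∈ gonColorings := by
  unfold gonColorings
  exact FinEnum.mem_toList κ

/-- The whole computation: find a `7`-gon, mark its neighbors in array `2`, compute the weights,
and test all guesses. -/
def colorCmd : Cmd :=
  .seq findGon (.seq (markSeen 2 fun _ => 0) (.seq weightsCmd (seqs (gonColorings.map searchCmd))))

theorem mem_guessRegs {r : ℕ} (h : r ∈ colorPairs.map guessReg) : 31 ≤ r ∧ r ≤ 37 := by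
  have : ∀ r ∈ colorPairs.map guessReg, 31 ≤ r ∧ r ≤ 37 := by decide
  exact this r h

theorem searchBody_writesReg {κ : Fin 7 → Fin 3} {r : ℕ}
    (h : (ifZero 0 (guessCmd κ) .skip).WritesReg r) : r = 0 ∨ 50 ≤ r := by
  rcases h with h | h
  · exact guessCmd_writesReg h
  · exact h.elim

/-- What holds throughout the search. -/
structure Searching (G : SimpleGraph (Fin n)) (C : Fin 7 → Fin n) (σ : State) : Prop where
  base : Base G σ
  gon : HoldsGon C σ
  weights : HoldsWeights G C σ
  sound : Sound G σ

theorem Sound.of_eq (h : Sound G σ) (h0 : τ.reg 0 = σ.reg 0) (h1 : τ.mem 1 = σ.mem 1) :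
    Sound G τ := by
  unfold Sound
  rw [h0, h1]
  exact h

theorem Searching.setReg {C : Fin 7 → Fin n} (h : Searching G C σ) {r : ℕ} (hr : 30 ≤ r) (x : ℕ) :
    Searching G C (σ.setReg w r x) := by
  refine ⟨h.base.setReg (by omega) (by omega) (by omega), fun i => ?_, h.weights,
    h.sound.of_eq ?_ rfl⟩
  · rw [State.setReg_reg, if_neg (by omega), h.gon i]
  · rw [State.setReg_reg, if_neg (by omega)]

theorem eval_searchBody (hw : n * (n + 1) < 2 ^ w) {C : Fin 7 → Fin n} (h : Searching G C σ)
    {g : Fin 3 → Fin 3 → Fin n} (hg : HoldsGuess g σ) (κ : Fin 7 → Fin 3) :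
    Searching G C ((ifZero 0 (guessCmd κ) .skip).eval w σ) ∧
      (σ.reg 0 = 1 ∨ IsSolvable G (propagate G (Forbidden G C κ g)) →
        ((ifZero 0 (guessCmd κ) .skip).eval w σ).reg 0 = 1) := by
  rw [eval_ifZero h.base.reg_three]
  by_cases h0 : σ.reg 0 = 0
  · rw [if_pos h0]
    have F := frame_eval w (guessCmd κ) σ
    obtain ⟨h1, h2⟩ := guessCmd_spec hw h.base h.gon h.weights hg h0 κ
    refine ⟨⟨h.base.eval (safe_guessCmd κ), h.gon.frame F fun r hr => ?_,
      h.weights.frame F fun hr => ?_, h1⟩, fun h' => h2 (h'.resolve_left (by omega))⟩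
    · have := guessCmd_writesReg hr
      omega
    · have := guessCmd_writesMem hr
      omega
  · rw [if_neg h0, Cmd.eval.eq_1]
    exact ⟨h, fun _ => (h.sound.resolve_left h0).1⟩

/-- The search keeps a coloring once it is found, and finds one if some guess leads to solvable
lists. -/
theorem eval_searchCmd (hw : n * (n + 1) < 2 ^ w) {C : Fin 7 → Fin n} (h : Searching G C σ)
    (κ : Fin 7 → Fin 3) :
    Searching G C ((searchCmd κ).eval w σ) ∧ (σ.reg 0 = 1 → ((searchCmd κ).eval w σ).reg 0 = 1) ∧
      ((∃ g, IsSolvable G (propagate G (Forbidden G C κ g))) →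
        ((searchCmd κ).eval w σ).reg 0 = 1) := by
  -- the guess found in the registers; the pairs of equal colors have no register
  have hread : ∀ τ : State, (∀ i ∈ colorPairs.map guessReg, ∃ v : Fin n, τ.reg i = v) →
      ∃ g : Fin 3 → Fin 3 → Fin n, HoldsGuess g τ := by
    intro τ hτ
    have : ∀ k c : Fin 3, ∃ v : Fin n, (k, c) ∈ colorPairs → τ.reg (guessReg (k, c)) = v := by
      intro k c
      by_cases hp : (k, c) ∈ colorPairs
      · obtain ⟨v, hv⟩ := hτ _ (List.mem_map_of_mem hp)
        exact ⟨v, fun _ => hv⟩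
      · exact ⟨C 0, fun h => absurd h hp⟩
    choose g hg using this
    exact ⟨g, fun p hp => hg p.1 p.2 hp⟩
  have body : ∀ i ∈ colorPairs.map guessReg, ¬ (ifZero 0 (guessCmd κ) .skip).WritesReg i :=
    fun i hi h => by
      have := mem_guessRegs hi
      have := searchBody_writesReg h
      omega
  have hnodup : (colorPairs.map guessReg).Nodup := by decide
  have hset : ∀ τ : State, ∀ i ∈ colorPairs.map guessReg, ∀ x, τ.reg 0 = 1 →
      (τ.setReg w i x).reg 0 = 1 := fun τ i hi x h => by
    have := mem_guessRegs hi
    rw [State.setReg_reg, if_neg (by omega), h]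
  refine ⟨?_, fun h0 => ?_, ?_⟩
  · refine (eval_nest (lt_of_bound hw) hnodup body (Searching G C) (fun _ => True) (fun _ => C 0)
      (fun τ h => h.base.reg_two)
      (fun τ i hi x h => h.setReg (by have := mem_guessRegs hi; omega) x)
      (fun _ _ _ _ _ => trivial) (fun τ hv h => ?_) (fun _ _ _ _ => trivial)
      (fun _ _ _ => trivial) h).1
    obtain ⟨g, hg⟩ := hread τ hv
    exact (eval_searchBody hw h hg κ).1
  · refine (eval_nest (lt_of_bound hw) hnodup body (fun τ => Searching G C τ ∧ τ.reg 0 = 1)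
      (fun _ => True) (fun _ => C 0)
      (fun τ h => h.1.base.reg_two)
      (fun τ i hi x h => ⟨h.1.setReg (by have := mem_guessRegs hi; omega) x, hset τ i hi x h.2⟩)
      (fun _ _ _ _ _ => trivial) (fun τ hv h => ?_) (fun _ _ _ _ => trivial)
      (fun _ _ _ => trivial) ⟨h, h0⟩).1.2
    obtain ⟨g, hg⟩ := hread τ hv
    exact (eval_searchBody hw h.1 hg κ).imp id fun h' => h' (Or.inl h.2)
  · rintro ⟨g, hs⟩
    refine (eval_nest (lt_of_bound hw) hnodup body (Searching G C) (fun τ => τ.reg 0 = 1)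
      -- the inverse of `guessReg`
      (fun r => g (Fin.ofNat 3 ((r - 30) / 3)) (Fin.ofNat 3 ((r - 30) % 3)))
      (fun τ h => h.base.reg_two)
      (fun τ i hi x h => h.setReg (by have := mem_guessRegs hi; omega) x)
      hset (fun τ hv h => ?_) (fun τ hv h h0 => ?_) (fun τ hv h => ?_) h).2
    · obtain ⟨g, hg⟩ := hread τ hv
      exact (eval_searchBody hw h hg κ).1
    · obtain ⟨g, hg⟩ := hread τ hv
      exact (eval_searchBody hw h hg κ).2 (Or.inl h0)
    · refine (eval_searchBody hw h (g := g) (fun p hp => ?_) κ).2 (Or.inr hs)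
      rw [hv _ (List.mem_map_of_mem hp)]
      have : ∀ p : Fin 3 × Fin 3, Fin.ofNat 3 ((guessReg p - 30) / 3) = p.1 ∧
          Fin.ofNat 3 ((guessReg p - 30) % 3) = p.2 := by decide
      rw [(this p).1, (this p).2]

theorem eval_searchCmds (hw : n * (n + 1) < 2 ^ w) {C : Fin 7 → Fin n} (h : Searching G C σ) :
    Searching G C ((seqs (gonColorings.map searchCmd)).eval w σ) ∧
      ((∃ κ g, IsSolvable G (propagate G (Forbidden G C κ g))) →
        ((seqs (gonColorings.map searchCmd)).eval w σ).reg 0 = 1) := by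
  have := eval_seqs (w := w) searchCmd gonColorings (fun pre τ => Searching G C τ ∧
    ((∃ κ ∈ pre, ∃ g, IsSolvable G (propagate G (Forbidden G C κ g))) → τ.reg 0 = 1)) (σ := σ)
    ⟨h, by simp⟩ (fun pre κ τ _ h _ => ?_)
  · refine ⟨this.1, fun ⟨κ, hκ⟩ => this.2 ⟨κ, mem_gonColorings κ, hκ⟩⟩
  · obtain ⟨h1, h2, h3⟩ := eval_searchCmd hw h.1 κ
    refine ⟨h1, ?_⟩
    rintro ⟨κ', hκ', hg⟩
    rw [List.mem_append, List.mem_singleton] at hκ'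
    rcases hκ' with hκ' | rfl
    · exact h2 (h.2 ⟨κ', hκ', hg⟩)
    · exact h3 hg

/-- If there is a coloring, its restriction to the `7`-gon and the guesses it justifies are among
those tested. -/
theorem eval_colorCmd (hw : n * (n + 1) < 2 ^ w) (hclean : IsClean G) (hconn : G.Connected)
    (h7 : ¬ (SimpleGraph.pathGraph 7).IsIndContained G)
    (h3 : ¬ (SimpleGraph.cycleGraph 3).IsIndContained G) {C₀ : Fin 7 → Fin n} (hC₀ : IsGon G C₀)
    (hσ : Base G σ) (h0 : σ.reg 0 = 0) (hm : σ.mem 2 = 0) :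
    IsThreeColoringOutput G (colorCmd.eval w σ) := by
  simp only [colorCmd, Cmd.eval.eq_6]
  obtain ⟨C, hC, C₁⟩ := eval_findGon hw hσ hC₀
  have F₁ := frame_eval w findGon σ
  generalize findGon.eval w σ = σ₁ at C₁ F₁ ⊢
  have B₁ := hσ.frame safe_findGon F₁
  have z₁ : σ₁.reg 0 = 0 := by
    rw [F₁.1 0 (fun h => by have := findGon_writesReg h; omega), h0]
  have m₁ : σ₁.mem 2 = 0 := by rw [F₁.2 2 findGon_writesMem, hm]
  have v₂ := view_markSeen hw B₁ (b := 2) (by decide) C₁ (fun _ => 0) 0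
  have F₂ := frame_eval w (markSeen 2 fun _ => 0) σ₁
  generalize (markSeen 2 fun _ => 0).eval w σ₁ = σ₂ at v₂ F₂ ⊢
  have B₂ := B₁.frame (safe_markSeen (by decide) _) F₂
  have C₂ := C₁.frame F₂ fun r h => by have := markSeen_writesReg h; omega
  have z₂ : σ₂.reg 0 = 0 := by
    rw [F₂.1 0 (fun h => by have := markSeen_writesReg h; omega), z₁]
  have A₂ : HoldsAttached w G C σ₂ := by
    intro x
    have : view n w 2 σ₂ 0 x ↔ σ₂.mem 2 x % 2 ^ w ≠ 0 := Iff.rfl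
    rw [← this, v₂]
    simp [view, m₁, SeesColor, Remote]
  have W₃ := eval_weightsCmd hw B₂ A₂
  have F₃ := frame_eval w weightsCmd σ₂
  generalize weightsCmd.eval w σ₂ = σ₃ at W₃ F₃ ⊢
  have B₃ := B₂.frame safe_weightsCmd F₃
  have C₃ := C₂.frame F₃ fun r h => by have := weightsCmd_writesReg h; omega
  have z₃ : σ₃.reg 0 = 0 := by
    rw [F₃.1 0 (fun h => by have := weightsCmd_writesReg h; omega), z₂]
  obtain ⟨h1, h2⟩ := eval_searchCmds hw (⟨B₃, C₃, W₃, Or.inl z₃⟩ : Searching G C σ₃)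
  rcases h1.sound with h | h
  · refine Or.inr ⟨h, ?_⟩
    rintro ⟨col⟩
    obtain ⟨g, hg⟩ := exists_isGuess hC col
    have hs : IsSolvable G (propagate G (Forbidden G C (fun i => col (C i)) g)) :=
      ⟨hg.exists_forbidden hclean hconn h7 h3 hC (le_propagate _)
        (isPropagated_propagate _), col, not_propagate hg.not_forbidden⟩
    have := h2 ⟨_, g, hs⟩
    omega
  · exact Or.inl h

/-! ### The running time -/

theorem wellFormed_all3 {f : Fin 3 → Cmd} (h : ∀ c, (f c).WellFormed) : (all3 f).WellFormed :=
  ⟨h 0, h 1, h 2⟩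

theorem depth_all3_le {f : Fin 3 → Cmd} {d : ℕ} (h : ∀ c, (f c).depth ≤ d) :
    (all3 f).depth ≤ d :=
  max_le (h 0) (max_le (h 1) (h 2))

theorem WellFormed.seq {p q : Cmd} (hp : p.WellFormed) (hq : q.WellFormed) :
    (Cmd.seq p q).WellFormed :=
  ⟨hp, hq⟩

theorem depth_seq_le {p q : Cmd} {d : ℕ} (hp : p.depth ≤ d) (hq : q.depth ≤ d) :
    (Cmd.seq p q).depth ≤ d :=
  max_le hp hq

theorem wellFormed_propagateCmd : propagateCmd.WellFormed := by
  simp [propagateCmd, propagateRoundCmd, propagateColorCmd, all3, ifAdj, ifCell, ifZero, WellFormed,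
    WritesReg]

theorem depth_propagateCmd_le : propagateCmd.depth ≤ 3 := by
  simp [propagateCmd, propagateRoundCmd, propagateColorCmd, all3, ifAdj, ifCell, ifZero, depth]

theorem wellFormed_copyMarks (s d : ℕ) : (copyMarks s d).WellFormed := by
  simp [copyMarks, copyArray, all3, ifCell, ifZero, WellFormed, WritesReg]

theorem depth_copyMarks_le (s d : ℕ) : (copyMarks s d).depth ≤ 1 := by
  simp [copyMarks, copyArray, all3, ifCell, ifZero, depth]

theorem wellFormed_solveCmd : solveCmd.WellFormed := by
  refine ⟨wellFormed_all3 fun a => ⟨wellFormed_copyMarks _ _, wellFormed_all3 fun c => ?_,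
    wellFormed_propagateCmd, ?_, wellFormed_copyMarks _ _, trivial⟩, fun h => ?_, by decide,
    by decide⟩
  · split_ifs <;> trivial
  · simp [checkEmpty, ifCell, ifZero, WellFormed, WritesReg]
  · rcases h with h | h | h <;> exact absurd (trialCmd_writesReg h) (by omega)

theorem depth_solveCmd_le : solveCmd.depth ≤ 4 := by
  refine Nat.succ_le_succ (depth_all3_le fun a => max_le
    ((depth_copyMarks_le _ _).trans (by decide)) (max_le (depth_all3_le fun c => ?_)
    (max_le depth_propagateCmd_le (max_le ?_ (max_le
    ((depth_copyMarks_le _ _).trans (by decide)) (Nat.zero_le _))))))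
  · split_ifs <;> exact Nat.zero_le _
  · simp [checkEmpty, ifCell, ifZero, depth]

theorem wellFormed_markSeen (b : ℕ) (κ : Fin 7 → Fin 3) : (markSeen b κ).WellFormed := by
  simp [markSeen, wellFormed_seqs, writesReg_seqs, ifAdj, ifZero, WellFormed, WritesReg]

theorem depth_markSeen_le (b : ℕ) (κ : Fin 7 → Fin 3) : (markSeen b κ).depth ≤ 1 := by
  refine Nat.succ_le_succ (depth_seqs_le ?_)
  simp [ifAdj, ifZero, depth]

theorem wellFormed_markAllBut (a : Fin 3) (r : ℕ) : (markAllBut a r).WellFormed :=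
  wellFormed_all3 fun c => by split_ifs <;> trivial

theorem depth_markAllBut_le (a : Fin 3) (r : ℕ) : (markAllBut a r).depth ≤ 0 :=
  depth_all3_le fun c => by split_ifs <;> exact Nat.zero_le _

theorem wellFormed_buildCmd (κ : Fin 7 → Fin 3) : (buildCmd κ).WellFormed := by
  refine ⟨?_, wellFormed_markSeen _ _, ?_, wellFormed_seqs.2 ?_, wellFormed_seqs.2 ?_⟩
  · simp [clearMarks, all3, WellFormed, WritesReg]
  · refine ⟨⟨?_, wellFormed_seqs.2 ?_⟩, fun h => ?_, by decide, by decide⟩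
    · simp [loadMarks, WellFormed]
    · rintro _ hp
      obtain ⟨p, -, rfl⟩ := List.mem_map.1 hp
      simp [markHeavyAt, ifZero, WellFormed]
    · rcases h with h | h
      · simp [loadMarks, WritesReg] at h
      · exact absurd (markHeavyAts_writesReg h) (by decide)
  all_goals
    rintro _ hp
    obtain ⟨_, -, rfl⟩ := List.mem_map.1 hp
    exact wellFormed_markAllBut _ _

theorem depth_buildCmd_le (κ : Fin 7 → Fin 3) : (buildCmd κ).depth ≤ 1 := by
  refine max_le ?_ (max_le (depth_markSeen_le _ _) (max_le (Nat.succ_le_succ (max_le ?_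
    (depth_seqs_le ?_))) (max_le (depth_seqs_le ?_) (depth_seqs_le ?_))))
  · simp [clearMarks, all3, depth]
  · simp [loadMarks, depth]
  · rintro _ hp
    obtain ⟨p, -, rfl⟩ := List.mem_map.1 hp
    simp [markHeavyAt, ifZero, depth]
  all_goals
    rintro _ hp
    obtain ⟨_, -, rfl⟩ := List.mem_map.1 hp
    exact (depth_markAllBut_le _ _).trans (by decide)

theorem wellFormed_guessCmd (κ : Fin 7 → Fin 3) : (guessCmd κ).WellFormed := by
  refine ⟨wellFormed_buildCmd κ, wellFormed_propagateCmd, wellFormed_copyMarks _ _,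
    wellFormed_solveCmd, ?_, ?_, ?_⟩
  · simp [extractCmd, ifCell, ifZero, WellFormed, WritesReg]
  · simp [checkProper, ifAdj, ifZero, WellFormed, WritesReg]
  · simp [ifZero, WellFormed]

theorem depth_guessCmd_le (κ : Fin 7 → Fin 3) : (guessCmd κ).depth ≤ 4 := by
  refine max_le ((depth_buildCmd_le κ).trans (by decide)) (max_le (depth_propagateCmd_le.trans
    (by decide)) (max_le ((depth_copyMarks_le _ _).trans (by decide)) (max_le depth_solveCmd_le
    (max_le ?_ (max_le ?_ ?_)))))
  · simp [extractCmd, ifCell, ifZero, depth]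
  · simp [checkProper, ifAdj, ifZero, depth]
  · simp [ifZero, depth]

theorem wellFormed_findGon : findGon.WellFormed := by
  refine wellFormed_nest ⟨⟨by decide, by decide⟩, wellFormed_seqs.2 ?_, wellFormed_seqs.2 ?_,
    trivial⟩ (by decide) (fun i hi => ⟨fun h => ?_, ?_⟩)
  · rintro _ hp
    obtain ⟨p, -, rfl⟩ := List.mem_map.1 hp
    unfold testPair
    split_ifs <;> simp [ifAdj, ifZero, WellFormed]
  · rintro _ hp
    obtain ⟨i, -, rfl⟩ := List.mem_map.1 hp
    exact ⟨by omega, by omega⟩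
  · have := testGon_writesReg h
    simp only [List.mem_cons, List.not_mem_nil, or_false] at hi
    omega
  · simp only [List.mem_cons, List.not_mem_nil, or_false] at hi
    omega

theorem depth_findGon_le : findGon.depth ≤ 7 := by
  have h1 : (seqs (indexPairs.map testPair)).depth ≤ 0 := by
    refine depth_seqs_le fun _ hp => ?_
    obtain ⟨p, -, rfl⟩ := List.mem_map.1 hp
    unfold testPair
    split_ifs <;> simp [ifAdj, ifZero, depth]
  have h2 : testGon.depth ≤ 0 := by
    refine max_le (Nat.zero_le _) (max_le h1 (max_le (depth_seqs_le fun _ hp => ?_)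
      (Nat.zero_le _)))
    obtain ⟨i, -, rfl⟩ := List.mem_map.1 hp
    exact Nat.zero_le _
  have h3 : ∀ p, (nest [10, 11, 12, 13, 14, 15, 16] p).depth = 7 + p.depth := fun p => by
    simp [depth_nest]
  rw [findGon, h3]
  omega

theorem wellFormed_searchCmd (κ : Fin 7 → Fin 3) : (searchCmd κ).WellFormed := by
  refine wellFormed_nest ⟨wellFormed_guessCmd κ, trivial⟩ (by decide) (fun i hi => ?_)
  have := mem_guessRegs hi
  refine ⟨fun h => ?_, by omega, by omega⟩
  have := searchBody_writesReg h
  omega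

/-- The six guesses cost six loops around the four of `solveCmd`. -/
theorem depth_searchCmd_le (κ : Fin 7 → Fin 3) : (searchCmd κ).depth ≤ 10 := by
  rw [searchCmd, depth_nest]
  exact Nat.add_le_add (le_refl 6) (max_le (depth_guessCmd_le κ) (Nat.zero_le _))

theorem wellFormed_weightsCmd : weightsCmd.WellFormed := by
  simp [weightsCmd, touchCmd, mateCmd, ifAdj, ifCell, ifZero, WellFormed, WritesReg]

theorem depth_weightsCmd_le : weightsCmd.depth ≤ 3 := by
  simp [weightsCmd, touchCmd, mateCmd, ifAdj, ifCell, ifZero, depth]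

theorem wellFormed_colorCmd : colorCmd.WellFormed := by
  have h1 := wellFormed_markSeen 2 fun _ => 0
  have h2 : (seqs (gonColorings.map searchCmd)).WellFormed := by
    refine wellFormed_seqs.2 fun _ hp => ?_
    obtain ⟨κ, -, rfl⟩ := List.mem_map.1 hp
    exact wellFormed_searchCmd κ
  unfold colorCmd
  exact wellFormed_findGon.seq (h1.seq (wellFormed_weightsCmd.seq h2))

theorem depth_colorCmd_le : colorCmd.depth ≤ 10 := by
  have h1 := depth_findGon_le
  have h2 := depth_markSeen_le 2 fun _ => 0
  have h3 := depth_weightsCmd_le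
  have h4 : (seqs (gonColorings.map searchCmd)).depth ≤ 10 := by
    refine depth_seqs_le fun _ hp => ?_
    obtain ⟨κ, -, rfl⟩ := List.mem_map.1 hp
    exact depth_searchCmd_le κ
  unfold colorCmd
  exact depth_seq_le (by omega) (depth_seq_le (by omega) (depth_seq_le (by omega) h4))

end Cmd

open CleanGraph

/-- The whole program. The input has `n` in register `0`; it is copied to register `2`, register
`4` is set to `1`, and register `0` is cleared to hold the answer. Register `3` is `0` from the
start. -/
def colorProg : Prog :=
  .seq (.arith 2 .add 0 3) (.seq (.const 4 1) (.seq (.const 0 0) Cmd.colorCmd.compile))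

/-- Words of this length can hold `n * (n + 1)`, and thereby all addresses and weights. -/
theorem bound_of_log_le {n w : ℕ} (h : 2 * (Nat.log 2 n + 1) ≤ w) : n * (n + 1) < 2 ^ w := by
  have h1 : n + 1 ≤ 2 ^ (Nat.log 2 n + 1) := Nat.lt_pow_succ_log_self (by decide) n
  have h2 : 2 ^ (2 * (Nat.log 2 n + 1)) ≤ 2 ^ w := Nat.pow_le_pow_right (by decide) h
  rw [two_mul, pow_add] at h2
  nlinarith

theorem exec_colorProg {n w : ℕ} {G : SimpleGraph (Fin n)} (hw : n * (n + 1) < 2 ^ w)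
    (hclean : IsClean G) (hconn : G.Connected)
    (h7 : ¬ (SimpleGraph.pathGraph 7).IsIndContained G)
    (h3 : ¬ (SimpleGraph.cycleGraph 3).IsIndContained G) {C : Fin 7 → Fin n} (hC : IsGon G C) :
    ∃ (σ : State) (t : ℕ), Exec w colorProg (graphInput G) σ t ∧
      t ≤ (3 + Cmd.colorCmd.coef) * n ^ 10 ∧ IsThreeColoringOutput G σ := by
  have hn : 1 ≤ n := (C 0).pos
  have hnw := Cmd.lt_of_bound hw
  have h1w := Cmd.one_lt_of_bound hw (C 0)
  set σ₀ := (((graphInput G).setReg w 2 n).setReg w 4 1).setReg w 0 0 with hσ₀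
  have hB : Cmd.Base G σ₀ := ⟨by simp [σ₀, Nat.mod_eq_of_lt hnw], by simp [σ₀, graphInput],
    by simp [σ₀, Nat.mod_eq_of_lt h1w], rfl⟩
  obtain ⟨t, ht, he⟩ := Cmd.exec_compile hnw Cmd.colorCmd Cmd.wellFormed_colorCmd σ₀ hB.reg_two
    hB.reg_four
  refine ⟨_, 1 + (1 + (1 + t)), .seq ?_ (.seq (.const _ _ _) (.seq (.const _ _ _) he)), ?_,
    Cmd.eval_colorCmd hw hclean hconn h7 h3 hC hB (by simp [σ₀]) ?_⟩
  · have := Exec.arith (w := w) (graphInput G) 2 .add 0 3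
    simpa [Op.eval, graphInput] using this
  · have h1 : 1 ≤ n ^ 10 := Nat.one_le_pow _ _ hn
    have := ht.trans ((Cmd.cost_le hn _).trans
      (Nat.mul_le_mul_left _ (Nat.pow_le_pow_right hn Cmd.depth_colorCmd_le)))
    rw [Nat.add_mul]
    omega
  · funext k
    simp [σ₀, graphInput]

end WordRAM

theorem mainTheorem6 :
    ∃ (p : WordRAM.Prog) (c K : ℕ), ∀ (n : ℕ) (G : SimpleGraph (Fin n)),
      CleanGraph.IsClean G → G.Connected →
      ¬ (SimpleGraph.pathGraph 7).IsIndContained G →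
      ¬ (SimpleGraph.cycleGraph 3).IsIndContained G →
      (SimpleGraph.cycleGraph 7).IsIndContained G →
      ∀ w : ℕ, c * (Nat.log 2 n + 1) ≤ w →
        ∃ (σ : WordRAM.State) (t : ℕ),
          WordRAM.Exec w p (WordRAM.graphInput G) σ t ∧ t ≤ K * n ^ 10 ∧
          WordRAM.IsThreeColoringOutput G σ := by
  refine ⟨WordRAM.colorProg, 2, 3 + WordRAM.Cmd.colorCmd.coef, ?_⟩
  intro n G hclean hconn h7 h3 hgon w hw
  obtain ⟨C, hC⟩ := CleanGraph.exists_isGon hgon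
  exact WordRAM.exec_colorProg (WordRAM.bound_of_log_le hw) hclean hconn h7 h3 hC
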